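/- Let $M$ be a smooth $7$-dimensional manifold and $D\subset TM$ a smooth rank $5$ distribution, with annihilator $D^\perp\subset T^*M$. For $q\in M$ and $p\in D^\perp(q)$ let $A_q^*(p)$ be the skew form on $D(q)$ given by $A_q^*(p)(X,Y)=p([X,Y](q))$ for local sections $X,Y$ of $D$. The first Kronecker index of $D$ at $q$ is the least degree of a nonzero homogeneous polynomial map $B:D^\perp(q)\to D(q)$ with $B(p)\in\ker A_q^*(p)$ for all $p$; it is at most $2$. Assume that it is maximal, i.e. equal to $2$, at every point $q\in M$. Notation. Fix a volume form $\Omega$ on $D(q)$, define $X_p\in D(q)$ by $i_{X_p}\Omega=A_q^*(p)\wedge A_q^*(p)$, and let $D_3(q)=\mathrm{span}\{X_p: p\in D^\perp(q)\}$ (independent of $\Omega$). Let $\pi:\mathbb P(D^\perp)\to M$ be the projectivized annihilator, and on it let $V=\ker\pi_*$, $H=\pi_*^{-1}(D)$, $H_3=\pi_*^{-1}(D_3)$; let $\Lambda$ be the hyperplane distribution $\{v\in T_{[p]}\mathbb P(D^\perp): p(\pi_*v)=0\}$ and $C$ its Cauchy characteristic distribution (equivalently, the projection to $\mathbb P(D^\perp)$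 of the kernel of the restriction to $D^\perp$ of the canonical symplectic form of $T^*M$). Put $L_0=V\oplus C$, $L_{i+1}=L_i+[V,L_i]$; $K_2=H$, and let $K_1(\lambda)$ be the set of values $X(\lambda)$ of local sections $X$ of $H$ with $[C,X](\lambda)\subset H(\lambda)$. For $r\ge 0$ let $\mathcal A_r(\lambda)=H_3(\lambda)+\mathrm{span}\{[L_s,L_t](\lambda): s+t\le r,\ 0\le s,t\le 2\}$, and set $$w(\lambda)=\min\{r:\mathcal A_r(\lambda)\ne H_3(\lambda)\},\qquad i(\lambda)=\min\{i\in\{1,2\}:\mathcal A_{w(\lambda)}(\lambda)\subset K_i(\lambda)\},$$ $$w_D(q)=\min_{\lambda\in\mathbb P(D^\perp)(q)}w(\lambda),\qquad i_D(q)=\max_{\lambda\in\mathbb P(D^\perp)(q)}i(\lambda).$$ Claim. At every point $q\in M$ either $i_D(q)=2$ or $D_3$ is involutive at $q$, i.e. $[D_3,D_3](q)\subset D_3(q)$ ($D_3$ is integrable if and only if it is involutive at every point). Moreover, $w_D(q)=1$ at every point $q$ at which $D_3$ is not involutive. -/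

import Mathlib

open scoped Manifold ContDiff Topology LinearAlgebra.Projectivization

noncomputable section

namespace CorankTwo

/-! ### Distributions and Lie brackets on a smooth manifold -/

section General

variable {E : Type*} [NormedAddCommGroup E] [NormedSpace ℝ E]
  {H : Type*} [TopologicalSpace H] (I : ModelWithCorners ℝ E H)
  {N : Type*} [TopologicalSpace N] [ChartedSpace H N] [IsManifold I ∞ N]

/-- `X` is, near `x`, a smooth section of the family of tangent subspaces `P`. -/
def IsSectionAt (P : ∀ y : N, Submodule ℝ (TangentSpace I y))
    (X : ∀ y : N, TangentSpace I y) (x : N) : Prop :=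
  ∀ᶠ y in 𝓝 x,
    ContMDiffAt I I.tangent ∞ (fun z => (⟨z, X z⟩ : TangentBundle I N)) y ∧ X y ∈ P y

/-- `D` is a smooth distribution of rank `l`: it has a smooth frame of `l` fields near each
point. -/
def IsDistribution (D : ∀ y : N, Submodule ℝ (TangentSpace I y)) (l : ℕ) : Prop :=
  ∀ x : N, ∃ X : Fin l → ∀ y : N, TangentSpace I y,
    (∀ j, IsSectionAt I D (X j) x) ∧
    ∀ᶠ y in 𝓝 x, LinearIndependent ℝ (fun j => X j y) ∧
      Submodule.span ℝ (Set.range fun j => X j y) = D y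

/-- The space `[P, Q](x)` spanned by the values at `x` of the brackets of local sections. -/
def bracketAt (P Q : ∀ y : N, Submodule ℝ (TangentSpace I y)) (x : N) :
    Submodule ℝ (TangentSpace I x) :=
  Submodule.span ℝ {v | ∃ X Y : ∀ y : N, TangentSpace I y,
    IsSectionAt I P X x ∧ IsSectionAt I Q Y x ∧ VectorField.mlieBracket I X Y x = v}

/-- `P` is involutive at `x`: `[P, P](x) ⊆ P(x)`. A distribution is integrable if and only if it
is involutive at each point. -/
def InvolutiveAt (P : ∀ y : N, Submodule ℝ (TangentSpace I y)) (x : N) : Prop :=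
  bracketAt I P P x ≤ P x

/-- The space of the values at `x` of those local sections `X` of `Q` for which
`[P, X](x) ⊆ Q(x)`. (These values form a subspace already; the span only bundles it.) -/
def bracketKer (P Q : ∀ y : N, Submodule ℝ (TangentSpace I y)) (x : N) :
    Submodule ℝ (TangentSpace I x) :=
  Submodule.span ℝ {v | ∃ X : ∀ y : N, TangentSpace I y, IsSectionAt I Q X x ∧ X x = v ∧
    ∀ Z : ∀ y : N, TangentSpace I y, IsSectionAt I P Z x →
      VectorField.mlieBracket I Z X x ∈ Q x}

/-- The annihilator `D^⊥(x)`, identified with the dual of `T_xN / D(x)`. -/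
def annihilator (D : ∀ y : N, Submodule ℝ (TangentSpace I y)) (x : N) :
    Submodule ℝ (TangentSpace I x →L[ℝ] ℝ) where
  carrier := {p | ∀ v ∈ D x, p v = 0}
  add_mem' := fun ha hb v hv => by
    rw [add_apply, ha v hv, hb v hv, add_zero]
  zero_mem' := fun v _ => rfl
  smul_mem' := fun c p hp v hv => by
    rw [smul_apply, hp v hv, smul_zero]

/-- The 1-form `α` is smooth near `x`. -/
def IsSmoothFormAt (α : ∀ y : N, TangentSpace I y →L[ℝ] ℝ) (x : N) : Prop :=
  ∀ᶠ y in 𝓝 x,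
    ContMDiffAt I (I.prod 𝓘(ℝ, E →L[ℝ] ℝ)) ∞
      (fun z => Bundle.TotalSpace.mk' (E →L[ℝ] ℝ)
        (E := fun z : N => TangentSpace I z →L[ℝ] Bundle.Trivial N ℝ z) z (α z)) y

/-! ### The pencil of skew forms, its first Kronecker index, and the subdistribution `D_{k+1}` -/

open Classical in
/-- Some local section of `D` with value `v` at `x` (it exists if `D` is a distribution and
`v ∈ D(x)`). -/
def sectionThrough (D : ∀ y : N, Submodule ℝ (TangentSpace I y)) (x : N)
    (v : TangentSpace I x) : ∀ y : N, TangentSpace I y :=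
  if h : ∃ X : ∀ y : N, TangentSpace I y, IsSectionAt I D X x ∧ X x = v then h.choose
  else fun _ => 0

/-- The pencil `A_x^*(p)(v, w) = p([v, w])`, `v, w ∈ D(x)`, `p ∈ D^⊥(x)`: the bracket is computed
with any local sections of `D` through `v` and `w`, the result does not depend on them. -/
def pencil (D : ∀ y : N, Submodule ℝ (TangentSpace I y)) (x : N)
    (p : TangentSpace I x →L[ℝ] ℝ) (v w : D x) : ℝ :=
  p (VectorField.mlieBracket I (sectionThrough I D x v) (sectionThrough I D x w) x)

/-- The first Kronecker index of the pencil at `x`: the least degree of a nonzero homogeneous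
polynomial map `B : D^⊥(x) → D(x)` with `B(p) ∈ ker A_x^*(p)` for all `p`. A homogeneous polynomial
map of degree `d` is the restriction of a `d`-linear map to the diagonal. -/
def kroneckerIndex (D : ∀ y : N, Submodule ℝ (TangentSpace I y)) (x : N) : ℕ :=
  sInf {d | ∃ B : MultilinearMap ℝ (fun _ : Fin d => annihilator I D x) (D x),
    (∃ p, B (fun _ => p) ≠ 0) ∧
    ∀ p : annihilator I D x, ∀ w : D x, pencil I D x p (B fun _ => p) w = 0}

/-- The `k`-th exterior power of a skew form `φ`, evaluated on `2k` vectors. -/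
def wedgePower {V : Type*} (φ : V → V → ℝ) (k : ℕ) (v : Fin (2 * k) → V) : ℝ :=
  (1 / 2 ^ k) * ∑ σ : Equiv.Perm (Fin (2 * k)), ((Equiv.Perm.sign σ : ℤ) : ℝ) *
    ∏ j : Fin k, φ (v (σ ⟨2 * j, by omega⟩)) (v (σ ⟨2 * j + 1, by omega⟩))

/-- For `D` of rank `2k+1`, the subspace `D_{k+1}(x)` of `D(x)` spanned by the vectors `X_p`,
`p ∈ D^⊥(x)`, where `X_p` is given by `i_{X_p} Ω = ⋀^k A_x^*(p)` for a volume form `Ω` on `D(x)`.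
(Changing `Ω` rescales all `X_p`.) -/
def kernelSpan (k : ℕ) (D : ∀ y : N, Submodule ℝ (TangentSpace I y)) (x : N) :
    Submodule ℝ (TangentSpace I x) :=
  Submodule.span ℝ {v | ∃ Ω : (D x) [⋀^Fin (2 * k + 1)]→ₗ[ℝ] ℝ, Ω ≠ 0 ∧
    ∃ p ∈ annihilator I D x, ∃ X : D x, (X : TangentSpace I x) = v ∧
      ∀ u : Fin (2 * k) → D x,
        Ω (Matrix.vecCons X u) = wedgePower (pencil I D x p) k u}

/-! ### The projectivized annihilator, in affine charts

For `D` of corank 2 and a smooth local frame `(α, β)` of `D^⊥` near `x`, the map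
`(y, t) ↦ [α(y) + t β(y)]` is (near `{x} × ℝ`) a parametrization of an open subset of `ℙ(D^⊥)`, and
each point of the fibre over `x` is covered by such a parametrization. The canonical distributions
of `ℙ(D^⊥)` are written in these coordinates, as distributions on `N × ℝ`. -/

/-- A smooth local frame `(α, β)` of `D^⊥` near `x`. -/
structure AffineChart (D : ∀ y : N, Submodule ℝ (TangentSpace I y)) (x : N) where
  α : ∀ y : N, TangentSpace I y →L[ℝ] ℝ
  β : ∀ y : N, TangentSpace I y →L[ℝ] ℝ
  smooth_α : IsSmoothFormAt I α x
  smooth_β : IsSmoothFormAt I β x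
  frame : ∀ᶠ y in 𝓝 x, LinearIndependent ℝ ![α y, β y] ∧
    Submodule.span ℝ {α y, β y} = annihilator I D y

/-- The lift `π_*^{-1}(P)` of `P` to `N × ℝ`, `π : N × ℝ → N` the projection. -/
def lift (P : ∀ y : N, Submodule ℝ (TangentSpace I y)) (z : N × ℝ) :
    Submodule ℝ (TangentSpace (I.prod 𝓘(ℝ, ℝ)) z) :=
  (P z.1).comap (mfderiv (I.prod 𝓘(ℝ, ℝ)) I (Prod.fst : N × ℝ → N) z).toLinearMap

/-- The vertical distribution `V = π_*^{-1}(0)`. -/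
def vertical (z : N × ℝ) : Submodule ℝ (TangentSpace (I.prod 𝓘(ℝ, ℝ)) z) :=
  lift I (fun _ => ⊥) z

namespace AffineChart

variable {I} {D : ∀ y : N, Submodule ℝ (TangentSpace I y)} {x : N} (c : AffineChart I D x)

/-- `t` is the coordinate, in the chart `c`, of the point `lam` of the fibre `ℙ(D^⊥)(x)`. -/
def IsCoord (t : ℝ) (lam : ℙ ℝ (annihilator I D x)) : Prop :=
  lam.submodule.map (annihilator I D x).subtype = Submodule.span ℝ {c.α x + t • c.β x}

/-- The quasi-contact distribution `Λ` induced by the Liouville form: the vectors `v` at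
`([α(y) + t β(y)], y)` with `(α(y) + t β(y))(π_* v) = 0`. -/
def quasiContact (z : N × ℝ) : Submodule ℝ (TangentSpace (I.prod 𝓘(ℝ, ℝ)) z) :=
  lift I (fun y => LinearMap.ker (c.α y + z.2 • c.β y).toLinearMap) z

/-- The characteristic distribution `C`: the Cauchy characteristic of `Λ`, that is, the projection
to `ℙ(D^⊥)` of the kernel of the restriction of the symplectic form of the cotangent bundle to
`D^⊥`. -/
def characteristic (z : N × ℝ) : Submodule ℝ (TangentSpace (I.prod 𝓘(ℝ, ℝ)) z) :=
  bracketKer (I.prod 𝓘(ℝ, ℝ)) c.quasiContact c.quasiContact z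

/-- `L_0 = V ⊕ C`, `L_{i+1} = L_i + [V, L_i]`. -/
def filtL : ℕ → ∀ z : N × ℝ, Submodule ℝ (TangentSpace (I.prod 𝓘(ℝ, ℝ)) z)
  | 0 => fun z => vertical I z ⊔ c.characteristic z
  | i + 1 => fun z => filtL i z ⊔ bracketAt (I.prod 𝓘(ℝ, ℝ)) (vertical I) (filtL i) z

/-- `filtKDown j` is `K_{k-j}`: first `K_k = H = π_*^{-1}(D)`, then `K_{k-1} = K`, the kernel of the
bracket with `C` from `H` to `Λ / H`, then successively the kernels of the brackets with `V`. -/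
def filtKDown : ℕ → ∀ z : N × ℝ, Submodule ℝ (TangentSpace (I.prod 𝓘(ℝ, ℝ)) z)
  | 0 => lift I D
  | 1 => bracketKer (I.prod 𝓘(ℝ, ℝ)) c.characteristic (lift I D)
  | j + 2 => bracketKer (I.prod 𝓘(ℝ, ℝ)) (vertical I) (filtKDown (j + 1))

/-- `K_i`, `1 ≤ i ≤ k`. -/
def filtK (k i : ℕ) (z : N × ℝ) : Submodule ℝ (TangentSpace (I.prod 𝓘(ℝ, ℝ)) z) :=
  c.filtKDown (k - i) z

/-- `𝒜_r = H_{k+1} + span {[L_s, L_t] : s + t ≤ r, 0 ≤ s, t ≤ k}`, `H_{k+1} = π_*^{-1}(D_{k+1})`. -/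
def spaceA (k r : ℕ) (z : N × ℝ) : Submodule ℝ (TangentSpace (I.prod 𝓘(ℝ, ℝ)) z) :=
  lift I (kernelSpan I k D) z ⊔
    ⨆ (s : ℕ) (t : ℕ) (_ : s + t ≤ r ∧ s ≤ k ∧ t ≤ k),
      bracketAt (I.prod 𝓘(ℝ, ℝ)) (c.filtL s) (c.filtL t) z

end AffineChart

/-! ### The invariants `w_D` and `i_D` -/

variable (k : ℕ) (D : ∀ y : N, Submodule ℝ (TangentSpace I y)) (x : N)

/-- `w(λ) = min {r | 𝒜_r(λ) ≠ H_{k+1}(λ)}` (and `0`, which is never a value of the minimum when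
the Kronecker index is maximal, if there is no such `r`). The condition does not depend on the
chart. -/
def wAt (lam : ℙ ℝ (annihilator I D x)) : ℕ :=
  sInf {r | ∃ (c : AffineChart I D x) (t : ℝ), c.IsCoord t lam ∧
    c.spaceA k r (x, t) ≠ lift I (kernelSpan I k D) (x, t)}

/-- `i(λ) = min {i | 𝒜_{w(λ)}(λ) ⊆ K_i(λ)}`, `1 ≤ i ≤ k`. -/
def iAt (lam : ℙ ℝ (annihilator I D x)) : ℕ :=
  sInf {i | 1 ≤ i ∧ i ≤ k ∧ ∃ (c : AffineChart I D x) (t : ℝ), c.IsCoord t lam ∧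
    c.spaceA k (wAt I k D x lam) (x, t) ≤ c.filtK k i (x, t)}

/-- `w_D(x) = min {w(λ) | λ ∈ ℙ(D^⊥)(x)}`. -/
def wInv : ℕ := sInf (Set.range (wAt I k D x))

/-- `i_D(x) = max {i(λ) | λ ∈ ℙ(D^⊥)(x)}`. -/
def iInv : ℕ := sSup (Set.range (iAt I k D x))

end General

end CorankTwo

end

/-! Let `(α, β)` be a local frame of `D^⊥`, let `p_t = α + tβ`, and let `X_t = e_0 + t e_1 + t² e_2`
be the vector of signed 4×4 sub-Pfaffians of `A^*(p_t)`. It is a quadratic kernel polynomial of the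
pencil. Since there is no kernel polynomial of degree 0 or 1, `X_t` vanishes nowhere and the `e_k`
are independent (`pfv_comb_ne_zero`, `coeffs_eq_zero`), so `D_3 = span(e_0, e_1, e_2)` has rank 3.
Comparing coefficients in `A^*(p_t) X_t = 0` gives `A^*(α)(e_{k+1}, ·) = -θ_k`, where `θ_k =
A^*(β)(e_k, ·)` and `θ_2 = 0`. Hence `D_3` is isotropic for the whole pencil and is cut out in `D`
by `θ_0` and `θ_1` (`mem_kernelSpan_iff`). Isotropy puts `[D_3, D_3]` inside `D`, so involutivity is
measured by the six numbers `θ_k([e_i, e_j])`, `k = 0, 1`.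

The decisive point is the Jacobi identity for `e_0, e_1, e_2` read modulo `D`. It gives two linear
relations between these numbers (`θ_w`). The remaining four are, up to binomial factors, the
coefficients of the cubic `t ↦ θ_t([X_t, X_t'])`, with `θ_t = θ_0 + t θ_1` and with `t` held fixed
inside the bracket (`obstruction_eq`). So if `D_3` is not involutive at a point, the cubic is
nonzero for some `t`.

On `ℙ(D^⊥)` the distribution `C` is spanned by the lift of `X_t` corrected by a vertical term, and
bracketing with `∂_t` differentiates in `t`. So `L_0` projects to the line of `X_t`, `L_1` also
contains a lift of `X_t'`, and `L_2` is `H_3`. A skew form vanishes on a line, hence `𝒜_0 = H_3` and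
`w ≥ 1`. The bracket of the lifts of `X_t` and `X_t'` lies in `𝒜_1`, while `θ_t` kills the
projections of both `H_3` and `K_1`. Where the cubic is nonzero, `𝒜_1` therefore lies in neither
`H_3` nor `K_1`, that is, `w = 1` and `i = 2`.

The invariants accept a witness from any chart. The bound on `w` is proved in every chart, and the
vanishing of the cubic is carried from one chart to another by the condition `DegenerateAt`, which
mentions `D` only. -/

noncomputable section

namespace CorankTwo

/-! ### Lie brackets and Cartan's formula in coordinates -/

section Calculus

set_option linter.unusedSectionVars false
variable {E : Type*} [NormedAddCommGroup E] [NormedSpace ℝ E]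
  {H : Type*} [TopologicalSpace H] (I : ModelWithCorners ℝ E H)
  {N : Type*} [TopologicalSpace N] [ChartedSpace H N] [IsManifold I ∞ N]

/-- The vector field `X`, read in the trivialization of the tangent bundle around `x`. -/
def fieldCoord (x : N) (X : ∀ y : N, TangentSpace I y) (y : N) : E :=
  (trivializationAt E (TangentSpace I) x).continuousLinearMapAt ℝ y (X y)

variable {I}

lemma fieldCoord_self (x : N) (X : ∀ y : N, TangentSpace I y) : fieldCoord I x X x = X x := by
  rw [fieldCoord, TangentBundle.continuousLinearMapAt_trivializationAt (mem_chart_source H x),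
    mfderiv_extChartAt_self]
  rfl

lemma fieldCoord_eq (x : N) (X : ∀ y : N, TangentSpace I y) {y : N}
    (hy : y ∈ (chartAt H x).source) :
    fieldCoord I x X y = (trivializationAt E (TangentSpace I) x ⟨y, X y⟩).2 := by
  rw [fieldCoord, Bundle.Trivialization.continuousLinearMapAt_apply,
    Bundle.Trivialization.linearMapAt_apply, if_pos (by simpa using hy)]

lemma contMDiffAt_fieldCoord {x : N} {X : ∀ y : N, TangentSpace I y} {n : WithTop ℕ∞}
    (hX : ContMDiffAt I I.tangent n (fun z => (⟨z, X z⟩ : TangentBundle I N)) x) :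
    ContMDiffAt I 𝓘(ℝ, E) n (fieldCoord I x X) x := by
  refine (Bundle.contMDiffAt_totalSpace.1 hX).2.congr_of_eventuallyEq ?_
  filter_upwards [(chartAt H x).open_source.mem_nhds (mem_chart_source H x)] with y hy
  exact fieldCoord_eq x X hy

/-- The manifold bracket is defined by pulling fields back to the chart. The inverse of the
derivative of the inverse chart is the derivative of the chart, which is also the trivialization of
the tangent bundle. -/
lemma mpullbackWithin_extChartAt_symm (x : N) (X : ∀ y : N, TangentSpace I y) {u : E}
    (hu : u ∈ (extChartAt I x).target) :
    VectorField.mpullbackWithin 𝓘(ℝ, E) I (extChartAt I x).symm X (Set.range I) u =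
      fieldCoord I x X ((extChartAt I x).symm u) := by
  have hs : (extChartAt I x).symm u ∈ (chartAt H x).source := by
    rw [← extChartAt_source I]; exact (extChartAt I x).map_target hu
  refine (isInvertible_mfderivWithin_extChartAt_symm hu).inverse_apply_eq.2 ?_
  rw [fieldCoord, TangentBundle.continuousLinearMapAt_trivializationAt hs]
  exact (congrArg (fun f => f (X ((extChartAt I x).symm u)))
    (mfderivWithin_extChartAt_symm_comp_mfderiv_extChartAt hu)).symm

/-- The Lie bracket in the coordinates around its base point. -/
theorem mlieBracket_eq_fieldCoord {x : N} {X Y : ∀ y : N, TangentSpace I y}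
    (hX : ContMDiffAt I I.tangent ∞ (fun z => (⟨z, X z⟩ : TangentBundle I N)) x)
    (hY : ContMDiffAt I I.tangent ∞ (fun z => (⟨z, Y z⟩ : TangentBundle I N)) x) :
    (VectorField.mlieBracket I X Y x : E) =
      mvfderiv I (fieldCoord I x Y) x (X x) - mvfderiv I (fieldCoord I x X) x (Y x) := by
  have key : ∀ Z : ∀ y : N, TangentSpace I y,
      ContMDiffAt I I.tangent ∞ (fun z => (⟨z, Z z⟩ : TangentBundle I N)) x →
      fderivWithin ℝ (VectorField.mpullbackWithin 𝓘(ℝ, E) I (extChartAt I x).symm Z (Set.range I))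
        (Set.range I) (extChartAt I x x) = mvfderiv I (fieldCoord I x Z) x := by
    intro Z hZ
    rw [((contMDiffAt_fieldCoord hZ).mdifferentiableAt (by simp)).mvfderiv]
    apply Filter.EventuallyEq.fderivWithin_eq
    · filter_upwards [extChartAt_target_mem_nhdsWithin x] with u hu
      exact mpullbackWithin_extChartAt_symm x Z hu
    · exact mpullbackWithin_extChartAt_symm x Z (mem_extChartAt_target x)
  have val : ∀ Z : ∀ y : N, TangentSpace I y,
      VectorField.mpullbackWithin 𝓘(ℝ, E) I (extChartAt I x).symm Z (Set.range I)
        (extChartAt I x x) = Z x := by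
    intro Z
    rw [mpullbackWithin_extChartAt_symm x Z (mem_extChartAt_target x), extChartAt_to_inv,
      fieldCoord_self]
  refine (isInvertible_mfderiv_extChartAt (mem_extChartAt_source x)).inverse_apply_eq.2 ?_
  rw [mfderiv_extChartAt_self]
  change VectorField.lieBracketWithin ℝ _ _ _ _ = mvfderiv I (fieldCoord I x Y) x (X x) -
    mvfderiv I (fieldCoord I x X) x (Y x)
  refine (congrFun VectorField.lieBracketWithin_eq _).trans ?_
  rw [Set.preimage_univ, Set.univ_inter, key X hX, key Y hY, val X, val Y]
  rfl

/-- The 1-form `α` is smooth at `y`. -/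
def SmoothFormAt (α : ∀ y : N, TangentSpace I y →L[ℝ] ℝ) (y : N) : Prop :=
  ContMDiffAt I (I.prod 𝓘(ℝ, E →L[ℝ] ℝ)) ∞
      (fun z => Bundle.TotalSpace.mk' (E →L[ℝ] ℝ)
        (E := fun z : N => TangentSpace I z →L[ℝ] Bundle.Trivial N ℝ z) z (α z)) y

/-- The vector field `X` is smooth at `y`. -/
def SmoothFieldAt (X : ∀ y : N, TangentSpace I y) (y : N) : Prop :=
  ContMDiffAt I I.tangent ∞ (fun z => (⟨z, X z⟩ : TangentBundle I N)) y

/-- The 1-form `α`, read in the trivialization of the tangent bundle around `x`. -/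
def formCoord (x : N) (α : ∀ y : N, TangentSpace I y →L[ℝ] ℝ) (y : N) : E →L[ℝ] ℝ :=
  (α y).comp ((trivializationAt E (TangentSpace I) x).symmL ℝ y)

lemma formCoord_self (x : N) (α : ∀ y : N, TangentSpace I y →L[ℝ] ℝ) (v : TangentSpace I x) :
    formCoord x α x v = α x v := by
  have h := (trivializationAt E (TangentSpace I) x).symmL_continuousLinearMapAt (R := ℝ)
    (by simp : x ∈ (trivializationAt E (TangentSpace I) x).baseSet) v
  rw [TangentBundle.continuousLinearMapAt_trivializationAt (mem_chart_source H x),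
    mfderiv_extChartAt_self] at h
  exact congrArg (α x) h

lemma formCoord_fieldCoord (x : N) (α : ∀ y : N, TangentSpace I y →L[ℝ] ℝ) {y : N}
    (hy : y ∈ (chartAt H x).source) (v : TangentSpace I y) :
    formCoord x α y ((trivializationAt E (TangentSpace I) x).continuousLinearMapAt ℝ y v) =
      α y v := by
  have h := (trivializationAt E (TangentSpace I) x).symmL_continuousLinearMapAt (R := ℝ)
    (by simpa using hy : y ∈ (trivializationAt E (TangentSpace I) x).baseSet) v
  exact congrArg (α y) h

lemma contMDiffAt_formCoord {x : N} {α : ∀ y : N, TangentSpace I y →L[ℝ] ℝ}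
    (h : SmoothFormAt α x) : ContMDiffAt I 𝓘(ℝ, E →L[ℝ] ℝ) ∞ (formCoord x α) x := by
  refine ((contMDiffAt_hom_bundle _).1 h).2.congr_of_eventuallyEq (.of_eq ?_)
  ext y v
  simp [formCoord, ContinuousLinearMap.inCoordinates]

/-- The derivative at `x` of the 1-form `α`, read in the trivialization around `x`. -/
def formDeriv (α : ∀ y : N, TangentSpace I y →L[ℝ] ℝ) (x : N) :
    TangentSpace I x →L[ℝ] TangentSpace I x →L[ℝ] ℝ :=
  mvfderiv I (formCoord x α) x

/-- The 2-form `-dα` at `x`. -/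
def negExtDeriv (α : ∀ y : N, TangentSpace I y →L[ℝ] ℝ) (x : N) :
    TangentSpace I x →L[ℝ] TangentSpace I x →L[ℝ] ℝ :=
  let T : E →L[ℝ] E →L[ℝ] ℝ := formDeriv α x
  (T.flip - T : E →L[ℝ] E →L[ℝ] ℝ)

lemma negExtDeriv_apply (α : ∀ y : N, TangentSpace I y →L[ℝ] ℝ) (x : N)
    (v w : TangentSpace I x) :
    negExtDeriv α x v w = formDeriv α x w v - formDeriv α x v w := rfl

lemma negExtDeriv_self (α : ∀ y : N, TangentSpace I y →L[ℝ] ℝ) (x : N)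
    (v : TangentSpace I x) : negExtDeriv α x v v = 0 := by
  rw [negExtDeriv_apply, sub_self]

lemma negExtDeriv_swap (α : ∀ y : N, TangentSpace I y →L[ℝ] ℝ) (x : N)
    (v w : TangentSpace I x) : negExtDeriv α x v w = - negExtDeriv α x w v := by
  rw [negExtDeriv_apply, negExtDeriv_apply, neg_sub]

lemma mvfderiv_clm_apply {F E' H' N' : Type*} [NormedAddCommGroup F] [NormedSpace ℝ F]
    [NormedAddCommGroup E'] [NormedSpace ℝ E'] [TopologicalSpace H']
    {I' : ModelWithCorners ℝ E' H'} [TopologicalSpace N'] [ChartedSpace H' N']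
    {g : N' → F →L[ℝ] ℝ} {h : N' → F} {z : N'}
    (hg : MDifferentiableAt I' 𝓘(ℝ, F →L[ℝ] ℝ) g z) (hh : MDifferentiableAt I' 𝓘(ℝ, F) h z)
    (v : TangentSpace I' z) :
    mvfderiv I' (fun y => g y (h y)) z v =
      (mvfderiv I' g z v) (h z) + g z (mvfderiv I' h z v) := by
  rw [(hg.clm_apply hh).mvfderiv, hg.mvfderiv, hh.mvfderiv]
  have h := fderivWithin_clm_apply (x := extChartAt I' z z)
    (I'.uniqueDiffOn _ (Set.mem_range_self _))
    hg.differentiableWithinAt_writtenInExtChartAt hh.differentiableWithinAt_writtenInExtChartAt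
  have h' := congrArg (fun T : E' →L[ℝ] ℝ => T v) h
  have e : (extChartAt I' z).symm (extChartAt I' z z) = z := extChartAt_to_inv z
  simp only [writtenInExtChartAt, extChartAt_model_space_eq_id, PartialEquiv.refl_coe,
    Function.comp_apply, Function.id_comp, id_eq] at h' ⊢
  rw [e, add_comm] at h'
  exact h'

/-- Cartan's formula. By the product rule in coordinates, the derivatives of the fields assemble
into the bracket and those of the form into `-dα`. -/
theorem form_mlieBracket {x : N} {α : ∀ y : N, TangentSpace I y →L[ℝ] ℝ} (hα : SmoothFormAt α x)
    {X Y : ∀ y : N, TangentSpace I y} (hX : SmoothFieldAt X x) (hY : SmoothFieldAt Y x) :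
    α x (VectorField.mlieBracket I X Y x) =
      mvfderiv I (fun y => α y (Y y)) x (X x) - mvfderiv I (fun y => α y (X y)) x (Y x) +
        negExtDeriv α x (X x) (Y x) := by
  have hg := (contMDiffAt_formCoord hα).mdifferentiableAt (by simp)
  have key : ∀ Z : ∀ y : N, TangentSpace I y, SmoothFieldAt Z x → ∀ v : TangentSpace I x,
      mvfderiv I (fun y => α y (Z y)) x v =
      formDeriv α x v (Z x) + formCoord x α x (mvfderiv I (fieldCoord I x Z) x v) := by
    intro Z hZ v
    have hh := (contMDiffAt_fieldCoord hZ).mdifferentiableAt (by simp)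
    have e : (fun y => α y (Z y)) =ᶠ[𝓝 x] fun y => formCoord x α y (fieldCoord I x Z y) := by
      filter_upwards [(chartAt H x).open_source.mem_nhds (mem_chart_source H x)] with y hy
      exact (formCoord_fieldCoord x α hy (Z y)).symm
    have e' : mvfderiv I (fun y => α y (Z y)) x =
        mvfderiv I (fun y => formCoord x α y (fieldCoord I x Z y)) x := by
      rw [mvfderiv, mvfderiv, e.mfderiv_eq, e.eq_of_nhds]
    rw [e', mvfderiv_clm_apply hg hh, fieldCoord_self]
    rfl
  rw [key X hX, key Y hY, negExtDeriv_apply, ← formCoord_self, mlieBracket_eq_fieldCoord hX hY,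
    map_sub]
  ring

/-! ### The product with a line -/

variable (I) in
/-- The differential of the projection `N × ℝ → N`. -/
def horiz (z : N × ℝ) : TangentSpace (I.prod 𝓘(ℝ, ℝ)) z →L[ℝ] TangentSpace I z.1 :=
  ContinuousLinearMap.fst ℝ E ℝ

variable (I) in
/-- The differential of the projection `N × ℝ → ℝ`. -/
def vert (z : N × ℝ) : TangentSpace (I.prod 𝓘(ℝ, ℝ)) z →L[ℝ] ℝ :=
  ContinuousLinearMap.snd ℝ E ℝ

variable (I) in
/-- The tangent vector of `N × ℝ` with components `v` and `s`. -/
def mkVec (z : N × ℝ) (v : TangentSpace I z.1) (s : ℝ) : TangentSpace (I.prod 𝓘(ℝ, ℝ)) z :=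
  ((v, s) : E × ℝ)

@[simp] lemma horiz_mkVec (z : N × ℝ) (v : TangentSpace I z.1) (s : ℝ) :
    horiz I z (mkVec I z v s) = v := rfl

@[simp] lemma vert_mkVec (z : N × ℝ) (v : TangentSpace I z.1) (s : ℝ) :
    vert I z (mkVec I z v s) = s := rfl

lemma mfderiv_fst_eq_horiz (z : N × ℝ) :
    mfderiv (I.prod 𝓘(ℝ, ℝ)) I (Prod.fst : N × ℝ → N) z = horiz I z := mfderiv_fst

lemma mem_lift {P : ∀ y : N, Submodule ℝ (TangentSpace I y)} {z : N × ℝ}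
    {v : TangentSpace (I.prod 𝓘(ℝ, ℝ)) z} : v ∈ lift I P z ↔ horiz I z v ∈ P z.1 := by
  rw [lift, mfderiv_fst_eq_horiz]; rfl

lemma mvfderiv_comp_fst {F : Type*} [NormedAddCommGroup F] [NormedSpace ℝ F] {g : N → F}
    {z : N × ℝ} (hg : MDifferentiableAt I 𝓘(ℝ, F) g z.1)
    (v : TangentSpace (I.prod 𝓘(ℝ, ℝ)) z) :
    mvfderiv (I.prod 𝓘(ℝ, ℝ)) (fun z : N × ℝ => g z.1) z v = mvfderiv I g z.1 (horiz I z v) := by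
  have h := mfderiv_comp z hg (mdifferentiableAt_fst (I := I) (I' := 𝓘(ℝ, ℝ)))
  rw [mfderiv_fst_eq_horiz] at h
  exact congrArg (fun T : E × ℝ →L[ℝ] F => T v) h

lemma mvfderiv_clm_comp {F G E' H' N' : Type*} [NormedAddCommGroup F] [NormedSpace ℝ F]
    [NormedAddCommGroup G] [NormedSpace ℝ G]
    [NormedAddCommGroup E'] [NormedSpace ℝ E'] [TopologicalSpace H']
    {I' : ModelWithCorners ℝ E' H'} [TopologicalSpace N'] [ChartedSpace H' N']
    (T : F →L[ℝ] G) {h : N' → F} {z : N'} (hh : MDifferentiableAt I' 𝓘(ℝ, F) h z)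
    (v : TangentSpace I' z) :
    mvfderiv I' (fun y => T (h y)) z v = T (mvfderiv I' h z v) := by
  have h := mfderiv_comp z (T.mdifferentiableAt (x := h z)) hh
  rw [ContinuousLinearMap.mfderiv_eq] at h
  exact congrArg (fun T : E' →L[ℝ] G => T v) h

/-- The chart of the product is a product of charts, so horizontal components can be read in the
trivialization of `N` alone. This reduces Cartan's formula for pulled-back forms to a computation on
`N`. -/
lemma fieldCoord_prod_fst (x : N) (t : ℝ) (Z : ∀ z : N × ℝ, TangentSpace (I.prod 𝓘(ℝ, ℝ)) z)
    {z : N × ℝ} (hz : z.1 ∈ (chartAt H x).source) :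
    (fieldCoord (I.prod 𝓘(ℝ, ℝ)) (x, t) Z z).1 =
      (trivializationAt E (TangentSpace I) x).continuousLinearMapAt ℝ z.1 (horiz I z (Z z)) := by
  have hz' : z ∈ (chartAt (ModelProd H ℝ) (x, t)).source := by
    simpa [chartAt_self_eq] using hz
  rw [fieldCoord, TangentBundle.continuousLinearMapAt_trivializationAt hz',
    TangentBundle.continuousLinearMapAt_trivializationAt hz]
  have h1 : MDifferentiableAt (I.prod 𝓘(ℝ, ℝ)) 𝓘(ℝ, E × ℝ)
    (extChartAt (I.prod 𝓘(ℝ, ℝ)) (x, t)) z := mdifferentiableAt_extChartAt hz'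
  have h2 : MDifferentiableAt I 𝓘(ℝ, E) (extChartAt I x) z.1 := mdifferentiableAt_extChartAt hz
  have e : (fun p => ContinuousLinearMap.fst ℝ E ℝ (extChartAt (I.prod 𝓘(ℝ, ℝ)) (x, t) p)) =
      (fun p : N × ℝ => extChartAt I x p.1) := by
    ext p; simp
  have h3 := mvfderiv_clm_comp (ContinuousLinearMap.fst ℝ E ℝ) h1 (Z z)
  rw [e, mvfderiv_comp_fst h2] at h3
  exact h3.symm

/-- Cartan's formula for the pull-back of a 1-form to the product with a line. -/
theorem form_horiz_mlieBracket {x : N} {t : ℝ} {α : ∀ y : N, TangentSpace I y →L[ℝ] ℝ}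
    (hα : SmoothFormAt α x)
    {X Y : ∀ z : N × ℝ, TangentSpace (I.prod 𝓘(ℝ, ℝ)) z}
    (hX : SmoothFieldAt X (x, t)) (hY : SmoothFieldAt Y (x, t)) :
    α x (horiz I (x, t) (VectorField.mlieBracket (I.prod 𝓘(ℝ, ℝ)) X Y (x, t))) =
      mvfderiv (I.prod 𝓘(ℝ, ℝ)) (fun z => α z.1 (horiz I z (Y z))) (x, t) (X (x, t)) -
        mvfderiv (I.prod 𝓘(ℝ, ℝ)) (fun z => α z.1 (horiz I z (X z))) (x, t) (Y (x, t)) +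
        negExtDeriv α x (horiz I (x, t) (X (x, t))) (horiz I (x, t) (Y (x, t))) := by
  have hg : MDifferentiableAt I 𝓘(ℝ, E →L[ℝ] ℝ) (formCoord x α) x :=
    (contMDiffAt_formCoord hα).mdifferentiableAt (by simp)
  have hg' : MDifferentiableAt (I.prod 𝓘(ℝ, ℝ)) 𝓘(ℝ, E →L[ℝ] ℝ)
      (fun z : N × ℝ => formCoord x α z.1) (x, t) :=
    MDifferentiableAt.comp (x, t) hg mdifferentiableAt_fst
  have key : ∀ Z : ∀ z : N × ℝ, TangentSpace (I.prod 𝓘(ℝ, ℝ)) z, SmoothFieldAt Z (x, t) →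
      ∀ v : TangentSpace (I.prod 𝓘(ℝ, ℝ)) (x, t),
      mvfderiv (I.prod 𝓘(ℝ, ℝ)) (fun z => α z.1 (horiz I z (Z z))) (x, t) v =
      formDeriv α x (horiz I (x, t) v) (horiz I (x, t) (Z (x, t))) +
        formCoord x α x
          (mvfderiv (I.prod 𝓘(ℝ, ℝ)) (fieldCoord (I.prod 𝓘(ℝ, ℝ)) (x, t) Z) (x, t) v).1 := by
    intro Z hZ v
    have hh : MDifferentiableAt (I.prod 𝓘(ℝ, ℝ)) 𝓘(ℝ, E × ℝ)
      (fieldCoord (I.prod 𝓘(ℝ, ℝ)) (x, t) Z) (x, t) :=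
      (contMDiffAt_fieldCoord hZ).mdifferentiableAt (by simp)
    have hh' : MDifferentiableAt (I.prod 𝓘(ℝ, ℝ)) 𝓘(ℝ, E)
      (fun z => ContinuousLinearMap.fst ℝ E ℝ (fieldCoord (I.prod 𝓘(ℝ, ℝ)) (x, t) Z z)) (x, t) :=
      (ContinuousLinearMap.fst ℝ E ℝ).mdifferentiableAt.comp (x, t) hh
    have e : (fun z : N × ℝ => α z.1 (horiz I z (Z z))) =ᶠ[𝓝 (x, t)] fun z => formCoord x α z.1
        (ContinuousLinearMap.fst ℝ E ℝ (fieldCoord (I.prod 𝓘(ℝ, ℝ)) (x, t) Z z)) := by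
      filter_upwards [continuousAt_fst.preimage_mem_nhds
        ((chartAt H x).open_source.mem_nhds (mem_chart_source H x))] with z hz
      rw [ContinuousLinearMap.coe_fst', fieldCoord_prod_fst x t Z hz]
      exact (formCoord_fieldCoord x α hz (horiz I z (Z z))).symm
    have e' : mvfderiv (I.prod 𝓘(ℝ, ℝ)) (fun z => α z.1 (horiz I z (Z z))) (x, t) =
        mvfderiv (I.prod 𝓘(ℝ, ℝ)) (fun z => formCoord x α z.1
          (ContinuousLinearMap.fst ℝ E ℝ (fieldCoord (I.prod 𝓘(ℝ, ℝ)) (x, t) Z z))) (x, t) := by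
      rw [mvfderiv, mvfderiv, e.mfderiv_eq, e.eq_of_nhds]
    rw [e', mvfderiv_clm_apply hg' hh', mvfderiv_comp_fst hg, mvfderiv_clm_comp _ hh,
      fieldCoord_self]
    rfl
  rw [key X hX, key Y hY, negExtDeriv_apply]
  refine (formCoord_self x α _).symm.trans ?_
  have hb := congrArg Prod.fst (mlieBracket_eq_fieldCoord hX hY)
  refine (congrArg (formCoord x α x) hb).trans ?_
  rw [Prod.fst_sub, map_sub]
  ring

end Calculus

/-! ### Smooth functions, vector fields and 1-forms -/

section Smoothness

set_option linter.unusedSectionVars false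

variable {E : Type*} [NormedAddCommGroup E] [NormedSpace ℝ E]
  {H : Type*} [TopologicalSpace H] {I : ModelWithCorners ℝ E H}
  {N : Type*} [TopologicalSpace N] [ChartedSpace H N] [IsManifold I ∞ N]

variable (I) in
/-- The real function `f` is smooth at `y`. -/
abbrev SmoothFunAt (f : N → ℝ) (y : N) : Prop := ContMDiffAt I 𝓘(ℝ, ℝ) ∞ f y

instance contMDiffVectorBundle_tangent :
    ContMDiffVectorBundle ∞ E (TangentSpace I : N → Type _) I :=
  TangentBundle.contMDiffVectorBundle (n := ∞) (h := ‹IsManifold I ∞ N›)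

namespace SmoothFieldAt

variable {X Y : ∀ y : N, TangentSpace I y} {x : N} {f : N → ℝ}

lemma add (hX : SmoothFieldAt X x) (hY : SmoothFieldAt Y x) :
    SmoothFieldAt (fun y => X y + Y y) x :=
  ContMDiffAt.add_section (V := fun y : N => TangentSpace I y) hX hY

lemma smul (hf : SmoothFunAt I f x) (hX : SmoothFieldAt X x) :
    SmoothFieldAt (fun y => f y • X y) x :=
  ContMDiffAt.smul_section (V := fun y : N => TangentSpace I y) hf hX

lemma const_smul (c : ℝ) (hX : SmoothFieldAt X x) : SmoothFieldAt (fun y => c • X y) x :=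
  smul contMDiffAt_const hX

lemma sub (hX : SmoothFieldAt X x) (hY : SmoothFieldAt Y x) :
    SmoothFieldAt (fun y => X y - Y y) x :=
  ContMDiffAt.sub_section (V := fun y : N => TangentSpace I y) hX hY

lemma sum {ι : Type*} {s : Finset ι} {X : ι → ∀ y : N, TangentSpace I y}
    (hX : ∀ i ∈ s, SmoothFieldAt (X i) x) : SmoothFieldAt (fun y => ∑ i ∈ s, X i y) x :=
  ContMDiffAt.sum_section (V := fun y : N => TangentSpace I y) hX

lemma mlieBracket [CompleteSpace E] (hX : SmoothFieldAt X x) (hY : SmoothFieldAt Y x) :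
    SmoothFieldAt (fun y => VectorField.mlieBracket I X Y y) x := by
  have : IsManifold I (minSmoothness ℝ 2) N := by
    rw [minSmoothness_of_isRCLikeNormedField]; infer_instance
  have : IsManifold I ((⊤ : ℕ∞) + 1) N := ‹IsManifold I ∞ N›
  exact ContMDiffAt.mlieBracket_vectorField (n := ⊤) (m := ⊤) hX hY
    (by rw [minSmoothness_of_isRCLikeNormedField]; exact le_rfl)

end SmoothFieldAt

namespace SmoothFormAt

variable {α β : ∀ y : N, TangentSpace I y →L[ℝ] ℝ} {X : ∀ y : N, TangentSpace I y}
  {x : N} {f : N → ℝ}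

lemma add (hα : SmoothFormAt α x) (hβ : SmoothFormAt β x) :
    SmoothFormAt (fun y => α y + β y) x :=
  ContMDiffAt.add_section (V := fun y : N => TangentSpace I y →L[ℝ] Bundle.Trivial N ℝ y) hα hβ

lemma smul (hf : SmoothFunAt I f x) (hα : SmoothFormAt α x) :
    SmoothFormAt (fun y => f y • α y) x :=
  ContMDiffAt.smul_section (V := fun y : N => TangentSpace I y →L[ℝ] Bundle.Trivial N ℝ y) hf hα

lemma sum {ι : Type*} {s : Finset ι} {α : ι → ∀ y : N, TangentSpace I y →L[ℝ] ℝ}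
    (hα : ∀ i ∈ s, SmoothFormAt (α i) x) : SmoothFormAt (fun y => ∑ i ∈ s, α i y) x :=
  ContMDiffAt.sum_section (V := fun y : N => TangentSpace I y →L[ℝ] Bundle.Trivial N ℝ y) hα

lemma apply (hα : SmoothFormAt α x) (hX : SmoothFieldAt X x) :
    SmoothFunAt I (fun y => α y (X y)) x := by
  have h := ContMDiffAt.clm_bundle_apply (E₁ := fun y : N => TangentSpace I y)
    (E₂ := Bundle.Trivial N ℝ) (b := fun y : N => y) hα hX
  exact (Bundle.contMDiffAt_totalSpace.1 h).2

end SmoothFormAt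

lemma smoothFormAt_mvfderiv {h : N → ℝ} {x : N} (hh : SmoothFunAt I h x) :
    SmoothFormAt (fun y => mvfderiv I h y) x := by
  refine (contMDiffAt_hom_bundle _).2 ⟨contMDiffAt_id, ?_⟩
  have := hh.mfderiv_const (m := ∞) le_rfl
  refine this.congr_of_eventuallyEq (.of_eq ?_)
  ext y v
  simp [inTangentCoordinates, ContinuousLinearMap.inCoordinates, mvfderiv]
  rfl

lemma smoothFieldAt_mkVec {X : ∀ y : N, TangentSpace I y} {z : N × ℝ}
    (hX : SmoothFieldAt X z.1) (s : ℝ) :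
    SmoothFieldAt (fun z : N × ℝ => mkVec I z (X z.1) s) z := by
  have h1 : ContMDiffAt (I.prod 𝓘(ℝ, ℝ)) I.tangent ∞
      (fun z : N × ℝ => (⟨z.1, X z.1⟩ : TangentBundle I N)) z :=
    ContMDiffAt.comp z hX contMDiffAt_fst
  have h0 : ContMDiffAt 𝓘(ℝ, ℝ) 𝓘(ℝ, ℝ).tangent ∞
      (fun t : ℝ => (⟨t, s⟩ : TangentBundle 𝓘(ℝ, ℝ) ℝ)) z.2 :=
    contMDiffAt_vectorSpace_iff_contDiffAt.2 contDiffAt_const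
  have h2 : ContMDiffAt (I.prod 𝓘(ℝ, ℝ)) 𝓘(ℝ, ℝ).tangent ∞
      (fun z : N × ℝ => (⟨z.2, s⟩ : TangentBundle 𝓘(ℝ, ℝ) ℝ)) z :=
    ContMDiffAt.comp z h0 contMDiffAt_snd
  exact (contMDiff_equivTangentBundleProd_symm (n := ∞) (I := I) (I' := 𝓘(ℝ, ℝ)) (M := N)
    (M' := ℝ)).contMDiffAt.comp z (h1.prodMk h2)

lemma smoothFieldAt_zero (x : N) : SmoothFieldAt (fun y : N => (0 : TangentSpace I y)) x :=
  (Bundle.contMDiff_zeroSection ℝ (TangentSpace I : N → Type _)).contMDiffAt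

end Smoothness

/-! ### Frames and coframes adapted to a rank 5 distribution -/

section Coframes

set_option linter.unusedSectionVars false

variable {E : Type*} [NormedAddCommGroup E] [NormedSpace ℝ E]
  {H : Type*} [TopologicalSpace H] {I : ModelWithCorners ℝ E H}
  {N : Type*} [TopologicalSpace N] [ChartedSpace H N] [IsManifold I ∞ N]

lemma smoothFunAt_det {ι : Type*} [Fintype ι] [DecidableEq ι] {G : N → Matrix ι ι ℝ} {x : N}
    (hG : ∀ i j, SmoothFunAt I (fun y => G y i j) x) : SmoothFunAt I (fun y => (G y).det) x := by
  simp only [Matrix.det_apply']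
  refine ContMDiffAt.sum fun σ _ => ?_
  exact contMDiffAt_const.mul (ContMDiffAt.prod fun i _ => hG _ _)

/-- By Cramer's rule the entries of the inverse are quotients of determinants. -/
lemma smoothFunAt_inv_apply {ι : Type*} [Fintype ι] [DecidableEq ι] {G : N → Matrix ι ι ℝ} {x : N}
    (hG : ∀ i j, SmoothFunAt I (fun y => G y i j) x) (h0 : (G x).det ≠ 0) (i j : ι) :
    SmoothFunAt I (fun y => (G y)⁻¹ i j) x := by
  simp only [Matrix.inv_def, Ring.inverse_eq_inv', Matrix.smul_apply, smul_eq_mul,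
    Matrix.adjugate_apply]
  refine ((smoothFunAt_det hG).inv₀ h0).mul (smoothFunAt_det fun k l => ?_)
  by_cases hk : k = j
  · simp only [hk, Matrix.updateRow_self]; exact contMDiffAt_const
  · simp only [Matrix.updateRow_ne hk]; exact hG k l

/-- A constant vector field in the trivialization around `x`. -/
def constField (x : N) (v : E) (y : N) : TangentSpace I y :=
  (trivializationAt E (TangentSpace I) x).symm y v

lemma smoothFieldAt_constField (x : N) (v : E) {y : N} (hy : y ∈ (chartAt H x).source) :
    SmoothFieldAt (I := I) (constField x v) y := by
  have hb : y ∈ (trivializationAt E (TangentSpace I) x).baseSet := by simpa using hy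
  refine ((trivializationAt E (TangentSpace I) x).contMDiffAt_section_iff hb).2 ?_
  refine (contMDiffAt_const (c := v)).congr_of_eventuallyEq ?_
  filter_upwards [(trivializationAt E (TangentSpace I) x).open_baseSet.mem_nhds hb] with z hz
  rw [constField, Bundle.Trivialization.apply_mk_symm _ hz]

lemma constField_self (x : N) (v : TangentSpace I x) : constField (I := I) x v x = v := by
  have h := (trivializationAt E (TangentSpace I) x).symmL_continuousLinearMapAt (R := ℝ)
    (by simp : x ∈ (trivializationAt E (TangentSpace I) x).baseSet) v
  rw [TangentBundle.continuousLinearMapAt_trivializationAt (mem_chart_source H x),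
    mfderiv_extChartAt_self, Bundle.Trivialization.symmL_apply] at h
  · exact h
  · simp

/-- A smooth local frame of the tangent bundle has a smooth dual coframe. -/
lemma exists_dual_coframe [FiniteDimensional ℝ E] {ι : Type*} [Fintype ι] [DecidableEq ι]
    {x : N} (hι : Fintype.card ι = Module.finrank ℝ E) {F : ι → ∀ y : N, TangentSpace I y}
    (hF : ∀ᶠ y in 𝓝 x, ∀ i, SmoothFieldAt (F i) y) (hli : LinearIndependent ℝ fun i => F i x) :
    ∃ ξ : ι → ∀ y : N, TangentSpace I y →L[ℝ] ℝ, ∀ᶠ y in 𝓝 x, (∀ i, SmoothFormAt (ξ i) y) ∧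
      ∀ i j, ξ i y (F j y) = if i = j then 1 else 0 := by
  let b : Module.Basis ι ℝ E := (Module.finBasis ℝ E).reindex (Fintype.equivOfCardEq (by simp [hι]))
  let c : ι → E →L[ℝ] ℝ := fun i => LinearMap.toContinuousLinearMap (b.coord i)
  let η : ι → ∀ y : N, TangentSpace I y →L[ℝ] ℝ :=
    fun i y => mvfderiv I (fun y => c i (extChartAt I x y)) y
  have hη : ∀ y ∈ (chartAt H x).source, ∀ i, SmoothFormAt (η i) y := fun y hy i =>
    smoothFormAt_mvfderiv ((c i).contMDiff.contMDiffAt.comp y (contMDiffAt_extChartAt' hy))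
  -- Coordinate differentials `η` form a smooth coframe that need not be dual to `F`. The inverse of
  -- the matrix of pairings corrects it.
  let G : N → Matrix ι ι ℝ := fun y => Matrix.of fun i j => η i y (F j y)
  have hsrc := (chartAt H x).open_source.mem_nhds (mem_chart_source H x)
  have hG : ∀ᶠ y in 𝓝 x, ∀ i j, SmoothFunAt I (fun y => G y i j) y := by
    filter_upwards [hF, hsrc] with y h1 h2 i j using (hη y h2 i).apply (h1 j)
  have hGx : ∀ i j, G x i j = b.repr (F j x) i := by
    intro i j
    have h := mvfderiv_clm_comp (c i)
      (mdifferentiableAt_extChartAt (I := I) (mem_chart_source H x)) (F j x)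
    have h' : mvfderiv I (extChartAt I x) x (F j x) = F j x :=
      congrArg (fun T : E →L[ℝ] E => T (F j x)) (mfderiv_extChartAt_self (I := I) (x := x))
    rw [h'] at h
    exact h
  have hdet : (G x).det ≠ 0 := by
    let v : ι → E := fun i => F i x
    have hv : LinearIndependent ℝ v := hli
    have h := (b.is_basis_iff_det.1 ⟨hv, hv.span_eq_top_of_card_eq_finrank' hι⟩).ne_zero
    rw [Module.Basis.det_apply] at h
    convert h using 2
    ext i j
    rw [hGx, Module.Basis.toMatrix_apply]
  have hdet' : ∀ᶠ y in 𝓝 x, (G y).det ≠ 0 :=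
    (smoothFunAt_det hG.self_of_nhds).continuousAt.eventually_ne hdet
  refine ⟨fun i y => ∑ k, (G y)⁻¹ i k • η k y, ?_⟩
  filter_upwards [hG, hdet', hsrc] with y h1 h2 h3
  refine ⟨fun i => SmoothFormAt.sum fun k _ =>
    SmoothFormAt.smul (smoothFunAt_inv_apply h1 h2 i k) (hη y h3 k), fun i j => ?_⟩
  have h := congrFun (congrFun (Matrix.nonsing_inv_mul (G y) (isUnit_iff_ne_zero.2 h2)) i) j
  rw [Matrix.mul_apply, Matrix.one_apply] at h
  rw [← h, sum_apply]
  rfl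

lemma exists_linearIndependent_sumElim {V : Type*} [AddCommGroup V] [Module ℝ V]
    [FiniteDimensional ℝ V] {m k : ℕ} (hV : Module.finrank ℝ V = m + k) {v : Fin m → V}
    (hv : LinearIndependent ℝ v) :
    ∃ w : Fin k → V, LinearIndependent ℝ (Sum.elim v w) := by
  obtain ⟨W, hW⟩ := Submodule.exists_isCompl (Submodule.span ℝ (Set.range v))
  have h1 : Module.finrank ℝ W = k := by
    have h := Submodule.finrank_add_eq_of_isCompl hW
    rw [finrank_span_eq_card hv, hV, Fintype.card_fin] at h
    omega
  let b := Module.finBasisOfFinrankEq ℝ W h1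
  refine ⟨fun i => b i, LinearIndependent.sum_type hv
    (b.linearIndependent.map' W.subtype W.ker_subtype) ?_⟩
  refine hW.disjoint.mono_right (Submodule.span_le.2 ?_)
  rintro _ ⟨i, rfl⟩
  exact (b i).2

variable {D : ∀ y : N, Submodule ℝ (TangentSpace I y)} {x : N}

/-- A smooth local frame of the tangent bundle adapted to the rank 5 distribution `D`, with its dual
coframe, whose last two forms are those of the chart `c`. -/
structure AdaptedFrame (D : ∀ y : N, Submodule ℝ (TangentSpace I y)) (x : N)
    (c : AffineChart I D x) where
  dom : Set N
  isOpen_dom : IsOpen dom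
  mem_dom : x ∈ dom
  X : Fin 5 → ∀ y : N, TangentSpace I y
  Y : Fin 2 → ∀ y : N, TangentSpace I y
  ξ : Fin 5 → ∀ y : N, TangentSpace I y →L[ℝ] ℝ
  smooth_X : ∀ i, ∀ y ∈ dom, SmoothFieldAt (X i) y
  smooth_Y : ∀ i, ∀ y ∈ dom, SmoothFieldAt (Y i) y
  smooth_ξ : ∀ i, ∀ y ∈ dom, SmoothFormAt (ξ i) y
  smooth_α : ∀ y ∈ dom, SmoothFormAt c.α y
  smooth_β : ∀ y ∈ dom, SmoothFormAt c.β y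
  span_X : ∀ y ∈ dom, Submodule.span ℝ (Set.range fun j => X j y) = D y
  ξ_X : ∀ y ∈ dom, ∀ i j, ξ i y (X j y) = if i = j then 1 else 0
  span_αβ : ∀ y ∈ dom, Submodule.span ℝ {c.α y, c.β y} = annihilator I D y
  expand : ∀ y ∈ dom, ∀ v, v = ∑ i, ξ i y v • X i y + (c.α y v • Y 0 y + c.β y v • Y 1 y)
  α_Y : ∀ y ∈ dom, c.α y (Y 0 y) = 1 ∧ c.α y (Y 1 y) = 0
  β_Y : ∀ y ∈ dom, c.β y (Y 0 y) = 0 ∧ c.β y (Y 1 y) = 1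

/-- Local frame and coframe adapted to a rank 5 distribution on a 7-manifold. -/
lemma exists_frame_coframe [FiniteDimensional ℝ E] (hE : Module.finrank ℝ E = 7)
    (hD : IsDistribution I D 5) (x : N) :
    ∃ (F : Fin 5 ⊕ Fin 2 → ∀ y : N, TangentSpace I y)
      (ξ : Fin 5 ⊕ Fin 2 → ∀ y : N, TangentSpace I y →L[ℝ] ℝ),
      ∀ᶠ y in 𝓝 x, (∀ i, SmoothFieldAt (F i) y) ∧ (∀ i, SmoothFormAt (ξ i) y) ∧
        (∀ i j, ξ i y (F j y) = if i = j then 1 else 0) ∧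
        Submodule.span ℝ (Set.range fun j => F (Sum.inl j) y) = D y ∧
        ∀ v, v = ∑ i, ξ i y v • F i y := by
  obtain ⟨X, hX, hXD⟩ := hD x
  obtain ⟨w, hw⟩ := exists_linearIndependent_sumElim (V := E) (m := 5) (k := 2) hE
    (v := fun j => X j x) hXD.self_of_nhds.1
  -- The frame of `D` is completed by fields that are constant in the trivialization. Independence
  -- at `x` is enough, since the dual coframe near `x` restores it at nearby points.
  let F : Fin 5 ⊕ Fin 2 → ∀ y : N, TangentSpace I y := Sum.elim X fun i => constField x (w i)
  have hF : ∀ᶠ y in 𝓝 x, ∀ i, SmoothFieldAt (F i) y := by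
    filter_upwards [Filter.eventually_all.2 hX,
      (chartAt H x).open_source.mem_nhds (mem_chart_source H x)] with y h1 h2
    rintro (i | i)
    · exact (h1 i).1
    · exact smoothFieldAt_constField x (w i) h2
  have hFx : (fun i => F i x) = (Sum.elim (fun j => X j x) w : Fin 5 ⊕ Fin 2 → E) := by
    funext i
    rcases i with i | i
    · rfl
    · exact constField_self x (w i)
  have hli : LinearIndependent ℝ fun i => F i x := by rw [hFx]; exact hw
  obtain ⟨ξ, hξ⟩ := exists_dual_coframe (by simp [hE]) hF hli
  refine ⟨F, ξ, ?_⟩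
  filter_upwards [hF, hξ, hXD] with y h1 h2 h3
  refine ⟨h1, h2.1, h2.2, h3.2, fun v => ?_⟩
  have key : ∀ (g : Fin 5 ⊕ Fin 2 → ℝ) i, ξ i y (∑ j, g j • F j y) = g i := by
    intro g i
    simp only [map_sum, map_smul, h2.2, smul_eq_mul, mul_ite, mul_one, mul_zero,
      Finset.sum_ite_eq, Finset.mem_univ, if_true]
  have hli : LinearIndependent ℝ fun i => F i y := by
    rw [Fintype.linearIndependent_iff]
    intro g hg i
    rw [← key g i, hg, map_zero]
  have hsp : Submodule.span ℝ (Set.range fun i => F i y) = ⊤ :=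
    LinearIndependent.span_eq_top_of_card_eq_finrank' (K := ℝ) (V := E) hli (by simp [hE])
  obtain ⟨g, hg⟩ := (Submodule.mem_span_range_iff_exists_fun ℝ).1
    (hsp ▸ Submodule.mem_top : v ∈ Submodule.span ℝ (Set.range fun i => F i y))
  rw [← hg]
  simp only [key]

/-- `D^⊥` has smooth local frames. -/
lemma nonempty_affineChart [FiniteDimensional ℝ E] (hE : Module.finrank ℝ E = 7)
    (hD : IsDistribution I D 5) (x : N) : Nonempty (AffineChart I D x) := by
  obtain ⟨F, ξ, h⟩ := exists_frame_coframe hE hD x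
  refine ⟨⟨ξ (Sum.inr 0), ξ (Sum.inr 1), h.mono fun y hy => hy.2.1 _, h.mono fun y hy => hy.2.1 _,
    h.mono fun y hy => ?_⟩⟩
  obtain ⟨-, -, h3, h4, h5⟩ := hy
  refine ⟨LinearIndependent.pair_iff.2 fun s t hst => ⟨?_, ?_⟩, le_antisymm ?_ ?_⟩
  · simpa [h3] using congrArg (fun T : TangentSpace I y →L[ℝ] ℝ => T (F (Sum.inr 0) y)) hst
  · simpa [h3] using congrArg (fun T : TangentSpace I y →L[ℝ] ℝ => T (F (Sum.inr 1) y)) hst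
  · refine Submodule.span_le.2 ?_
    have : ∀ j : Fin 2, ξ (Sum.inr j) y ∈ annihilator I D y := by
      intro j v hv
      rw [← h4] at hv
      induction hv using Submodule.span_induction with
      | mem v hv => obtain ⟨i, rfl⟩ := hv; simp [h3]
      | zero => simp
      | add u v _ _ hu hv => rw [map_add, hu, hv, add_zero]
      | smul c v _ hv => rw [map_smul, hv, smul_zero]
    rintro _ (rfl | rfl)
    exacts [this 0, this 1]
  · intro p hp
    refine Submodule.mem_span_pair.2 ⟨p (F (Sum.inr 0) y), p (F (Sum.inr 1) y), ?_⟩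
    ext v
    have hz : ∀ i : Fin 5, p (F (Sum.inl i) y) = 0 := fun i =>
      hp _ (h4 ▸ Submodule.subset_span ⟨i, rfl⟩)
    conv_rhs => rw [h5 v]
    simp [Fintype.sum_sum_type, hz]
    ring

/-- Every affine chart of the projectivized annihilator comes with an adapted frame. -/
lemma nonempty_adaptedFrame [FiniteDimensional ℝ E] (hE : Module.finrank ℝ E = 7)
    (hD : IsDistribution I D 5) (c : AffineChart I D x) : Nonempty (AdaptedFrame D x c) := by
  obtain ⟨F, ξ, h⟩ := exists_frame_coframe hE hD x
  obtain ⟨U, hU, hUo, hxU⟩ := eventually_nhds_iff.1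
    (h.and (c.smooth_α.and (c.smooth_β.and c.frame)))
  let a : Fin 2 → N → ℝ := fun j y => c.α y (F (Sum.inr j) y)
  let b : Fin 2 → N → ℝ := fun j y => c.β y (F (Sum.inr j) y)
  -- The determinant of the change from the last two forms of the coframe to `(α, β)`.
  let d : N → ℝ := fun y => a 0 y * b 1 y - a 1 y * b 0 y
  have sa : ∀ j, ∀ y ∈ U, SmoothFunAt I (a j) y := fun j y hy =>
    SmoothFormAt.apply (hU y hy).2.1 ((hU y hy).1.1 _)
  have sb : ∀ j, ∀ y ∈ U, SmoothFunAt I (b j) y := fun j y hy =>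
    SmoothFormAt.apply (hU y hy).2.2.1 ((hU y hy).1.1 _)
  have hX0 : ∀ y ∈ U, ∀ p ∈ annihilator I D y, ∀ i : Fin 5, p (F (Sum.inl i) y) = 0 :=
    fun y hy p hp i => hp _ ((hU y hy).1.2.2.2.1 ▸ Submodule.subset_span ⟨i, rfl⟩)
  have hαD : ∀ y ∈ U, c.α y ∈ annihilator I D y := fun y hy =>
    (hU y hy).2.2.2.2 ▸ Submodule.subset_span (by simp)
  have hβD : ∀ y ∈ U, c.β y ∈ annihilator I D y := fun y hy =>
    (hU y hy).2.2.2.2 ▸ Submodule.subset_span (by simp)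
  have eα : ∀ y ∈ U, ∀ v, c.α y v = ξ (Sum.inr 0) y v * a 0 y + ξ (Sum.inr 1) y v * a 1 y := by
    intro y hy v
    conv_lhs => rw [(hU y hy).1.2.2.2.2 v]
    simp [Fintype.sum_sum_type, hX0 y hy _ (hαD y hy), a]
  have eβ : ∀ y ∈ U, ∀ v, c.β y v = ξ (Sum.inr 0) y v * b 0 y + ξ (Sum.inr 1) y v * b 1 y := by
    intro y hy v
    conv_lhs => rw [(hU y hy).1.2.2.2.2 v]
    simp [Fintype.sum_sum_type, hX0 y hy _ (hβD y hy), b]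
  have hd : ∀ y ∈ U, d y ≠ 0 := by
    -- If the determinant vanished, `b₁α - a₁β` and `-b₀α + a₀β` would both be zero. Independence
    -- then gives `a₀ = a₁ = 0`, hence `α = 0`.
    intro y hy h0
    have hli := LinearIndependent.pair_iff.1 (hU y hy).2.2.2.1
    have h1 := hli (b 1 y) (-a 1 y) (by
      ext v
      simp only [add_apply, smul_apply, smul_eq_mul, zero_apply, eα y hy, eβ y hy]
      linear_combination (ξ (Sum.inr 0) y v) * h0)
    have h2 := hli (-b 0 y) (a 0 y) (by
      ext v
      simp only [add_apply, smul_apply, smul_eq_mul, zero_apply, eα y hy, eβ y hy]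
      linear_combination (ξ (Sum.inr 1) y v) * h0)
    have h3 := hli 1 0 (by
      ext v
      simp only [add_apply, smul_apply, smul_eq_mul, zero_apply, eα y hy, h2.2,
        neg_eq_zero.1 h1.2]
      simp)
    exact one_ne_zero h3.1
  have sd : ∀ y ∈ U, SmoothFunAt I (fun y => (d y)⁻¹) y := fun y hy =>
    (((sa 0 y hy).mul (sb 1 y hy)).sub ((sa 1 y hy).mul (sb 0 y hy))).inv₀ (hd y hy)
  -- The inverse of the 2×2 matrix, so that `Y` is dual to `(α, β)` and annihilated by the five
  -- remaining forms.
  let Y : Fin 2 → ∀ y : N, TangentSpace I y :=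
    ![fun y => (d y)⁻¹ • (b 1 y • F (Sum.inr 0) y - b 0 y • F (Sum.inr 1) y),
      fun y => (d y)⁻¹ • (a 0 y • F (Sum.inr 1) y - a 1 y • F (Sum.inr 0) y)]
  refine ⟨{ dom := U, isOpen_dom := hUo, mem_dom := hxU, X := fun i => F (Sum.inl i), Y := Y,
            ξ := fun i => ξ (Sum.inl i)
            smooth_X := fun i y hy => (hU y hy).1.1 _
            smooth_Y := ?_
            smooth_ξ := fun i y hy => (hU y hy).1.2.1 _
            smooth_α := fun y hy => (hU y hy).2.1
            smooth_β := fun y hy => (hU y hy).2.2.1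
            span_X := fun y hy => (hU y hy).1.2.2.2.1
            ξ_X := fun y hy i j => by simp [(hU y hy).1.2.2.1]
            span_αβ := fun y hy => (hU y hy).2.2.2.2
            expand := ?_, α_Y := ?_, β_Y := ?_ }⟩
  · intro i y hy
    have hF := (hU y hy).1.1
    fin_cases i
    · exact SmoothFieldAt.smul (sd y hy) (((hF _).smul (sb 1 y hy)).sub ((hF _).smul (sb 0 y hy)))
    · exact SmoothFieldAt.smul (sd y hy) (((hF _).smul (sa 0 y hy)).sub ((hF _).smul (sa 1 y hy)))
  · intro y hy v
    conv_lhs => rw [(hU y hy).1.2.2.2.2 v]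
    have := hd y hy
    rw [Fintype.sum_sum_type, Fin.sum_univ_two, eα y hy, eβ y hy]
    congr 1
    have h1 : (d y)⁻¹ * d y = 1 := inv_mul_cancel₀ this
    simp only [Y, Matrix.cons_val_zero, Matrix.cons_val_one]
    match_scalars
    · linear_combination -(ξ (Sum.inr 0) y v) * h1
    · linear_combination -(ξ (Sum.inr 1) y v) * h1
  · intro y hy
    have h1 : (d y)⁻¹ * d y = 1 := inv_mul_cancel₀ (hd y hy)
    constructor
    · simp only [Y, Matrix.cons_val_zero, map_smul, map_sub, smul_eq_mul]
      linear_combination h1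
    · simp only [Y, Matrix.cons_val_one, Matrix.cons_val_zero, map_smul, map_sub, smul_eq_mul]
      simp only [a]; ring
  · intro y hy
    have h1 : (d y)⁻¹ * d y = 1 := inv_mul_cancel₀ (hd y hy)
    constructor
    · simp only [Y, Matrix.cons_val_zero, map_smul, map_sub, smul_eq_mul]
      simp only [b]; ring
    · simp only [Y, Matrix.cons_val_one, Matrix.cons_val_zero, map_smul, map_sub, smul_eq_mul]
      linear_combination h1

end Coframes

/-! ### Linear algebra: pencils of skew forms on `ℝ⁵` -/

section Pfaffian

/-- The bilinear form on `ℝ⁵` with matrix `a`. -/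
def bform (a : Fin 5 → Fin 5 → ℝ) (u v : Fin 5 → ℝ) : ℝ := ∑ i, ∑ j, u i * a i j * v j

/-- The signed `4 × 4` sub-Pfaffians of a skew matrix of size 5. -/
def pfv (a : Fin 5 → Fin 5 → ℝ) : Fin 5 → ℝ :=
  ![a 1 2 * a 3 4 - a 1 3 * a 2 4 + a 1 4 * a 2 3,
    -(a 0 2 * a 3 4 - a 0 3 * a 2 4 + a 0 4 * a 2 3),
    a 0 1 * a 3 4 - a 0 3 * a 1 4 + a 0 4 * a 1 3,
    -(a 0 1 * a 2 4 - a 0 2 * a 1 4 + a 0 4 * a 1 2),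
    a 0 1 * a 2 3 - a 0 2 * a 1 3 + a 0 3 * a 1 2]

/-- Skew symmetry. -/
def IsSkew (a : Fin 5 → Fin 5 → ℝ) : Prop := ∀ i j, a i j = - a j i

variable {a b : Fin 5 → Fin 5 → ℝ}

lemma IsSkew.diag (ha : IsSkew a) (i : Fin 5) : a i i = 0 := by
  have := ha i i; linarith

lemma bform_eq (ha : IsSkew a) (u v : Fin 5 → ℝ) : bform a u v =
    a 0 1 * (u 0 * v 1 - u 1 * v 0) + a 0 2 * (u 0 * v 2 - u 2 * v 0) +
    a 0 3 * (u 0 * v 3 - u 3 * v 0) + a 0 4 * (u 0 * v 4 - u 4 * v 0) +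
    a 1 2 * (u 1 * v 2 - u 2 * v 1) + a 1 3 * (u 1 * v 3 - u 3 * v 1) +
    a 1 4 * (u 1 * v 4 - u 4 * v 1) + a 2 3 * (u 2 * v 3 - u 3 * v 2) +
    a 2 4 * (u 2 * v 4 - u 4 * v 2) + a 3 4 * (u 3 * v 4 - u 4 * v 3) := by
  simp only [bform, Fin.sum_univ_five]
  rw [ha.diag 0, ha.diag 1, ha.diag 2, ha.diag 3, ha.diag 4, ha 1 0, ha 2 0, ha 3 0, ha 4 0,
    ha 2 1, ha 3 1, ha 4 1, ha 3 2, ha 4 2, ha 4 3]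
  ring

/-- The Pfaffian of a form on four vectors, as a determinant with the vector of sub-Pfaffians. -/
lemma det_pfv (ha : IsSkew a) (u : Fin 4 → Fin 5 → ℝ) :
    (Matrix.of (Matrix.vecCons (pfv a) u)).det =
      bform a (u 0) (u 1) * bform a (u 2) (u 3) - bform a (u 0) (u 2) * bform a (u 1) (u 3) +
        bform a (u 0) (u 3) * bform a (u 1) (u 2) := by
  simp only [bform_eq ha]
  simp [Matrix.det_succ_row_zero, Fin.sum_univ_succ, Fin.succAbove, pfv]
  ring

/-- The polarization of `pfv`. -/
def pfm (a b : Fin 5 → Fin 5 → ℝ) : Fin 5 → ℝ := pfv (a + b) - pfv a - pfv b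

lemma IsSkew.comb (ha : IsSkew a) (hb : IsSkew b) (s t : ℝ) : IsSkew (s • a + t • b) := by
  intro i j
  simp only [Pi.add_apply, Pi.smul_apply, smul_eq_mul, ha i j, hb i j]
  ring

lemma IsSkew.add (ha : IsSkew a) (hb : IsSkew b) : IsSkew (a + b) := by
  simpa using ha.comb hb 1 1

lemma pfv_comb (a b : Fin 5 → Fin 5 → ℝ) (s t : ℝ) :
    pfv (s • a + t • b) = s ^ 2 • pfv a + (s * t) • pfm a b + t ^ 2 • pfv b := by
  ext i
  fin_cases i <;> simp [pfv, pfm] <;> ring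

lemma bform_comb (a b : Fin 5 → Fin 5 → ℝ) (s t : ℝ) (u v : Fin 5 → ℝ) :
    bform (s • a + t • b) u v = s * bform a u v + t * bform b u v := by
  simp only [bform, Pi.add_apply, Pi.smul_apply, smul_eq_mul, Finset.mul_sum,
    ← Finset.sum_add_distrib]
  exact Finset.sum_congr rfl fun i _ => Finset.sum_congr rfl fun j _ => by ring

lemma bform_add (a b : Fin 5 → Fin 5 → ℝ) (u v : Fin 5 → ℝ) :
    bform (a + b) u v = bform a u v + bform b u v := by
  simpa using bform_comb a b 1 1 u v

lemma bform_swap (ha : IsSkew a) (u v : Fin 5 → ℝ) : bform a u v = - bform a v u := by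
  rw [bform_eq ha, bform_eq ha]; ring

lemma bform_self (ha : IsSkew a) (u : Fin 5 → ℝ) : bform a u u = 0 := by
  rw [bform_eq ha]; ring

lemma bform_add_left (u u' v : Fin 5 → ℝ) :
    bform a (u + u') v = bform a u v + bform a u' v := by
  simp only [bform, Pi.add_apply, ← Finset.sum_add_distrib]
  exact Finset.sum_congr rfl fun i _ => Finset.sum_congr rfl fun j _ => by ring

lemma bform_smul_left (c : ℝ) (u v : Fin 5 → ℝ) : bform a (c • u) v = c * bform a u v := by
  simp only [bform, Pi.smul_apply, smul_eq_mul, Finset.mul_sum]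
  exact Finset.sum_congr rfl fun i _ => Finset.sum_congr rfl fun j _ => by ring

lemma bform_add_right (u v v' : Fin 5 → ℝ) :
    bform a u (v + v') = bform a u v + bform a u v' := by
  simp only [bform, Pi.add_apply, ← Finset.sum_add_distrib]
  exact Finset.sum_congr rfl fun i _ => Finset.sum_congr rfl fun j _ => by ring

lemma bform_smul_right (c : ℝ) (u v : Fin 5 → ℝ) : bform a u (c • v) = c * bform a u v := by
  simp only [bform, Pi.smul_apply, smul_eq_mul, Finset.mul_sum]
  exact Finset.sum_congr rfl fun i _ => Finset.sum_congr rfl fun j _ => by ring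

@[simp] lemma bform_zero_left (v : Fin 5 → ℝ) : bform a 0 v = 0 := by simp [bform]

lemma bform_single_right (u : Fin 5 → ℝ) (j : Fin 5) :
    bform a u (Pi.single j 1) = ∑ i, u i * a i j := by
  simp [bform, Pi.single_apply]

/-- The vector of sub-Pfaffians spans the kernel. -/
lemma bform_pfv (ha : IsSkew a) (v : Fin 5 → ℝ) : bform a (pfv a) v = 0 := by
  rw [bform_eq ha]
  simp [pfv]
  ring

/-- Each 2×2 minor of the pair `(pfv a, v)` is a combination of three of the five equations for `v`:
those with index outside `{i, j}`, weighted by the entry of `a` at the other two such indices. -/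
lemma pfv_mul_eq (ha : IsSkew a) {v : Fin 5 → ℝ} (hv : ∀ w, bform a v w = 0) (i j : Fin 5) :
    pfv a i * v j = pfv a j * v i := by
  have h0 := hv (Pi.single 0 1)
  have h1 := hv (Pi.single 1 1)
  have h2 := hv (Pi.single 2 1)
  have h3 := hv (Pi.single 3 1)
  have h4 := hv (Pi.single 4 1)
  simp only [bform_single_right, Fin.sum_univ_five] at h0 h1 h2 h3 h4
  rw [ha.diag 0, ha 1 0, ha 2 0, ha 3 0, ha 4 0] at h0
  rw [ha.diag 1, ha 2 1, ha 3 1, ha 4 1] at h1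
  rw [ha.diag 2, ha 3 2, ha 4 2] at h2
  rw [ha.diag 3, ha 4 3] at h3
  rw [ha.diag 4] at h4
  have key : ∀ i j : Fin 5, i < j → pfv a i * v j = pfv a j * v i := by
    intro i j hij
    fin_cases i <;> fin_cases j <;> simp at hij <;> simp [pfv]
    · linear_combination -(-(a 3 4) * h2 + a 2 4 * h3 - a 2 3 * h4)
    · linear_combination -(a 3 4 * h1 - a 1 4 * h3 + a 1 3 * h4)
    · linear_combination -(-(a 2 4) * h1 + a 1 4 * h2 - a 1 2 * h4)
    · linear_combination -(a 2 3 * h1 - a 1 3 * h2 + a 1 2 * h3)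
    · linear_combination -(-(a 3 4) * h0 + a 0 4 * h3 - a 0 3 * h4)
    · linear_combination -(a 2 4 * h0 - a 0 4 * h2 + a 0 2 * h4)
    · linear_combination -(-(a 2 3) * h0 + a 0 3 * h2 - a 0 2 * h3)
    · linear_combination -(-(a 1 4) * h0 + a 0 4 * h1 - a 0 1 * h4)
    · linear_combination -(a 1 3 * h0 - a 0 3 * h1 + a 0 1 * h3)
    · linear_combination -(-(a 1 2) * h0 + a 0 2 * h1 - a 0 1 * h2)
  rcases lt_trichotomy i j with h | h | h
  · exact key i j h
  · rw [h]
  · exact (key j i h).symm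

lemma exists_smul_pfv (ha : IsSkew a) (h : pfv a ≠ 0) {v : Fin 5 → ℝ}
    (hv : ∀ w, bform a v w = 0) : ∃ c : ℝ, v = c • pfv a := by
  obtain ⟨i, hi⟩ := Function.ne_iff.1 h
  refine ⟨v i / pfv a i, ?_⟩
  ext j
  have hi' : pfv a i ≠ 0 := hi
  have := pfv_mul_eq ha hv i j
  simp only [Pi.smul_apply, smul_eq_mul]
  field_simp
  linear_combination this

/-- A pencil of skew forms on `ℝ⁵` without nonzero polynomial kernels of degree 0 or 1. -/
structure KroneckerPencil (a b : Fin 5 → Fin 5 → ℝ) : Prop where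
  skew_left : IsSkew a
  skew_right : IsSkew b
  kernel_zero : ∀ v, (∀ w, bform a v w = 0) → (∀ w, bform b v w = 0) → v = 0
  kernel_one : ∀ u v, (∀ w, bform a u w = 0) → (∀ w, bform a v w + bform b u w = 0) →
    (∀ w, bform b v w = 0) → u = 0 ∧ v = 0

/-- These are the coefficients of `t` and `t²` in `(a + t b)(pfv (a + t b), w) = 0`, separated by
taking `t = 1` and `t = -1`. -/
lemma bform_right_pfm (ha : IsSkew a) (hb : IsSkew b) (w : Fin 5 → ℝ) :
    bform a (pfm a b) w + bform b (pfv a) w = 0 ∧ bform a (pfv b) w + bform b (pfm a b) w = 0 := by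
  have h1 := bform_pfv (ha.comb hb 1 1) w
  have h2 := bform_pfv (ha.comb hb 1 (-1)) w
  have h3 := bform_pfv ha w
  have h4 := bform_pfv hb w
  rw [bform_comb, pfv_comb] at h1 h2
  simp only [bform_add_left, bform_smul_left, h3, h4] at h1 h2
  constructor <;> linarith

lemma exists_ne_zero_of_linear_conditions (f : Fin 4 → ((Fin 5 → ℝ) →ₗ[ℝ] ℝ)) :
    ∃ v, v ≠ 0 ∧ ∀ i, f i v = 0 := by
  have h : LinearMap.ker (LinearMap.pi f) ≠ ⊥ :=
    LinearMap.ker_ne_bot_of_finrank_lt (by simp)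
  obtain ⟨v, hv, h0⟩ := Submodule.exists_mem_ne_zero_of_ne_bot h
  exact ⟨v, h0, fun i => congrFun (LinearMap.mem_ker.1 hv) i⟩

/-- `v ↦ bform a u v` as a linear map. -/
def bformRight (a : Fin 5 → Fin 5 → ℝ) (u : Fin 5 → ℝ) : (Fin 5 → ℝ) →ₗ[ℝ] ℝ where
  toFun := bform a u
  map_add' := bform_add_right u
  map_smul' c v := bform_smul_right c u v

/-- The left side is a determinant with first row `pfv a`; the relation says that `a` has rank at
most two. -/
lemma pfaffian_eq_zero (ha : IsSkew a) (h : pfv a = 0) (x y z w : Fin 5 → ℝ) :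
    bform a x y * bform a z w - bform a x z * bform a y w + bform a x w * bform a y z = 0 := by
  have := det_pfv ha ![x, y, z, w]
  rw [h, Matrix.det_eq_zero_of_row_eq_zero 0 (fun j => rfl)] at this
  simpa using this.symm

/-- If the pencil has rank at most two then it has a constant kernel. -/
lemma exists_common_kernel_of_ne (ha : IsSkew a) (hb : IsSkew b) (h0 : pfv a = 0)
    (h1 : pfm a b = 0) (h2 : pfv b = 0) {x y : Fin 5 → ℝ} (hxy : bform a x y ≠ 0) :
    ∃ v, v ≠ 0 ∧ (∀ w, bform a v w = 0) ∧ ∀ w, bform b v w = 0 := by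
  -- Four linear conditions in dimension five: `v` is orthogonal to `x` and `y` for both forms. In
  -- the Pfaffian relation on `x, y, v, w` only one product survives.
  obtain ⟨v, hv0, hv⟩ := exists_ne_zero_of_linear_conditions
    ![bformRight a x, bformRight a y, bformRight b x, bformRight b y]
  have e1 : bform a x v = 0 := hv 0
  have e2 : bform a y v = 0 := hv 1
  have e3 : bform b x v = 0 := hv 2
  have e4 : bform b y v = 0 := hv 3
  have h3 : pfv (a + b) = 0 := by
    rw [pfm, h0, h2] at h1; simpa using h1
  have ka : ∀ w, bform a v w = 0 := by
    intro w
    have h := pfaffian_eq_zero ha h0 x y v w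
    rw [e1, e2] at h
    simpa [hxy] using h
  refine ⟨v, hv0, ka, fun w => ?_⟩
  -- Subtracting the relation for `b` from that for `a + b` leaves the mixed term `a(x, y) b(v, w)`.
  have h := pfaffian_eq_zero (ha.add hb) h3 x y v w
  have h' := pfaffian_eq_zero hb h2 x y v w
  simp only [bform_add, e1, e2, e3, e4, ka] at h h'
  have : bform a x y * bform b v w = 0 := by linarith
  simpa [hxy] using this

lemma pfm_comm (a b : Fin 5 → Fin 5 → ℝ) : pfm a b = pfm b a := by
  rw [pfm, pfm, add_comm]; abel

namespace KroneckerPencil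

/-- An identically zero Pfaffian vector means rank at most two throughout the pencil, and such a
pencil has a constant kernel vector, that is, a kernel polynomial of degree 0. -/
lemma not_all_zero (h : KroneckerPencil a b) (h0 : pfv a = 0) (h1 : pfm a b = 0)
    (h2 : pfv b = 0) : False := by
  by_cases hA : ∃ x y, bform a x y ≠ 0
  · obtain ⟨x, y, hxy⟩ := hA
    obtain ⟨v, hv0, hv, hv'⟩ :=
      exists_common_kernel_of_ne h.skew_left h.skew_right h0 h1 h2 hxy
    exact hv0 (h.kernel_zero v hv hv')
  by_cases hB : ∃ x y, bform b x y ≠ 0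
  · obtain ⟨x, y, hxy⟩ := hB
    obtain ⟨v, hv0, hv, hv'⟩ :=
      exists_common_kernel_of_ne h.skew_right h.skew_left h2 (pfm_comm a b ▸ h1) h0 hxy
    exact hv0 (h.kernel_zero v hv' hv)
  · push Not at hA hB
    have := h.kernel_zero (Pi.single 0 1) (hA _) (hB _)
    simpa using congrFun this 0

/-- The vector of sub-Pfaffians vanishes nowhere on the pencil. -/
lemma pfv_comb_ne_zero (h : KroneckerPencil a b) {s t : ℝ} (hst : s ≠ 0 ∨ t ≠ 0) :
    pfv (s • a + t • b) ≠ 0 := by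
  intro hz
  have c1 := fun w => (bform_right_pfm h.skew_left h.skew_right w).1
  have c2 := fun w => (bform_right_pfm h.skew_left h.skew_right w).2
  have c0 := bform_pfv h.skew_left
  have c3 := bform_pfv h.skew_right
  rw [pfv_comb] at hz
  have hw : ∀ (d : Fin 5 → Fin 5 → ℝ) (w : Fin 5 → ℝ),
      s ^ 2 * bform d (pfv a) w + s * t * bform d (pfm a b) w + t ^ 2 * bform d (pfv b) w = 0 := by
    intro d w
    have := congrArg (fun v => bform d v w) hz
    simpa only [bform_add_left, bform_smul_left, bform_zero_left] using this
  by_cases hs : s = 0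
  · have ht : t ≠ 0 := by tauto
    subst hs
    have e2 : pfv b = 0 := by simpa [ht] using hz
    have := h.kernel_one (pfv a) (pfm a b) c0 c1 (fun w => by
      have := c2 w; rw [e2, bform_zero_left] at this; linarith)
    exact h.not_all_zero this.1 this.2 e2
  -- A zero at `(s, t)` makes the quadratic kernel polynomial divisible by a linear form: `s² P(x,
  -- y) = (s y - t x)(x (s e₁ + t e₂) + y s e₂)`. The quotient is a kernel polynomial of degree 1.
  · have := h.kernel_one (s • pfm a b + t • pfv b) (s • pfv b)
      (fun w => by
        have e1 := hw a w
        rw [c0 w] at e1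
        rw [bform_add_left, bform_smul_left, bform_smul_left]
        by_cases ht : t = 0
        · subst ht
          have e2 := hw b w
          rw [c3 w] at e2
          have e3 : bform b (pfv a) w = 0 := by
            have : s ^ 2 * bform b (pfv a) w = 0 := by linarith
            simpa [hs] using this
          linear_combination s * c1 w - s * e3
        · have : t * (s * bform a (pfm a b) w + t * bform a (pfv b) w) = 0 := by
            linear_combination e1
          simpa [ht] using this)
      (fun w => by
        rw [bform_add_left, bform_smul_left, bform_smul_left, bform_smul_left, c3 w]
        linear_combination s * c2 w)
      (fun w => by rw [bform_smul_left, c3 w, mul_zero])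
    have e2 : pfv b = 0 := by simpa [hs] using this.2
    have e1 : pfm a b = 0 := by simpa [hs, e2] using this.1
    have e0 : pfv a = 0 := by simpa [hs, e2, e1] using hz
    exact h.not_all_zero e0 e1 e2

lemma pfv_left_ne_zero (h : KroneckerPencil a b) : pfv a ≠ 0 := by
  simpa using h.pfv_comb_ne_zero (s := 1) (t := 0) (by simp)

lemma pfv_right_ne_zero (h : KroneckerPencil a b) : pfv b ≠ 0 := by
  simpa using h.pfv_comb_ne_zero (s := 0) (t := 1) (by simp)

/-- The three coefficients of the kernel polynomial are linearly independent. -/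
lemma coeffs_eq_zero (h : KroneckerPencil a b) {r s t : ℝ}
    (hz : r • pfv a + s • pfm a b + t • pfv b = 0) : r = 0 ∧ s = 0 ∧ t = 0 := by
  have c1 := fun w => (bform_right_pfm h.skew_left h.skew_right w).1
  have c2 := fun w => (bform_right_pfm h.skew_left h.skew_right w).2
  have c0 := bform_pfv h.skew_left
  have c3 := bform_pfv h.skew_right
  have hw : ∀ (d : Fin 5 → Fin 5 → ℝ) (w : Fin 5 → ℝ),
      r * bform d (pfv a) w + s * bform d (pfm a b) w + t * bform d (pfv b) w = 0 := by
    intro d w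
    have := congrArg (fun v => bform d v w) hz
    simpa only [bform_add_left, bform_smul_left, bform_zero_left] using this
  have key : ∀ r t : ℝ, r • pfv a + t • pfv b = 0 → r = 0 ∧ t = 0 := by
    intro r t hrt
    have hr : r = 0 := by
      by_contra hr
      refine h.pfv_left_ne_zero (h.kernel_zero _ c0 fun w => ?_)
      have := congrArg (fun v => bform b v w) hrt
      simp only [bform_add_left, bform_smul_left, bform_zero_left, c3 w] at this
      simpa [hr] using this
    refine ⟨hr, ?_⟩
    simpa [hr, h.pfv_right_ne_zero] using hrt
  by_cases hs : s = 0
  · subst hs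
    have := key r t (by simpa using hz)
    exact ⟨this.1, rfl, this.2⟩
  exfalso
  -- If `r t = s²`, then `r` times the relation says that the kernel polynomial vanishes at `(r,
  -- s)`. Otherwise, applying `a` and `b` to the relation and eliminating gives `a(pfv b, ·) = 0`,
  -- so `pfv b` is a constant kernel vector.
  by_cases hrt : r * t = s ^ 2
  · refine h.pfv_comb_ne_zero (s := r) (t := s) (Or.inr hs) ?_
    have h1 : (r ^ 2) • pfv a + (r * s) • pfm a b + s ^ 2 • pfv b =
        r • (r • pfv a + s • pfm a b + t • pfv b) := by
      rw [← hrt]; module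
    rw [pfv_comb, h1, hz, smul_zero]
  · refine h.pfv_right_ne_zero (h.kernel_zero _ (fun w => ?_) c3)
    have e1 := hw a w
    have e2 := hw b w
    rw [c0 w] at e1
    rw [c3 w] at e2
    have : (r * t - s ^ 2) * bform a (pfv b) w = 0 := by
      linear_combination r * e1 + s * e2 - r * s * c1 w - s ^ 2 * c2 w
    simpa [sub_ne_zero.2 hrt] using this

/-- The span of the coefficients of the kernel polynomial is isotropic. -/
lemma isotropic_right (h : KroneckerPencil a b) :
    bform b (pfv a) (pfm a b) = 0 ∧ bform b (pfv a) (pfv b) = 0 ∧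
      bform b (pfm a b) (pfv b) = 0 := by
  have c1 := fun w => (bform_right_pfm h.skew_left h.skew_right w).1
  have hs := bform_swap h.skew_right
  refine ⟨?_, ?_, ?_⟩
  · have := c1 (pfm a b)
    rw [bform_self h.skew_left] at this
    linarith
  · rw [hs, bform_pfv h.skew_right, neg_zero]
  · rw [hs, bform_pfv h.skew_right, neg_zero]

/-- The span of the coefficients is cut out by the functionals `b e₀` and `b e₁`. -/
lemma exists_comb_of_bform_eq_zero (h : KroneckerPencil a b) {v : Fin 5 → ℝ}
    (h0 : bform b (pfv a) v = 0) (h1 : bform b (pfm a b) v = 0) :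
    ∃ r s t : ℝ, v = r • pfv a + s • pfm a b + t • pfv b := by
  let f : (Fin 5 → ℝ) →ₗ[ℝ] (Fin 2 → ℝ) :=
    LinearMap.pi ![bformRight b (pfv a), bformRight b (pfm a b)]
  let e : Fin 3 → Fin 5 → ℝ := ![pfv a, pfm a b, pfv b]
  have he : LinearIndependent ℝ e := by
    rw [Fintype.linearIndependent_iff]
    intro g hg
    have := h.coeffs_eq_zero (r := g 0) (s := g 1) (t := g 2) (by
      simpa [Fin.sum_univ_three, e] using hg)
    intro i
    fin_cases i
    exacts [this.1, this.2.1, this.2.2]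
  -- A dependence between the two functionals puts a combination of `pfv a` and `pfm a b` in the
  -- kernel of `b`, the line of `pfv b`, against independence. So the common kernel of the
  -- functionals has dimension 3; it contains the three coefficients by isotropy, hence equals their
  -- span.
  have hsurj : Function.Surjective f := by
    rw [← LinearMap.range_eq_top]
    by_contra hne
    obtain ⟨φ, hφ, hφ'⟩ := Submodule.exists_dual_map_eq_bot_of_lt_top (lt_top_iff_ne_top.2 hne)
      inferInstance
    have hφv : ∀ v, φ ![1, 0] * bform b (pfv a) v + φ ![0, 1] * bform b (pfm a b) v = 0 := by
      intro v
      have h1 : φ (f v) = 0 := by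
        have : φ (f v) ∈ (LinearMap.range f).map φ := ⟨f v, ⟨v, rfl⟩, rfl⟩
        rwa [hφ', Submodule.mem_bot] at this
      have h2 : f v = bform b (pfv a) v • ![1, 0] + bform b (pfm a b) v • ![0, 1] := by
        ext i; fin_cases i <;> simp [f, bformRight]
      rw [h2, map_add, map_smul, map_smul, smul_eq_mul, smul_eq_mul] at h1
      linarith
    obtain ⟨c, hc⟩ := exists_smul_pfv h.skew_right h.pfv_right_ne_zero
      (v := φ ![1, 0] • pfv a + φ ![0, 1] • pfm a b) (fun w => by
        rw [bform_add_left, bform_smul_left, bform_smul_left]; exact hφv w)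
    have := h.coeffs_eq_zero (r := φ ![1, 0]) (s := φ ![0, 1]) (t := -c) (by rw [hc]; module)
    refine hφ (LinearMap.ext fun u => ?_)
    have hu : u = u 0 • ![1, 0] + u 1 • ![0, 1] := by
      ext i; fin_cases i <;> simp
    rw [hu, map_add, map_smul, map_smul, this.1, this.2.1]
    simp
  have hker : Module.finrank ℝ (LinearMap.ker f) = 3 := by
    have := LinearMap.finrank_range_add_finrank_ker f
    rw [LinearMap.range_eq_top.2 hsurj, finrank_top] at this
    simp at this
    omega
  have hle : Submodule.span ℝ (Set.range e) ≤ LinearMap.ker f := by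
    rw [Submodule.span_le]
    have hi := h.isotropic_right
    have hs := bform_swap h.skew_right
    rintro _ ⟨i, rfl⟩
    refine LinearMap.mem_ker.2 ?_
    ext j
    fin_cases i <;> fin_cases j <;>
      simp [f, e, bformRight, bform_self h.skew_right, hi.1, hi.2.1, hi.2.2, hs (pfm a b) (pfv a)]
  have heq : Submodule.span ℝ (Set.range e) = LinearMap.ker f :=
    Submodule.eq_of_le_of_finrank_eq hle (by rw [finrank_span_eq_card he, hker]; simp)
  have hv : v ∈ Submodule.span ℝ (Set.range e) := by
    rw [heq]
    refine LinearMap.mem_ker.2 ?_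
    ext j
    fin_cases j
    exacts [h0, h1]
  obtain ⟨g, hg⟩ := (Submodule.mem_span_range_iff_exists_fun ℝ).1 hv
  exact ⟨g 0, g 1, g 2, by simpa [Fin.sum_univ_three, e] using hg.symm⟩

end KroneckerPencil
end Pfaffian

/-! ### The exterior square of a skew form -/

section WedgeSquare

/-- Each of the three pairings of four indices comes from eight permutations, all with the same
signed contribution. -/
lemma sum_perm_fin_four (f : Fin 4 → Fin 4 → ℝ) (hf : ∀ i j, f i j = - f j i) :
    ∑ σ : Equiv.Perm (Fin 4), ((Equiv.Perm.sign σ : ℤ) : ℝ) * (f (σ 0) (σ 1) * f (σ 2) (σ 3)) =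
      8 * (f 0 1 * f 2 3 - f 0 2 * f 1 3 + f 0 3 * f 1 2) := by
  -- The indices are written as iterated successors so that `decomposeFin` can peel the permutations
  -- one index at a time.
  have key : ∀ σ : Equiv.Perm (Fin 4), f (σ 0) (σ 1) * f (σ 2) (σ 3) =
      f (σ 0) (σ (Fin.succ 0)) *
        f (σ (Fin.succ (Fin.succ 0))) (σ (Fin.succ (Fin.succ (Fin.succ 0)))) := fun _ => rfl
  simp only [key]
  rw [← Equiv.sum_comp (Equiv.Perm.decomposeFin.symm), Fintype.sum_prod_type]
  simp only [← Equiv.sum_comp (Equiv.Perm.decomposeFin (n := 2)).symm, Fintype.sum_prod_type,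
    ← Equiv.sum_comp (Equiv.Perm.decomposeFin (n := 1)).symm,
    ← Equiv.sum_comp (Equiv.Perm.decomposeFin (n := 0)).symm,
    Equiv.Perm.decomposeFin_symm_apply_succ, Equiv.Perm.decomposeFin_symm_apply_zero,
    Equiv.Perm.decomposeFin.symm_sign, Fin.sum_univ_succ]
  simp [Equiv.swap_apply_def, Fin.ext_iff]
  rw [hf 1 0, hf 2 0, hf 3 0, hf 2 1, hf 3 1, hf 3 2]
  ring

/-- The square of a skew form is twice its Pfaffian. -/
lemma wedgePower_two {V : Type*} {φ : V → V → ℝ} (hφ : ∀ u v, φ u v = - φ v u) (u : Fin 4 → V) :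
    wedgePower φ 2 u = 2 * (φ (u 0) (u 1) * φ (u 2) (u 3) - φ (u 0) (u 2) * φ (u 1) (u 3) +
      φ (u 0) (u 3) * φ (u 1) (u 2)) := by
  have h := sum_perm_fin_four (fun i j => φ (u i) (u j)) (fun i j => hφ _ _)
  have e : wedgePower φ 2 u = (1 / 2 ^ 2) * ∑ σ : Equiv.Perm (Fin 4),
      ((Equiv.Perm.sign σ : ℤ) : ℝ) *
        (φ (u (σ 0)) (u (σ 1)) * φ (u (σ 2)) (u (σ 3))) := by
    rw [wedgePower]
    congr 1
    refine Finset.sum_congr rfl fun σ _ => ?_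
    rw [Fin.prod_univ_two]
    rfl
  rw [e, h]
  ring

end WedgeSquare

/-! ### The pencil `A^*` in an adapted frame -/

section Pointwise

set_option linter.unusedSectionVars false

variable {E : Type*} [NormedAddCommGroup E] [NormedSpace ℝ E]
  {H : Type*} [TopologicalSpace H] {I : ModelWithCorners ℝ E H}
  {N : Type*} [TopologicalSpace N] [ChartedSpace H N] [IsManifold I ∞ N]

lemma mvfderiv_eq_zero_of_eventually {h : N → ℝ} {x : N} {r : ℝ} (hh : ∀ᶠ y in 𝓝 x, h y = r)
    (v : TangentSpace I x) : mvfderiv I h x v = 0 := by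
  have e : h =ᶠ[𝓝 x] fun _ => r := hh
  have e1 : mfderiv I 𝓘(ℝ, ℝ) h x = mfderiv I 𝓘(ℝ, ℝ) (fun _ => r) x := e.mfderiv_eq
  rw [mfderiv_const] at e1
  exact congrArg (fun T : E →L[ℝ] ℝ => T v) e1

/-- For fields in the kernel of the form, Cartan's formula loses its derivative terms and becomes
tensorial. This makes the pencil well defined, and it later serves for `θ_k` on `D_3`. -/
lemma form_mlieBracket_of_eventually_zero {x : N} {α : ∀ y : N, TangentSpace I y →L[ℝ] ℝ}
    (hα : SmoothFormAt α x) {X Y : ∀ y : N, TangentSpace I y} (hX : SmoothFieldAt X x)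
    (hY : SmoothFieldAt Y x) (hX0 : ∀ᶠ y in 𝓝 x, α y (X y) = 0)
    (hY0 : ∀ᶠ y in 𝓝 x, α y (Y y) = 0) :
    α x (VectorField.mlieBracket I X Y x) = negExtDeriv α x (X x) (Y x) := by
  rw [form_mlieBracket hα hX hY, mvfderiv_eq_zero_of_eventually hX0,
    mvfderiv_eq_zero_of_eventually hY0, sub_self, zero_add]

lemma form_horiz_mlieBracket_of_eventually_zero {x : N} {t : ℝ}
    {α : ∀ y : N, TangentSpace I y →L[ℝ] ℝ} (hα : SmoothFormAt α x)
    {X Y : ∀ z : N × ℝ, TangentSpace (I.prod 𝓘(ℝ, ℝ)) z}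
    (hX : SmoothFieldAt X (x, t)) (hY : SmoothFieldAt Y (x, t))
    (hX0 : ∀ᶠ z in 𝓝 (x, t), α z.1 (horiz I z (X z)) = 0)
    (hY0 : ∀ᶠ z in 𝓝 (x, t), α z.1 (horiz I z (Y z)) = 0) :
    α x (horiz I (x, t) (VectorField.mlieBracket (I.prod 𝓘(ℝ, ℝ)) X Y (x, t))) =
      negExtDeriv α x (horiz I (x, t) (X (x, t))) (horiz I (x, t) (Y (x, t))) := by
  rw [form_horiz_mlieBracket hα hX hY, mvfderiv_eq_zero_of_eventually hX0,
    mvfderiv_eq_zero_of_eventually hY0, sub_self, zero_add]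

namespace AdaptedFrame

variable {D : ∀ y : N, Submodule ℝ (TangentSpace I y)} {x : N} {c : AffineChart I D x}
  (S : AdaptedFrame D x c) {y : N}

/-- The vector with given coordinates in the frame of `D`. -/
def vec (y : N) (u : Fin 5 → ℝ) : TangentSpace I y := ∑ i, u i • S.X i y

/-- The coordinates in the frame of `D`. -/
def coords (y : N) (v : TangentSpace I y) : Fin 5 → ℝ := fun i => S.ξ i y v

/-- The matrix of `A^*(α)`. -/
def a (y : N) (i j : Fin 5) : ℝ := c.α y (VectorField.mlieBracket I (S.X i) (S.X j) y)

/-- The matrix of `A^*(β)`. -/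
def b (y : N) (i j : Fin 5) : ℝ := c.β y (VectorField.mlieBracket I (S.X i) (S.X j) y)

lemma vec_add (u v : Fin 5 → ℝ) : S.vec y (u + v) = S.vec y u + S.vec y v := by
  simp only [vec, Pi.add_apply, add_smul, Finset.sum_add_distrib]

lemma vec_smul (r : ℝ) (u : Fin 5 → ℝ) : S.vec y (r • u) = r • S.vec y u := by
  simp only [vec, Pi.smul_apply, smul_eq_mul, mul_smul, Finset.smul_sum]

lemma X_mem (hy : y ∈ S.dom) (i : Fin 5) : S.X i y ∈ D y :=
  S.span_X y hy ▸ Submodule.subset_span ⟨i, rfl⟩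

lemma vec_mem (hy : y ∈ S.dom) (u : Fin 5 → ℝ) : S.vec y u ∈ D y :=
  Submodule.sum_mem _ fun i _ => Submodule.smul_mem _ _ (S.X_mem hy i)

lemma α_mem (hy : y ∈ S.dom) : c.α y ∈ annihilator I D y :=
  S.span_αβ y hy ▸ Submodule.subset_span (by simp)

lemma β_mem (hy : y ∈ S.dom) : c.β y ∈ annihilator I D y :=
  S.span_αβ y hy ▸ Submodule.subset_span (by simp)

lemma mem_D_iff (hy : y ∈ S.dom) {v : TangentSpace I y} :
    v ∈ D y ↔ c.α y v = 0 ∧ c.β y v = 0 := by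
  refine ⟨fun h => ⟨S.α_mem hy v h, S.β_mem hy v h⟩, fun h => ?_⟩
  rw [S.expand y hy v, h.1, h.2, zero_smul, zero_smul, add_zero, add_zero]
  exact S.vec_mem hy _

lemma vec_coords (hy : y ∈ S.dom) {v : TangentSpace I y} (hv : v ∈ D y) :
    S.vec y (S.coords y v) = v := by
  have h := S.expand y hy v
  rw [((S.mem_D_iff hy).1 hv).1, ((S.mem_D_iff hy).1 hv).2, zero_smul, zero_smul, add_zero,
    add_zero] at h
  exact h.symm

lemma coords_vec (hy : y ∈ S.dom) (u : Fin 5 → ℝ) : S.coords y (S.vec y u) = u := by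
  funext i
  simp only [coords, vec, map_sum, map_smul, S.ξ_X y hy, smul_eq_mul, mul_ite, mul_one, mul_zero,
    Finset.sum_ite_eq, Finset.mem_univ, if_true]

lemma eq_of_annihilator (hy : y ∈ S.dom) {p : TangentSpace I y →L[ℝ] ℝ}
    (hp : p ∈ annihilator I D y) : p = p (S.Y 0 y) • c.α y + p (S.Y 1 y) • c.β y := by
  ext v
  have hz : ∀ i, p (S.X i y) = 0 := fun i => hp _ (S.X_mem hy i)
  conv_lhs => rw [S.expand y hy v]
  simp only [map_add, map_sum, map_smul, hz, mul_zero, Finset.sum_const_zero, zero_add, add_apply,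
    smul_apply, smul_eq_mul]
  ring

lemma dom_mem_nhds (hy : y ∈ S.dom) : S.dom ∈ 𝓝 y := S.isOpen_dom.mem_nhds hy

lemma α_mlieBracket (hy : y ∈ S.dom) {X Y : ∀ y : N, TangentSpace I y}
    (hX : IsSectionAt I D X y) (hY : IsSectionAt I D Y y) :
    c.α y (VectorField.mlieBracket I X Y y) = negExtDeriv c.α y (X y) (Y y) := by
  refine form_mlieBracket_of_eventually_zero (S.smooth_α y hy) hX.self_of_nhds.1
    hY.self_of_nhds.1 ?_ ?_
  · filter_upwards [S.dom_mem_nhds hy, hX] with z h1 h2 using S.α_mem h1 _ h2.2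
  · filter_upwards [S.dom_mem_nhds hy, hY] with z h1 h2 using S.α_mem h1 _ h2.2

lemma β_mlieBracket (hy : y ∈ S.dom) {X Y : ∀ y : N, TangentSpace I y}
    (hX : IsSectionAt I D X y) (hY : IsSectionAt I D Y y) :
    c.β y (VectorField.mlieBracket I X Y y) = negExtDeriv c.β y (X y) (Y y) := by
  refine form_mlieBracket_of_eventually_zero (S.smooth_β y hy) hX.self_of_nhds.1
    hY.self_of_nhds.1 ?_ ?_
  · filter_upwards [S.dom_mem_nhds hy, hX] with z h1 h2 using S.β_mem h1 _ h2.2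
  · filter_upwards [S.dom_mem_nhds hy, hY] with z h1 h2 using S.β_mem h1 _ h2.2

lemma isSectionAt_vec (hy : y ∈ S.dom) {u : Fin 5 → N → ℝ}
    (hu : ∀ i, ∀ z ∈ S.dom, SmoothFunAt I (u i) z) :
    IsSectionAt I D (fun z => S.vec z (fun i => u i z)) y := by
  filter_upwards [S.dom_mem_nhds hy] with z hz
  exact ⟨SmoothFieldAt.sum fun i _ => SmoothFieldAt.smul (hu i z hz) (S.smooth_X i z hz),
    S.vec_mem hz _⟩

lemma isSectionAt_X (hy : y ∈ S.dom) (i : Fin 5) : IsSectionAt I D (S.X i) y := by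
  filter_upwards [S.dom_mem_nhds hy] with z hz using ⟨S.smooth_X i z hz, S.X_mem hz i⟩

lemma isSectionAt_vec_const (hy : y ∈ S.dom) (u : Fin 5 → ℝ) :
    IsSectionAt I D (fun z => S.vec z u) y :=
  S.isSectionAt_vec hy (u := fun i _ => u i) fun _ _ _ => contMDiffAt_const

lemma isSkew_a : IsSkew (S.a y) := fun i j => by
  rw [a, a, VectorField.mlieBracket_swap_apply, map_neg]

lemma isSkew_b : IsSkew (S.b y) := fun i j => by
  rw [b, b, VectorField.mlieBracket_swap_apply, map_neg]

lemma negExtDeriv_α_vec (hy : y ∈ S.dom) (u v : Fin 5 → ℝ) :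
    negExtDeriv c.α y (S.vec y u) (S.vec y v) = bform (S.a y) u v := by
  simp only [vec, map_sum, map_smul, sum_apply, smul_apply, smul_eq_mul, bform, a,
    S.α_mlieBracket hy (S.isSectionAt_X hy _) (S.isSectionAt_X hy _), Finset.mul_sum]
  rw [Finset.sum_comm]
  exact Finset.sum_congr rfl fun i _ => Finset.sum_congr rfl fun j _ => by ring

lemma negExtDeriv_β_vec (hy : y ∈ S.dom) (u v : Fin 5 → ℝ) :
    negExtDeriv c.β y (S.vec y u) (S.vec y v) = bform (S.b y) u v := by
  simp only [vec, map_sum, map_smul, sum_apply, smul_apply, smul_eq_mul, bform, b,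
    S.β_mlieBracket hy (S.isSectionAt_X hy _) (S.isSectionAt_X hy _), Finset.mul_sum]
  rw [Finset.sum_comm]
  exact Finset.sum_congr rfl fun i _ => Finset.sum_congr rfl fun j _ => by ring

lemma smoothFunAt_a [CompleteSpace E] (hy : y ∈ S.dom) (i j : Fin 5) :
    SmoothFunAt I (fun z => S.a z i j) y :=
  SmoothFormAt.apply (S.smooth_α y hy) ((S.smooth_X i y hy).mlieBracket (S.smooth_X j y hy))

lemma smoothFunAt_b [CompleteSpace E] (hy : y ∈ S.dom) (i j : Fin 5) :
    SmoothFunAt I (fun z => S.b z i j) y :=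
  SmoothFormAt.apply (S.smooth_β y hy) ((S.smooth_X i y hy).mlieBracket (S.smooth_X j y hy))

/-- Constant coefficients in the frame give a section through any vector of `D`, so the default
value in `sectionThrough` is never taken. -/
lemma sectionThrough_spec (hy : y ∈ S.dom) (v : D y) :
    IsSectionAt I D (sectionThrough I D y v) y ∧ sectionThrough I D y v y = v := by
  have h : ∃ X : ∀ y : N, TangentSpace I y, IsSectionAt I D X y ∧ X y = v :=
    ⟨fun z => S.vec z (S.coords y v), S.isSectionAt_vec_const hy _, S.vec_coords hy v.2⟩
  rw [sectionThrough, dif_pos h]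
  exact h.choose_spec

lemma annihilator_mlieBracket (hy : y ∈ S.dom) {p : TangentSpace I y →L[ℝ] ℝ}
    (hp : p ∈ annihilator I D y) {X Y : ∀ y : N, TangentSpace I y}
    (hX : IsSectionAt I D X y) (hY : IsSectionAt I D Y y) :
    p (VectorField.mlieBracket I X Y y) =
      bform (p (S.Y 0 y) • S.a y + p (S.Y 1 y) • S.b y) (S.coords y (X y)) (S.coords y (Y y)) := by
  rw [bform_comb, ← S.negExtDeriv_α_vec hy, ← S.negExtDeriv_β_vec hy,
    S.vec_coords hy hX.self_of_nhds.2, S.vec_coords hy hY.self_of_nhds.2,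
    ← S.α_mlieBracket hy hX hY, ← S.β_mlieBracket hy hX hY]
  exact congrArg (fun q : TangentSpace I y →L[ℝ] ℝ => q (VectorField.mlieBracket I X Y y))
    (S.eq_of_annihilator hy hp)

lemma pencil_eq (hy : y ∈ S.dom) {p : TangentSpace I y →L[ℝ] ℝ}
    (hp : p ∈ annihilator I D y) (v w : D y) :
    pencil I D y p v w =
      bform (p (S.Y 0 y) • S.a y + p (S.Y 1 y) • S.b y) (S.coords y v) (S.coords y w) := by
  rw [pencil, S.annihilator_mlieBracket hy hp (S.sectionThrough_spec hy v).1
    (S.sectionThrough_spec hy w).1, (S.sectionThrough_spec hy v).2,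
    (S.sectionThrough_spec hy w).2]

end AdaptedFrame
end Pointwise

/-! ### Determinants as functions of the first row -/

section DetRow

/-- Taking for `u` the standard basis vectors other than the `i`-th, the determinant is `± w i`. -/
lemma eq_zero_of_det_vecCons {w : Fin 5 → ℝ}
    (h : ∀ u : Fin 4 → Fin 5 → ℝ, (Matrix.of (Matrix.vecCons w u)).det = 0) : w = 0 := by
  funext i
  have h' := h fun k => Pi.single (i.succAbove k) 1
  rw [Matrix.det_succ_row_zero, Finset.sum_eq_single i] at h'
  · have e : (Matrix.of (Matrix.vecCons w fun k => Pi.single (i.succAbove k) 1)).submatrix Fin.succ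
        i.succAbove = 1 := by
      ext k l
      simp [Pi.single_apply, Matrix.one_apply, eq_comm]
    rw [e, Matrix.det_one, mul_one] at h'
    exact (mul_eq_zero.1 h').resolve_left (pow_ne_zero _ (by norm_num))
  · intro j _ hj
    obtain ⟨k, hk⟩ := Fin.exists_succAbove_eq hj
    rw [Matrix.det_eq_zero_of_row_eq_zero k, mul_zero]
    intro l
    simp [hk, Pi.single_apply, Fin.succAbove_ne]
  · simp

lemma det_vecCons_sub (v w : Fin 5 → ℝ) (u : Fin 4 → Fin 5 → ℝ) :
    (Matrix.of (Matrix.vecCons (v - w) u)).det =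
      (Matrix.of (Matrix.vecCons v u)).det - (Matrix.of (Matrix.vecCons w u)).det := by
  simp only [Matrix.det_succ_row_zero (n := 4), ← Finset.sum_sub_distrib]
  refine Finset.sum_congr rfl fun i _ => ?_
  simp only [Matrix.of_apply, Matrix.cons_val_zero, Pi.sub_apply]
  -- The minors along the first row involve only `u`.
  change _ * (Matrix.of u |>.submatrix id _).det = _ * (Matrix.of u |>.submatrix id _).det -
    _ * (Matrix.of u |>.submatrix id _).det
  ring

lemma det_vecCons_smul (r : ℝ) (w : Fin 5 → ℝ) (u : Fin 4 → Fin 5 → ℝ) :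
    (Matrix.of (Matrix.vecCons (r • w) u)).det = r * (Matrix.of (Matrix.vecCons w u)).det := by
  simp only [Matrix.det_succ_row_zero (n := 4), Finset.mul_sum]
  refine Finset.sum_congr rfl fun i _ => ?_
  simp only [Matrix.of_apply, Matrix.cons_val_zero, Pi.smul_apply, smul_eq_mul]
  change _ * (Matrix.of u |>.submatrix id _).det = _ * (_ * (Matrix.of u |>.submatrix id _).det)
  ring

end DetRow

/-! ### The Kronecker index and `D_3` in coordinates -/

section KernelSpan

set_option linter.unusedSectionVars false

variable {E : Type*} [NormedAddCommGroup E] [NormedSpace ℝ E]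
  {H : Type*} [TopologicalSpace H] {I : ModelWithCorners ℝ E H}
  {N : Type*} [TopologicalSpace N] [ChartedSpace H N] [IsManifold I ∞ N]

namespace AdaptedFrame

variable {D : ∀ y : N, Submodule ℝ (TangentSpace I y)} {x : N} {c : AffineChart I D x}
  (S : AdaptedFrame D x c) {y : N}

/-- The frame of `D`, as vectors of `D y`. -/
def vecD (hy : y ∈ S.dom) (u : Fin 5 → ℝ) : D y := ⟨S.vec y u, S.vec_mem hy u⟩

/-- `D y` in coordinates. -/
def equiv (hy : y ∈ S.dom) : D y ≃ₗ[ℝ] (Fin 5 → ℝ) where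
  toFun v := S.coords y v
  map_add' u v := by funext i; exact map_add (S.ξ i y) _ _
  map_smul' r v := by funext i; exact map_smul (S.ξ i y) _ _
  invFun u := S.vecD hy u
  left_inv v := Subtype.ext (S.vec_coords hy v.2)
  right_inv u := S.coords_vec hy u

lemma pencil_vecD (hy : y ∈ S.dom) {p : TangentSpace I y →L[ℝ] ℝ}
    (hp : p ∈ annihilator I D y) (u : Fin 5 → ℝ) (w : D y) :
    pencil I D y p (S.vecD hy u) w =
      p (S.Y 0 y) * bform (S.a y) u (S.coords y w) +
        p (S.Y 1 y) * bform (S.b y) u (S.coords y w) := by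
  rw [S.pencil_eq hy hp, bform_comb]
  change _ * bform (S.a y) (S.coords y (S.vec y u)) _ +
    _ * bform (S.b y) (S.coords y (S.vec y u)) _ = _
  rw [S.coords_vec hy]

lemma vecD_eq_zero (hy : y ∈ S.dom) {u : Fin 5 → ℝ} (h : S.vecD hy u = 0) : u = 0 :=
  (S.equiv hy).symm.map_eq_zero_iff.1 h

/-- Evaluation on `Y i` as a linear form on `D^⊥`. -/
def evalY (y : N) (i : Fin 2) : annihilator I D y →ₗ[ℝ] ℝ where
  toFun p := p.1 (S.Y i y)
  map_add' _ _ := rfl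
  map_smul' _ _ := rfl

lemma exists_annihilator (hy : y ∈ S.dom) (s t : ℝ) :
    ∃ p : annihilator I D y, p.1 = s • c.α y + t • c.β y ∧ p.1 (S.Y 0 y) = s ∧
      p.1 (S.Y 1 y) = t := by
  refine ⟨⟨s • c.α y + t • c.β y, Submodule.add_mem _ (Submodule.smul_mem _ _ (S.α_mem hy))
    (Submodule.smul_mem _ _ (S.β_mem hy))⟩, rfl, ?_, ?_⟩
  · simp only [add_apply, smul_apply, (S.α_Y y hy).1, (S.β_Y y hy).1, smul_eq_mul, mul_one,
      mul_zero, add_zero]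
  · simp only [add_apply, smul_apply, (S.α_Y y hy).2, (S.β_Y y hy).2, smul_eq_mul, mul_one,
      mul_zero, zero_add]

/-- In an adapted frame, a pencil of maximal first Kronecker index is a Kronecker pencil. -/
theorem kroneckerPencil (hy : y ∈ S.dom) (hk : kroneckerIndex I D y = 2) :
    KroneckerPencil (S.a y) (S.b y) := by
  have not_mem : ∀ d < 2, ¬ ∃ B : MultilinearMap ℝ (fun _ : Fin d => annihilator I D y) (D y),
      (∃ p, B (fun _ => p) ≠ 0) ∧
      ∀ p : annihilator I D y, ∀ w : D y, pencil I D y p (B fun _ => p) w = 0 := by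
    intro d hd h
    have h' : kroneckerIndex I D y ≤ d := Nat.sInf_le h
    omega
  refine ⟨S.isSkew_a, S.isSkew_b, fun v h1 h2 => ?_, fun u v h0 h1 h2 => ?_⟩
  · by_contra hv
    refine not_mem 0 (by norm_num) ⟨MultilinearMap.constOfIsEmpty ℝ _ (S.vecD hy v),
      ⟨0, fun h => hv (S.vecD_eq_zero hy h)⟩, fun p w => ?_⟩
    refine (S.pencil_vecD hy p.2 v w).trans ?_
    rw [h1, h2, mul_zero, mul_zero, add_zero]
  · by_contra huv
    -- The linear kernel polynomial `sα + tβ ↦ s u + t v`; evaluation on the dual vectors `Y`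
    -- recovers `s` and `t`.
    let L : annihilator I D y →ₗ[ℝ] D y :=
      (S.equiv hy).symm.toLinearMap ∘ₗ
        ((S.evalY y 0).smulRight u + (S.evalY y 1).smulRight v)
    have hL : ∀ p, L p = S.vecD hy (p.1 (S.Y 0 y) • u + p.1 (S.Y 1 y) • v) := fun p => rfl
    refine not_mem 1 (by norm_num) ⟨MultilinearMap.ofSubsingleton ℝ _ _ 0 L, ?_, fun p w => ?_⟩
    · by_contra hne
      push Not at hne
      refine huv ⟨?_, ?_⟩
      · obtain ⟨p, -, e0, e1⟩ := S.exists_annihilator hy 1 0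
        have h : L p = 0 := hne p
        rw [hL, e0, e1, one_smul, zero_smul, add_zero] at h
        exact S.vecD_eq_zero hy h
      · obtain ⟨p, -, e0, e1⟩ := S.exists_annihilator hy 0 1
        have h : L p = 0 := hne p
        rw [hL, e0, e1, one_smul, zero_smul, zero_add] at h
        exact S.vecD_eq_zero hy h
    · change pencil I D y p (L p) w = 0
      rw [hL, S.pencil_vecD hy p.2]
      simp only [bform_add_left, bform_smul_left, h0, h2]
      linear_combination (p.1 (S.Y 0 y) * p.1 (S.Y 1 y)) * h1 (S.coords y w)

/-- The coefficients of the kernel polynomial, in coordinates. -/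
def e (y : N) : Fin 3 → Fin 5 → ℝ := ![pfv (S.a y), pfm (S.a y) (S.b y), pfv (S.b y)]

/-- The coefficients of the kernel polynomial, as vector fields. -/
def eField (i : Fin 3) (y : N) : TangentSpace I y := S.vec y (S.e y i)

lemma eField_mem (hy : y ∈ S.dom) (i : Fin 3) : S.eField i y ∈ D y := S.vec_mem hy _

/-- The exterior square is twice the Pfaffian, and the Pfaffian on four vectors is a determinant
with first row `pfv`. So `pfv` represents `X_p` up to a scalar. -/
lemma wedgePower_pencil (hy : y ∈ S.dom) {p : TangentSpace I y →L[ℝ] ℝ}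
    (hp : p ∈ annihilator I D y) (u : Fin 4 → D y) :
    wedgePower (pencil I D y p) 2 u = 2 * (Matrix.of (Matrix.vecCons
      (pfv (p (S.Y 0 y) • S.a y + p (S.Y 1 y) • S.b y)) fun i => S.coords y (u i))).det := by
  have hs := (S.isSkew_a (y := y)).comb (S.isSkew_b (y := y)) (p (S.Y 0 y)) (p (S.Y 1 y))
  rw [wedgePower_two, det_pfv hs]
  · simp only [S.pencil_eq hy hp]
  · intro v w
    rw [S.pencil_eq hy hp, S.pencil_eq hy hp, bform_swap hs]

/-- `D_3` is spanned by the coefficients of the kernel polynomial. -/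
theorem kernelSpan_eq (hy : y ∈ S.dom) :
    kernelSpan I 2 D y = Submodule.span ℝ (Set.range fun i => S.eField i y) := by
  let bs : Module.Basis (Fin 5) ℝ (D y) := Module.Basis.ofEquivFun (S.equiv hy)
  have hdet : ∀ v : Fin 5 → D y, bs.det v = (Matrix.of fun i => S.coords y (v i)).det := by
    intro v
    rw [Module.Basis.det_apply, ← Matrix.det_transpose]
    rfl
  have hcons : ∀ (X : D y) (u : Fin 4 → D y),
      (Matrix.of fun i => S.coords y (Matrix.vecCons X u i : D y)) =
        Matrix.of (Matrix.vecCons (S.coords y X) fun i => S.coords y (u i)) := by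
    intro X u
    ext i j
    refine Fin.cases ?_ (fun i => ?_) i <;> rfl
  apply le_antisymm
  · refine Submodule.span_le.2 ?_
    rintro _ ⟨Ω, hΩ, p, hp, X, rfl, hX⟩
    have e1 : Ω = Ω bs • bs.det := Ω.eq_smul_basis_det bs
    set r := Ω bs with hr
    have hr0 : r ≠ 0 := fun h0 => hΩ (by rw [e1, h0, zero_smul])
    set q := pfv (p (S.Y 0 y) • S.a y + p (S.Y 1 y) • S.b y) with hq
    -- Every volume form is a multiple `r` of the coordinate determinant, and a vector is determined
    -- by its contraction with a volume form.
    have key : r • S.coords y X = (2 : ℝ) • q := by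
      refine sub_eq_zero.1 (eq_zero_of_det_vecCons fun u => ?_)
      have h := hX fun i => (S.equiv hy).symm (u i)
      rw [S.wedgePower_pencil hy hp, e1, AlternatingMap.smul_apply, hdet, hcons] at h
      have hu : (fun i => S.coords y ((S.equiv hy).symm (u i) : D y)) = u := by
        funext i; exact (S.equiv hy).apply_symm_apply (u i)
      rw [hu] at h
      rw [det_vecCons_sub, det_vecCons_smul, det_vecCons_smul]
      exact sub_eq_zero.2 h
    have key' : (X : TangentSpace I y) = (2 * r⁻¹) • S.vec y q := by
      rw [← S.vec_smul, ← S.vec_coords hy X.2]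
      congr 1
      rw [mul_comm, mul_smul, ← key, smul_smul, inv_mul_cancel₀ hr0, one_smul]
    change (X : TangentSpace I y) ∈ _
    rw [key', hq, pfv_comb, S.vec_add, S.vec_add, S.vec_smul, S.vec_smul, S.vec_smul]
    have hm : ∀ i, S.eField i y ∈ Submodule.span ℝ (Set.range fun i => S.eField i y) :=
      fun i => Submodule.subset_span ⟨i, rfl⟩
    exact Submodule.smul_mem _ _ (Submodule.add_mem _ (Submodule.add_mem _
      (Submodule.smul_mem _ _ (hm 0)) (Submodule.smul_mem _ _ (hm 1)))
      (Submodule.smul_mem _ _ (hm 2)))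
  · have hmem : ∀ s t : ℝ, S.vec y (pfv (s • S.a y + t • S.b y)) ∈ kernelSpan I 2 D y := by
      intro s t
      obtain ⟨p, -, e0, e1⟩ := S.exists_annihilator hy s t
      -- The factor 2 in the volume form absorbs the one in the exterior square, so that `X_p` is
      -- exactly `pfv`.
      refine Submodule.subset_span ⟨(2 : ℝ) • bs.det, ?_, p, p.2, S.vecD hy _, rfl, fun u => ?_⟩
      · exact smul_ne_zero two_ne_zero bs.det_ne_zero
      · rw [S.wedgePower_pencil hy p.2, AlternatingMap.smul_apply, hdet, hcons, e0, e1]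
        change (2 : ℝ) * (Matrix.of (Matrix.vecCons (S.coords y (S.vec y _)) _)).det = _
        rw [S.coords_vec hy]
    have h0 : S.eField 0 y ∈ kernelSpan I 2 D y := by
      have h := hmem 1 0
      rw [one_smul, zero_smul, add_zero] at h
      exact h
    have h2 : S.eField 2 y ∈ kernelSpan I 2 D y := by
      have h := hmem 0 1
      rw [one_smul, zero_smul, zero_add] at h
      exact h
    -- The middle coefficient is recovered by polarization, from the values at `α + β`, `α` and `β`.
    have h1 : S.eField 1 y ∈ kernelSpan I 2 D y := by
      have h := hmem 1 1
      rw [pfv_comb, S.vec_add, S.vec_add, S.vec_smul, S.vec_smul, S.vec_smul] at h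
      have h' := Submodule.sub_mem _ (Submodule.sub_mem _ h h0) h2
      convert h' using 1
      change S.vec y (pfm _ _) = _ - S.vec y (pfv _) - S.vec y (pfv _)
      module
    refine Submodule.span_le.2 ?_
    rintro _ ⟨i, rfl⟩
    fin_cases i
    exacts [h0, h1, h2]

end AdaptedFrame
end KernelSpan

/-! ### Brackets of sections of `D_3` and the obstruction cubic -/

section Derived

set_option linter.unusedSectionVars false

variable {E : Type*} [NormedAddCommGroup E] [NormedSpace ℝ E] [CompleteSpace E]
  {H : Type*} [TopologicalSpace H] {I : ModelWithCorners ℝ E H}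
  {N : Type*} [TopologicalSpace N] [ChartedSpace H N] [IsManifold I ∞ N]

lemma smoothFunAt_pfv {a : N → Fin 5 → Fin 5 → ℝ} {y : N}
    (ha : ∀ i j, SmoothFunAt I (fun z => a z i j) y) (k : Fin 5) :
    SmoothFunAt I (fun z => pfv (a z) k) y := by
  have h : ∀ i j k l m n, SmoothFunAt I (fun z => a z i j * a z k l - a z i k * a z j l +
      a z m n * a z j k) y := fun i j k l m n =>
    (((ha i j).mul (ha k l)).sub ((ha i k).mul (ha j l))).add ((ha m n).mul (ha j k))
  fin_cases k
  · exact h 1 2 3 4 1 4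
  · exact (h 0 2 3 4 0 4).neg
  · exact h 0 1 3 4 0 4
  · exact (h 0 1 2 4 0 4).neg
  · exact h 0 1 2 3 0 3

namespace AdaptedFrame

variable {D : ∀ y : N, Submodule ℝ (TangentSpace I y)} {x : N} {c : AffineChart I D x}
  (S : AdaptedFrame D x c) {y : N}

lemma smoothFunAt_e (hy : y ∈ S.dom) (k : Fin 3) (i : Fin 5) :
    SmoothFunAt I (fun z => S.e z k i) y := by
  have ha := S.smoothFunAt_a hy
  have hb := S.smoothFunAt_b hy
  fin_cases k
  · exact smoothFunAt_pfv ha i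
  · exact ((smoothFunAt_pfv (a := fun z => S.a z + S.b z) (fun i j => (ha i j).add (hb i j)) i).sub
      (smoothFunAt_pfv ha i)).sub (smoothFunAt_pfv hb i)
  · exact smoothFunAt_pfv hb i

lemma isSectionAt_eField (hy : y ∈ S.dom) (k : Fin 3) : IsSectionAt I D (S.eField k) y :=
  S.isSectionAt_vec hy (u := fun i z => S.e z k i) fun i _ hz => S.smoothFunAt_e hz k i

lemma smooth_eField (hy : y ∈ S.dom) (k : Fin 3) : SmoothFieldAt (S.eField k) y :=
  (S.isSectionAt_eField hy k).self_of_nhds.1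

lemma coords_eField (hy : y ∈ S.dom) (k : Fin 3) : S.coords y (S.eField k y) = S.e y k :=
  S.coords_vec hy _

/-- The forms `A^*(β)(e_k, ·)`, extended to the tangent bundle by the adapted frame. -/
def θ (k : Fin 3) (y : N) : TangentSpace I y →L[ℝ] ℝ :=
  ∑ j, bform (S.b y) (S.e y k) (Pi.single j 1) • S.ξ j y

lemma θ_apply (k : Fin 3) (v : TangentSpace I y) :
    S.θ k y v = bform (S.b y) (S.e y k) (S.coords y v) := by
  have h : ∀ j, bform (S.b y) (S.e y k) (Pi.single j 1) = ∑ i, S.e y k i * S.b y i j :=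
    fun j => bform_single_right _ j
  simp only [θ, sum_apply, smul_apply, smul_eq_mul, h, Finset.sum_mul]
  rw [Finset.sum_comm]
  rfl

lemma smooth_θ (hy : y ∈ S.dom) (k : Fin 3) : SmoothFormAt (S.θ k) y := by
  refine SmoothFormAt.sum fun j _ => SmoothFormAt.smul ?_ (S.smooth_ξ j y hy)
  simp only [bform_single_right]
  exact ContMDiffAt.sum fun i _ => (S.smoothFunAt_e hy k i).mul (S.smoothFunAt_b hy i j)

lemma θ_eq_negExtDeriv (hy : y ∈ S.dom) (k : Fin 3) {v : TangentSpace I y} (hv : v ∈ D y) :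
    S.θ k y v = negExtDeriv c.β y (S.eField k y) v := by
  rw [θ_apply, eField, ← S.negExtDeriv_β_vec hy, S.vec_coords hy hv]

lemma θ_two (v : TangentSpace I y) : S.θ 2 y v = 0 := by
  rw [θ_apply]; exact bform_pfv S.isSkew_b _

/-- The recursion between consecutive coefficients of the kernel polynomial. It expresses `A^*(α)`
on `D_3` by the same forms `θ_k` as `A^*(β)`. -/
lemma bform_a_e (k : Fin 2) (v : Fin 5 → ℝ) :
    bform (S.a y) (S.e y k.succ) v = - bform (S.b y) (S.e y k.castSucc) v := by
  have h := bform_right_pfm (S.isSkew_a (y := y)) (S.isSkew_b (y := y)) v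
  refine eq_neg_of_add_eq_zero_left ?_
  fin_cases k
  exacts [h.1, h.2]

lemma negExtDeriv_α_eField (hy : y ∈ S.dom) {v : TangentSpace I y} (hv : v ∈ D y) :
    negExtDeriv c.α y (S.eField 0 y) v = 0 ∧ negExtDeriv c.α y (S.eField 1 y) v = - S.θ 0 y v ∧
      negExtDeriv c.α y (S.eField 2 y) v = - S.θ 1 y v := by
  rw [← S.vec_coords hy hv]
  simp only [eField, S.negExtDeriv_α_vec hy, θ_apply, S.coords_vec hy]
  exact ⟨bform_pfv S.isSkew_a _, S.bform_a_e 0 _, S.bform_a_e 1 _⟩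

lemma bform_b_e_e (hk : ∀ y : N, kroneckerIndex I D y = 2)
    (hy : y ∈ S.dom) (i j : Fin 3) : bform (S.b y) (S.e y i) (S.e y j) = 0 := by
  obtain ⟨h1, h2, h3⟩ := (S.kroneckerPencil hy (hk y)).isotropic_right
  have hs := bform_swap (S.isSkew_b (y := y))
  have h0 := bform_self (S.isSkew_b (y := y))
  fin_cases i <;> fin_cases j
  · exact h0 _
  · exact h1
  · exact h2
  · exact (hs _ _).trans (neg_eq_zero.2 h1)
  · exact h0 _
  · exact h3
  · exact (hs _ _).trans (neg_eq_zero.2 h2)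
  · exact (hs _ _).trans (neg_eq_zero.2 h3)
  · exact h0 _

/-- The `θ_k` vanish on `D_3` by isotropy, and a dimension count shows that they cut it out in `D`.
Membership of brackets in `D_3` is tested by these forms. -/
lemma mem_kernelSpan_iff (hk : ∀ y : N, kroneckerIndex I D y = 2)
    (hy : y ∈ S.dom) {v : TangentSpace I y} :
    v ∈ kernelSpan I 2 D y ↔ v ∈ D y ∧ ∀ k, S.θ k y v = 0 := by
  rw [S.kernelSpan_eq hy]
  constructor
  · intro h
    induction h using Submodule.span_induction with
    | mem v hv =>
      obtain ⟨i, rfl⟩ := hv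
      refine ⟨S.eField_mem hy i, fun k => ?_⟩
      rw [θ_apply, S.coords_eField hy, S.bform_b_e_e hk hy]
    | zero => exact ⟨Submodule.zero_mem _, fun k => map_zero _⟩
    | add u v _ _ hu hv =>
      exact ⟨Submodule.add_mem _ hu.1 hv.1, fun k => by rw [map_add, hu.2, hv.2, add_zero]⟩
    | smul r v _ hv =>
      exact ⟨Submodule.smul_mem _ _ hv.1, fun k => by rw [map_smul, hv.2, smul_zero]⟩
  · rintro ⟨h, h'⟩
    obtain ⟨r, s, t, e⟩ := (S.kroneckerPencil hy (hk y)).exists_comb_of_bform_eq_zero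
      (v := S.coords y v) ((S.θ_apply 0 v).symm.trans (h' 0)) ((S.θ_apply 1 v).symm.trans (h' 1))
    rw [← S.vec_coords hy h, e, S.vec_add, S.vec_add, S.vec_smul, S.vec_smul, S.vec_smul]
    have hm : ∀ i, S.eField i y ∈ Submodule.span ℝ (Set.range fun i => S.eField i y) :=
      fun i => Submodule.subset_span ⟨i, rfl⟩
    exact Submodule.add_mem _ (Submodule.add_mem _
      (Submodule.smul_mem _ _ (hm 0)) (Submodule.smul_mem _ _ (hm 1)))
      (Submodule.smul_mem _ _ (hm 2))

lemma kernelSpan_le (hk : ∀ y : N, kroneckerIndex I D y = 2)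
    (hy : y ∈ S.dom) : kernelSpan I 2 D y ≤ D y :=
  fun _ h => ((S.mem_kernelSpan_iff hk hy).1 h).1

lemma eField_mem_kernelSpan (hy : y ∈ S.dom) (i : Fin 3) : S.eField i y ∈ kernelSpan I 2 D y := by
  rw [S.kernelSpan_eq hy]
  exact Submodule.subset_span ⟨i, rfl⟩

/-- `D_3` is isotropic for the whole pencil. -/
lemma negExtDeriv_eq_zero (hk : ∀ y : N, kroneckerIndex I D y = 2)
    (hy : y ∈ S.dom) {u v : TangentSpace I y}
    (hu : u ∈ kernelSpan I 2 D y) (hv : v ∈ kernelSpan I 2 D y) :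
    negExtDeriv c.α y u v = 0 ∧ negExtDeriv c.β y u v = 0 := by
  obtain ⟨hvD, hvθ⟩ := (S.mem_kernelSpan_iff hk hy).1 hv
  rw [S.kernelSpan_eq hy] at hu
  induction hu using Submodule.span_induction with
  | mem u hu =>
    obtain ⟨i, rfl⟩ := hu
    refine ⟨?_, by rw [← S.θ_eq_negExtDeriv hy i hvD, hvθ]⟩
    obtain ⟨h0, h1, h2⟩ := S.negExtDeriv_α_eField hy hvD
    rw [hvθ, neg_zero] at h1 h2
    fin_cases i
    exacts [h0, h1, h2]
  | zero => simp
  | add u u' _ _ h h' => simp [h, h']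
  | smul r u _ h => simp [h]

lemma isSectionAt_kernelSpan (hk : ∀ y : N, kroneckerIndex I D y = 2)
    (hy : y ∈ S.dom) {Z : ∀ y : N, TangentSpace I y}
    (hZ : IsSectionAt I (kernelSpan I 2 D) Z y) : IsSectionAt I D Z y := by
  filter_upwards [hZ, S.dom_mem_nhds hy] with z h1 h2
  exact ⟨h1.1, S.kernelSpan_le hk h2 h1.2⟩

/-- Modulo `D` the bracket is given by the pencil, for which `D_3` is isotropic. -/
lemma mlieBracket_mem_D (hk : ∀ y : N, kroneckerIndex I D y = 2)
    (hy : y ∈ S.dom) {X Y : ∀ y : N, TangentSpace I y}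
    (hX : IsSectionAt I (kernelSpan I 2 D) X y) (hY : IsSectionAt I (kernelSpan I 2 D) Y y) :
    VectorField.mlieBracket I X Y y ∈ D y := by
  have h := S.negExtDeriv_eq_zero hk hy hX.self_of_nhds.2 hY.self_of_nhds.2
  have hX' := S.isSectionAt_kernelSpan hk hy hX
  have hY' := S.isSectionAt_kernelSpan hk hy hY
  rw [S.mem_D_iff hy, S.α_mlieBracket hy hX' hY', S.β_mlieBracket hy hX' hY']
  exact h

lemma θ_mlieBracket (hk : ∀ y : N, kroneckerIndex I D y = 2)
    (hy : y ∈ S.dom) (k : Fin 3) {X Y : ∀ y : N, TangentSpace I y}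
    (hX : IsSectionAt I (kernelSpan I 2 D) X y) (hY : IsSectionAt I (kernelSpan I 2 D) Y y) :
    S.θ k y (VectorField.mlieBracket I X Y y) = negExtDeriv (S.θ k) y (X y) (Y y) := by
  refine form_mlieBracket_of_eventually_zero (S.smooth_θ hy k) hX.self_of_nhds.1
    hY.self_of_nhds.1 ?_ ?_
  · filter_upwards [S.dom_mem_nhds hy, hX] with z h1 h2
      using ((S.mem_kernelSpan_iff hk h1).1 h2.2).2 k
  · filter_upwards [S.dom_mem_nhds hy, hY] with z h1 h2
      using ((S.mem_kernelSpan_iff hk h1).1 h2.2).2 k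

lemma isSectionAt_kernelSpan_eField (hy : y ∈ S.dom) (k : Fin 3) :
    IsSectionAt I (kernelSpan I 2 D) (S.eField k) y := by
  filter_upwards [S.dom_mem_nhds hy, S.isSectionAt_eField hy k] with z h1 h2
  exact ⟨h2.1, S.eField_mem_kernelSpan h1 k⟩

/-- The brackets of the frame of `D_3`. -/
def w (i j : Fin 3) (y : N) : TangentSpace I y :=
  VectorField.mlieBracket I (S.eField i) (S.eField j) y

lemma isSectionAt_w (hk : ∀ y : N, kroneckerIndex I D y = 2)
    (hy : y ∈ S.dom) (i j : Fin 3) : IsSectionAt I D (S.w i j) y := by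
  filter_upwards [S.dom_mem_nhds hy] with z hz
  exact ⟨(S.smooth_eField hz i).mlieBracket (S.smooth_eField hz j),
    S.mlieBracket_mem_D hk hz (S.isSectionAt_kernelSpan_eField hz i)
      (S.isSectionAt_kernelSpan_eField hz j)⟩

/-- The Jacobi identity for the frame of `D_3`, modulo `D`. -/
lemma θ_w (hk : ∀ y : N, kroneckerIndex I D y = 2) (hy : y ∈ S.dom) :
    S.θ 0 y (S.w 0 2 y) = S.θ 1 y (S.w 0 1 y) ∧ S.θ 0 y (S.w 1 2 y) = S.θ 1 y (S.w 0 2 y) := by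
  have hI : IsManifold I (minSmoothness ℝ 3) N := by
    rw [minSmoothness_of_isRCLikeNormedField]; infer_instance
  have hm : ∀ k, ContMDiffAt I I.tangent (minSmoothness ℝ 2)
      (fun z => (⟨z, S.eField k z⟩ : TangentBundle I N)) y := fun k => by
    rw [minSmoothness_of_isRCLikeNormedField]
    exact (S.smooth_eField hy k).of_le (by norm_cast)
  have J : VectorField.mlieBracket I (S.eField 0) (S.w 1 2) y =
      VectorField.mlieBracket I (S.w 0 1) (S.eField 2) y +
        VectorField.mlieBracket I (S.eField 1) (S.w 0 2) y :=
    VectorField.leibniz_identity_mlieBracket_apply (hm 0) (hm 1) (hm 2)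
  have he := S.isSectionAt_eField hy
  have hw := S.isSectionAt_w hk hy
  have hwD : ∀ i j, S.w i j y ∈ D y := fun i j => (hw i j).self_of_nhds.2
  -- Each inner bracket `w i j` is itself a section of `D`, so `α` and `β` of the outer brackets are
  -- values of the pencil on some `e_k`, that is, `± θ` or zero. `α` yields the first relation and
  -- `β` the second.
  have Jα := congrArg (c.α y) J
  have Jβ := congrArg (c.β y) J
  rw [map_add, S.α_mlieBracket hy (he _) (hw _ _), S.α_mlieBracket hy (he _) (hw _ _),
    S.α_mlieBracket hy (hw _ _) (he _), negExtDeriv_swap _ _ (S.w 0 1 y),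
    (S.negExtDeriv_α_eField hy (hwD _ _)).1, (S.negExtDeriv_α_eField hy (hwD _ _)).2.1,
    (S.negExtDeriv_α_eField hy (hwD _ _)).2.2] at Jα
  rw [map_add, S.β_mlieBracket hy (he _) (hw _ _), S.β_mlieBracket hy (he _) (hw _ _),
    S.β_mlieBracket hy (hw _ _) (he _), negExtDeriv_swap _ _ (S.w 0 1 y),
    ← S.θ_eq_negExtDeriv hy _ (hwD _ _), ← S.θ_eq_negExtDeriv hy _ (hwD _ _),
    ← S.θ_eq_negExtDeriv hy _ (hwD _ _), S.θ_two] at Jβ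
  exact ⟨by linarith, by linarith⟩

/-- The kernel of `A^*(α + t β)`. -/
def kerVec (t : ℝ) (y : N) : TangentSpace I y :=
  S.eField 0 y + t • S.eField 1 y + t ^ 2 • S.eField 2 y

/-- The derivative in `t` of the kernel of `A^*(α + t β)`. -/
def kerVecDeriv (t : ℝ) (y : N) : TangentSpace I y :=
  S.eField 1 y + (2 * t) • S.eField 2 y

/-- The form `A^*(β)(X_p, ·)`, `p = α + t β`. -/
def θt (t : ℝ) (y : N) : TangentSpace I y →L[ℝ] ℝ := S.θ 0 y + t • S.θ 1 y

lemma smooth_θt (hy : y ∈ S.dom) (t : ℝ) : SmoothFormAt (S.θt t) y :=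
  (S.smooth_θ hy 0).add (SmoothFormAt.smul contMDiffAt_const (S.smooth_θ hy 1))

lemma θt_eq (hy : y ∈ S.dom) (t : ℝ) {v : TangentSpace I y} (hv : v ∈ D y) :
    S.θt t y v = negExtDeriv c.β y (S.kerVec t y) v := by
  simp only [θt, kerVec, map_add, map_smul, add_apply, smul_apply,
    ← S.θ_eq_negExtDeriv hy _ hv, S.θ_two, smul_zero, add_zero]

lemma isSectionAt_kerVec (hy : y ∈ S.dom) (t : ℝ) :
    IsSectionAt I (kernelSpan I 2 D) (S.kerVec t) y := by
  filter_upwards [S.dom_mem_nhds hy] with z hz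
  have h := S.smooth_eField hz
  have h' := S.eField_mem_kernelSpan hz
  exact ⟨((h 0).add ((h 1).const_smul t)).add ((h 2).const_smul (t ^ 2)),
    Submodule.add_mem _ (Submodule.add_mem _ (h' 0) (Submodule.smul_mem _ _ (h' 1)))
      (Submodule.smul_mem _ _ (h' 2))⟩

lemma isSectionAt_kerVecDeriv (hy : y ∈ S.dom) (t : ℝ) :
    IsSectionAt I (kernelSpan I 2 D) (S.kerVecDeriv t) y := by
  filter_upwards [S.dom_mem_nhds hy] with z hz
  have h := S.smooth_eField hz
  have h' := S.eField_mem_kernelSpan hz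
  exact ⟨(h 1).add ((h 2).const_smul (2 * t)),
    Submodule.add_mem _ (h' 1) (Submodule.smul_mem _ _ (h' 2))⟩

lemma θt_eq_zero (hk : ∀ y : N, kroneckerIndex I D y = 2)
    (hy : y ∈ S.dom) (t : ℝ) {v : TangentSpace I y}
    (hv : v ∈ kernelSpan I 2 D y) : S.θt t y v = 0 := by
  have h := ((S.mem_kernelSpan_iff hk hy).1 hv).2
  rw [θt, add_apply, smul_apply, h, h, smul_zero, add_zero]

lemma θt_mlieBracket (hk : ∀ y : N, kroneckerIndex I D y = 2)
    (hy : y ∈ S.dom) (t : ℝ) {X Y : ∀ y : N, TangentSpace I y}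
    (hX : IsSectionAt I (kernelSpan I 2 D) X y) (hY : IsSectionAt I (kernelSpan I 2 D) Y y) :
    S.θt t y (VectorField.mlieBracket I X Y y) = negExtDeriv (S.θt t) y (X y) (Y y) := by
  refine form_mlieBracket_of_eventually_zero (S.smooth_θt hy t) hX.self_of_nhds.1
    hY.self_of_nhds.1 ?_ ?_
  · filter_upwards [S.dom_mem_nhds hy, hX] with z h1 h2 using S.θt_eq_zero hk h1 t h2.2
  · filter_upwards [S.dom_mem_nhds hy, hY] with z h1 h2 using S.θt_eq_zero hk h1 t h2.2

/-- The obstruction to `𝒜_1 ⊆ K_1` at `[α + t β]`. -/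
def obstruction (t : ℝ) (y : N) : ℝ :=
  negExtDeriv (S.θt t) y (S.kerVec t y) (S.kerVecDeriv t y)

/-- `X_t ∧ X_t'` equals `e_0∧e_1 + 2t e_0∧e_2 + t² e_1∧e_2`. Pairing with `θ_0 + t θ_1` leaves two
terms in each of the degrees 1 and 2, which the Jacobi relations merge into the coefficients 3. -/
lemma obstruction_eq (hk : ∀ y : N, kroneckerIndex I D y = 2) (hy : y ∈ S.dom) (t : ℝ) :
    S.obstruction t y = S.θ 0 y (S.w 0 1 y) + 3 * t * S.θ 0 y (S.w 0 2 y) +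
      3 * t ^ 2 * S.θ 1 y (S.w 0 2 y) + t ^ 3 * S.θ 1 y (S.w 1 2 y) := by
  have hs := S.isSectionAt_kernelSpan_eField hy
  have hww : ∀ i j, negExtDeriv (S.θt t) y (S.eField i y) (S.eField j y) =
      S.θ 0 y (S.w i j y) + t * S.θ 1 y (S.w i j y) := fun i j =>
    (S.θt_mlieBracket hk hy t (hs i) (hs j)).symm
  have h21 := negExtDeriv_swap (S.θt t) y (S.eField 2 y) (S.eField 1 y)
  obtain ⟨J1, J2⟩ := S.θ_w hk hy
  rw [obstruction]
  simp only [kerVec, kerVecDeriv, map_add, map_smul, add_apply, smul_apply, negExtDeriv_self,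
    h21, hww 0 1, hww 0 2, hww 1 2, smul_eq_mul]
  linear_combination (-t) * J1 + t ^ 2 * J2

/-- If `D_3` is not involutive then the obstruction does not vanish identically on the fibre. -/
theorem exists_obstruction_ne_zero (hk : ∀ y : N, kroneckerIndex I D y = 2) (hy : y ∈ S.dom)
    (hinv : ¬ InvolutiveAt I (kernelSpan I 2 D) y) : ∃ t, S.obstruction t y ≠ 0 := by
  by_contra! h0
  simp only [S.obstruction_eq hk hy] at h0
  obtain ⟨J1, J2⟩ := S.θ_w hk hy
  -- Four values determine a cubic.
  have e0 := h0 0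
  have e1 := h0 1
  have e2 := h0 (-1)
  have e3 := h0 2
  have z1 : S.θ 0 y (S.w 0 1 y) = 0 := by linarith
  have z2 : S.θ 0 y (S.w 0 2 y) = 0 := by linarith
  have z3 : S.θ 1 y (S.w 0 2 y) = 0 := by linarith
  have z4 : S.θ 1 y (S.w 1 2 y) = 0 := by linarith
  refine hinv (Submodule.span_le.2 ?_)
  rintro _ ⟨X, Y, hX, hY, rfl⟩
  refine (S.mem_kernelSpan_iff hk hy).2 ⟨S.mlieBracket_mem_D hk hy hX hY, fun k => ?_⟩
  have hs := S.isSectionAt_kernelSpan_eField hy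
  -- The four coefficients and the Jacobi relations give all `θ_k(w i j) = 0`. On sections of `D_3`
  -- this value is the tensor `-dθ_k`, so its vanishing on the frame suffices for arbitrary
  -- sections.
  have hw : ∀ i j, negExtDeriv (S.θ k) y (S.eField i y) (S.eField j y) = 0 := by
    have h01 : S.θ k y (S.w 0 1 y) = 0 := by
      fin_cases k
      exacts [z1, J1.symm.trans z2, S.θ_two _]
    have h02 : S.θ k y (S.w 0 2 y) = 0 := by
      fin_cases k
      exacts [z2, z3, S.θ_two _]
    have h12 : S.θ k y (S.w 1 2 y) = 0 := by
      fin_cases k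
      exacts [J2.trans z3, z4, S.θ_two _]
    have e := fun i j => S.θ_mlieBracket hk hy k (hs i) (hs j)
    have e01 := (e 0 1).symm.trans h01
    have e02 := (e 0 2).symm.trans h02
    have e12 := (e 1 2).symm.trans h12
    intro i j
    fin_cases i <;> fin_cases j
    · exact negExtDeriv_self _ _ _
    · exact e01
    · exact e02
    · exact (negExtDeriv_swap _ _ _ _).trans (neg_eq_zero.2 e01)
    · exact negExtDeriv_self _ _ _
    · exact e12
    · exact (negExtDeriv_swap _ _ _ _).trans (neg_eq_zero.2 e02)
    · exact (negExtDeriv_swap _ _ _ _).trans (neg_eq_zero.2 e12)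
    · exact negExtDeriv_self _ _ _
  have hXm := hX.self_of_nhds.2
  have hYm := hY.self_of_nhds.2
  rw [S.kernelSpan_eq hy] at hXm hYm
  obtain ⟨r, hr⟩ := (Submodule.mem_span_range_iff_exists_fun ℝ).1 hXm
  obtain ⟨s, hs⟩ := (Submodule.mem_span_range_iff_exists_fun ℝ).1 hYm
  rw [S.θ_mlieBracket hk hy k hX hY, ← hr, ← hs]
  simp only [map_sum, map_smul, sum_apply, smul_apply, hw, smul_zero, Finset.sum_const_zero]

end AdaptedFrame
end Derived

/-! ### Calculus on `N × ℝ`, the affine charts of `ℙ(D^⊥)` -/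

section Product

set_option linter.unusedSectionVars false

variable {E : Type*} [NormedAddCommGroup E] [NormedSpace ℝ E] [CompleteSpace E]
  {H : Type*} [TopologicalSpace H] {I : ModelWithCorners ℝ E H}
  {N : Type*} [TopologicalSpace N] [ChartedSpace H N] [IsManifold I ∞ N]

lemma mvfderiv_congr {h h' : N → ℝ} {x : N} (e : h =ᶠ[𝓝 x] h') (v : TangentSpace I x) :
    mvfderiv I h x v = mvfderiv I h' x v := by
  have e1 : mfderiv I 𝓘(ℝ, ℝ) h x = mfderiv I 𝓘(ℝ, ℝ) h' x := e.mfderiv_eq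
  exact congrArg (fun T : E →L[ℝ] ℝ => T v) e1

lemma mvfderiv_mul_apply {f g : N → ℝ} {x : N} (hf : MDifferentiableAt I 𝓘(ℝ, ℝ) f x)
    (hg : MDifferentiableAt I 𝓘(ℝ, ℝ) g x) (v : TangentSpace I x) :
    mvfderiv I (fun y => f y * g y) x v = f x * mvfderiv I g x v + g x * mvfderiv I f x v := by
  rw [mvfderiv_fun_mul hf hg]
  rfl

lemma mvfderiv_add_apply {f g : N → ℝ} {x : N} (hf : MDifferentiableAt I 𝓘(ℝ, ℝ) f x)
    (hg : MDifferentiableAt I 𝓘(ℝ, ℝ) g x) (v : TangentSpace I x) :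
    mvfderiv I (fun y => f y + g y) x v = mvfderiv I f x v + mvfderiv I g x v := by
  rw [mvfderiv_fun_add hf hg]
  rfl

lemma mvfderiv_neg_apply {f : N → ℝ} {x : N} (v : TangentSpace I x) :
    mvfderiv I (fun y => - f y) x v = - mvfderiv I f x v := by
  rw [mvfderiv_fun_neg]
  rfl

lemma mvfderiv_comp_snd {g : ℝ → ℝ} {z : N × ℝ} (hg : DifferentiableAt ℝ g z.2)
    (v : TangentSpace (I.prod 𝓘(ℝ, ℝ)) z) :
    mvfderiv (I.prod 𝓘(ℝ, ℝ)) (fun z : N × ℝ => g z.2) z v = deriv g z.2 * vert I z v := by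
  have h := mfderiv_comp z hg.mdifferentiableAt (mdifferentiableAt_snd (I := I) (I' := 𝓘(ℝ, ℝ)))
  rw [mfderiv_snd, mfderiv_eq_fderiv] at h
  have h' := congrArg (fun T : E × ℝ →L[ℝ] ℝ => T v) h
  refine h'.trans ?_
  change fderiv ℝ g z.2 (vert I z v) = _
  rw [← toSpanSingleton_deriv, ContinuousLinearMap.toSpanSingleton_apply, smul_eq_mul, mul_comm]

lemma mdifferentiableAt_comp_snd {g : ℝ → ℝ} {z : N × ℝ} (hg : DifferentiableAt ℝ g z.2) :
    MDifferentiableAt (I.prod 𝓘(ℝ, ℝ)) 𝓘(ℝ, ℝ) (fun z : N × ℝ => g z.2) z :=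
  MDifferentiableAt.comp z hg.mdifferentiableAt mdifferentiableAt_snd

lemma mdifferentiableAt_form_horiz {x : N} {t : ℝ} {α : ∀ y : N, TangentSpace I y →L[ℝ] ℝ}
    (hα : SmoothFormAt α x) {Z : ∀ z : N × ℝ, TangentSpace (I.prod 𝓘(ℝ, ℝ)) z}
    (hZ : SmoothFieldAt Z (x, t)) :
    MDifferentiableAt (I.prod 𝓘(ℝ, ℝ)) 𝓘(ℝ, ℝ) (fun z : N × ℝ => α z.1 (horiz I z (Z z)))
      (x, t) := by
  have hg : MDifferentiableAt I 𝓘(ℝ, E →L[ℝ] ℝ) (formCoord x α) x :=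
    (contMDiffAt_formCoord hα).mdifferentiableAt (by simp)
  have hg' : MDifferentiableAt (I.prod 𝓘(ℝ, ℝ)) 𝓘(ℝ, E →L[ℝ] ℝ)
      (fun z : N × ℝ => formCoord x α z.1) (x, t) :=
    MDifferentiableAt.comp (x, t) hg mdifferentiableAt_fst
  have hh : MDifferentiableAt (I.prod 𝓘(ℝ, ℝ)) 𝓘(ℝ, E × ℝ)
    (fieldCoord (I.prod 𝓘(ℝ, ℝ)) (x, t) Z) (x, t) :=
    (contMDiffAt_fieldCoord hZ).mdifferentiableAt (by simp)
  have hh' : MDifferentiableAt (I.prod 𝓘(ℝ, ℝ)) 𝓘(ℝ, E)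
    (fun z => ContinuousLinearMap.fst ℝ E ℝ (fieldCoord (I.prod 𝓘(ℝ, ℝ)) (x, t) Z z)) (x, t) :=
    (ContinuousLinearMap.fst ℝ E ℝ).mdifferentiableAt.comp (x, t) hh
  have e : (fun z : N × ℝ => α z.1 (horiz I z (Z z))) =ᶠ[𝓝 (x, t)] fun z => formCoord x α z.1
      (ContinuousLinearMap.fst ℝ E ℝ (fieldCoord (I.prod 𝓘(ℝ, ℝ)) (x, t) Z z)) := by
    filter_upwards [continuousAt_fst.preimage_mem_nhds
      ((chartAt H x).open_source.mem_nhds (mem_chart_source H x))] with z hz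
    rw [ContinuousLinearMap.coe_fst', fieldCoord_prod_fst x t Z hz]
    exact (formCoord_fieldCoord x α hz (horiz I z (Z z))).symm
  exact (hg'.clm_apply hh').congr_of_eventuallyEq e

lemma mem_vertical {z : N × ℝ} {v : TangentSpace (I.prod 𝓘(ℝ, ℝ)) z} :
    v ∈ vertical I z ↔ horiz I z v = 0 := by
  rw [vertical, mem_lift]; rfl

lemma AffineChart.mem_quasiContact {D : ∀ y : N, Submodule ℝ (TangentSpace I y)} {x : N}
    (c : AffineChart I D x) {z : N × ℝ} {v : TangentSpace (I.prod 𝓘(ℝ, ℝ)) z} :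
    v ∈ c.quasiContact z ↔ c.α z.1 (horiz I z v) + z.2 * c.β z.1 (horiz I z v) = 0 := by
  rw [AffineChart.quasiContact, mem_lift]; rfl

variable (I) in
/-- The coordinate vector field of the fibre. -/
def dt (z : N × ℝ) : TangentSpace (I.prod 𝓘(ℝ, ℝ)) z := mkVec I z 0 1

variable (I) in
lemma smooth_dt (z : N × ℝ) : SmoothFieldAt (dt I (N := N)) z :=
  smoothFieldAt_mkVec (X := fun _ => 0) (smoothFieldAt_zero _) 1

variable (I) in
lemma horiz_dt (z : N × ℝ) : horiz I z (dt I z) = 0 := horiz_mkVec z 0 1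

variable (I) in
lemma vert_dt (z : N × ℝ) : vert I z (dt I z) = 1 := vert_mkVec z 0 1

namespace AdaptedFrame

variable {D : ∀ y : N, Submodule ℝ (TangentSpace I y)} {x : N} {c : AffineChart I D x}
  (S : AdaptedFrame D x c) {y : N} {t : ℝ}

lemma prod_mem_nhds (hy : y ∈ S.dom) (t : ℝ) : ∀ᶠ z in 𝓝 (y, t), z.1 ∈ S.dom :=
  continuousAt_fst.preimage_mem_nhds (S.dom_mem_nhds hy)

/-- Cartan's formula for the Liouville form. -/
lemma contact_mlieBracket (hy : y ∈ S.dom)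
    {Z W : ∀ z : N × ℝ, TangentSpace (I.prod 𝓘(ℝ, ℝ)) z}
    (hZ : IsSectionAt (I.prod 𝓘(ℝ, ℝ)) c.quasiContact Z (y, t))
    (hW : IsSectionAt (I.prod 𝓘(ℝ, ℝ)) c.quasiContact W (y, t)) :
    let b := horiz I (y, t) (VectorField.mlieBracket (I.prod 𝓘(ℝ, ℝ)) Z W (y, t))
    let v := horiz I (y, t) (Z (y, t))
    let w := horiz I (y, t) (W (y, t))
    c.α y b + t * c.β y b = - (vert I (y, t) (Z (y, t)) * c.β y w) +
      vert I (y, t) (W (y, t)) * c.β y v + (negExtDeriv c.α y v w + t * negExtDeriv c.β y v w) := by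
  intro b v w
  -- Along `Λ` one has `α(Z) = -t β(Z)`. In the sum of Cartan's formula for `α` and `t` times the
  -- one for `β`, the derivatives of `β(Z)` cancel and only the derivative of `t` remains.
  have key : ∀ Z : ∀ z : N × ℝ, TangentSpace (I.prod 𝓘(ℝ, ℝ)) z,
      IsSectionAt (I.prod 𝓘(ℝ, ℝ)) c.quasiContact Z (y, t) →
      ∀ u : TangentSpace (I.prod 𝓘(ℝ, ℝ)) (y, t),
      mvfderiv (I.prod 𝓘(ℝ, ℝ)) (fun z => c.α z.1 (horiz I z (Z z))) (y, t) u =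
      -(t * mvfderiv (I.prod 𝓘(ℝ, ℝ)) (fun z => c.β z.1 (horiz I z (Z z))) (y, t) u +
        c.β y (horiz I (y, t) (Z (y, t))) * vert I (y, t) u) := by
    intro Z hZ u
    have e : (fun z : N × ℝ => c.α z.1 (horiz I z (Z z))) =ᶠ[𝓝 (y, t)]
        fun z => -(z.2 * c.β z.1 (horiz I z (Z z))) := by
      filter_upwards [hZ] with z hz
      exact eq_neg_of_add_eq_zero_left (c.mem_quasiContact.1 hz.2)
    rw [mvfderiv_congr e, mvfderiv_neg_apply, mvfderiv_mul_apply
      (mdifferentiableAt_comp_snd (g := fun t => t) differentiableAt_id)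
      (mdifferentiableAt_form_horiz (S.smooth_β y hy) hZ.self_of_nhds.1),
      mvfderiv_comp_snd (g := fun t => t) differentiableAt_id, deriv_id'', one_mul]
  have hα := form_horiz_mlieBracket (S.smooth_α y hy) hZ.self_of_nhds.1 hW.self_of_nhds.1
  have hβ := form_horiz_mlieBracket (S.smooth_β y hy) hZ.self_of_nhds.1 hW.self_of_nhds.1
  rw [key Z hZ, key W hW] at hα
  linear_combination hα + t * hβ

lemma ext_forms (hy : y ∈ S.dom) {u v : TangentSpace I y}
    (hα : c.α y u = c.α y v) (hβ : c.β y u = c.β y v) (hξ : ∀ i, S.ξ i y u = S.ξ i y v) :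
    u = v := by
  rw [S.expand y hy u, S.expand y hy v, hα, hβ]
  simp only [hξ]

/-- The horizontal vector field `∑ g_k(t) e_k`. -/
def polyField (g : Fin 3 → ℝ → ℝ) (z : N × ℝ) : TangentSpace (I.prod 𝓘(ℝ, ℝ)) z :=
  ∑ k, g k z.2 • mkVec I z (S.eField k z.1) 0

lemma horiz_polyField (g : Fin 3 → ℝ → ℝ) (z : N × ℝ) :
    horiz I z (S.polyField g z) = ∑ k, g k z.2 • S.eField k z.1 := by
  simp only [polyField, map_sum, map_smul, horiz_mkVec]

lemma vert_polyField (g : Fin 3 → ℝ → ℝ) (z : N × ℝ) : vert I z (S.polyField g z) = 0 := by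
  simp only [polyField, map_sum, map_smul, vert_mkVec, smul_zero, Finset.sum_const_zero]

lemma smooth_polyField {g : Fin 3 → ℝ → ℝ} (hg : ∀ k, ContDiff ℝ ∞ (g k)) {z : N × ℝ}
    (hz : z.1 ∈ S.dom) : SmoothFieldAt (S.polyField g) z := by
  refine SmoothFieldAt.sum fun k _ => SmoothFieldAt.smul ?_
    (smoothFieldAt_mkVec (S.smooth_eField hz k) 0)
  exact ContMDiffAt.comp z (hg k).contMDiff.contMDiffAt contMDiffAt_snd

/-- The fields `e_k` do not depend on `t`, so the bracket with `∂_t` differentiates the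
coefficients. The identity is tested on each form of the adapted coframe. -/
lemma horiz_dt_polyField {g : Fin 3 → ℝ → ℝ} (hg : ∀ k, ContDiff ℝ ∞ (g k)) (hy : y ∈ S.dom) :
    horiz I (y, t) (VectorField.mlieBracket (I.prod 𝓘(ℝ, ℝ)) (dt I) (S.polyField g) (y, t)) =
      ∑ k, deriv (g k) t • S.eField k y := by
  have hd : ∀ k, DifferentiableAt ℝ (g k) t := fun k => (hg k).differentiable (by simp) t
  have key : ∀ η : ∀ y : N, TangentSpace I y →L[ℝ] ℝ, SmoothFormAt η y →
      η y (horiz I (y, t)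
        (VectorField.mlieBracket (I.prod 𝓘(ℝ, ℝ)) (dt I) (S.polyField g) (y, t))) =
      η y (∑ k, deriv (g k) t • S.eField k y) := by
    intro η hη
    rw [form_horiz_mlieBracket hη (smooth_dt I _) (S.smooth_polyField hg hy), horiz_dt, map_zero,
      zero_apply, mvfderiv_eq_zero_of_eventually (r := 0)
        (h := fun z : N × ℝ => η z.1 (horiz I z (dt I z)))
        (.of_forall fun z => by rw [horiz_dt, map_zero])]
    have hm : ∀ k, MDifferentiableAt I 𝓘(ℝ, ℝ) (fun y => η y (S.eField k y)) y := fun k =>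
      (hη.apply (S.smooth_eField hy k)).mdifferentiableAt (by simp)
    have hm' : ∀ k, MDifferentiableAt (I.prod 𝓘(ℝ, ℝ)) 𝓘(ℝ, ℝ)
        (fun z : N × ℝ => η z.1 (S.eField k z.1)) (y, t) := fun k =>
      MDifferentiableAt.comp (y, t) (hm k) mdifferentiableAt_fst
    have hs : ∀ k, MDifferentiableAt (I.prod 𝓘(ℝ, ℝ)) 𝓘(ℝ, ℝ)
        (fun z : N × ℝ => g k z.2) (y, t) := fun k => mdifferentiableAt_comp_snd (hd k)
    have hp : ∀ k, MDifferentiableAt (I.prod 𝓘(ℝ, ℝ)) 𝓘(ℝ, ℝ)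
        (fun z : N × ℝ => g k z.2 * η z.1 (S.eField k z.1)) (y, t) := fun k => (hs k).mul (hm' k)
    have hp' : MDifferentiableAt (I.prod 𝓘(ℝ, ℝ)) 𝓘(ℝ, ℝ) (fun z : N × ℝ =>
        g 0 z.2 * η z.1 (S.eField 0 z.1) + g 1 z.2 * η z.1 (S.eField 1 z.1)) (y, t) :=
      (hp 0).add (hp 1)
    have e : (fun z : N × ℝ => η z.1 (horiz I z (S.polyField g z))) = fun z =>
        (g 0 z.2 * η z.1 (S.eField 0 z.1) + g 1 z.2 * η z.1 (S.eField 1 z.1)) +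
          g 2 z.2 * η z.1 (S.eField 2 z.1) := by
      funext z
      rw [horiz_polyField, Fin.sum_univ_three]
      simp only [map_add, map_smul, smul_eq_mul]
    have hk : ∀ k, mvfderiv (I.prod 𝓘(ℝ, ℝ)) (fun z : N × ℝ => g k z.2 * η z.1 (S.eField k z.1))
        (y, t) (dt I (y, t)) = deriv (g k) t * η y (S.eField k y) := by
      intro k
      rw [mvfderiv_mul_apply (hs k) (hm' k),
        mvfderiv_comp_fst (z := (y, t)) (g := fun y => η y (S.eField k y)) (hm k),
        mvfderiv_comp_snd (hd k), horiz_dt, vert_dt, map_zero]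
      ring
    rw [e, mvfderiv_add_apply hp' (hp 2), mvfderiv_add_apply (hp 0) (hp 1), hk, hk,
      hk, Fin.sum_univ_three]
    simp only [map_add, map_smul, smul_eq_mul]
    ring
  exact S.ext_forms hy (key _ (S.smooth_α y hy)) (key _ (S.smooth_β y hy))
    fun i => key _ (S.smooth_ξ i y hy)

end AdaptedFrame
end Product

/-! ### The characteristic distribution `C` -/

section Characteristic

set_option linter.unusedSectionVars false

variable {E : Type*} [NormedAddCommGroup E] [NormedSpace ℝ E] [CompleteSpace E]
  {H : Type*} [TopologicalSpace H] {I : ModelWithCorners ℝ E H}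
  {N : Type*} [TopologicalSpace N] [ChartedSpace H N] [IsManifold I ∞ N]

namespace AdaptedFrame

variable {D : ∀ y : N, Submodule ℝ (TangentSpace I y)} {x : N} {c : AffineChart I D x}
  (S : AdaptedFrame D x c) {y : N} {t : ℝ}

/-- `kerVec` spans the kernel of `A^*(α + t β)`: it is in the kernel. -/
lemma negExtDeriv_kerVec (hy : y ∈ S.dom) (t : ℝ) {v : TangentSpace I y} (hv : v ∈ D y) :
    negExtDeriv c.α y (S.kerVec t y) v + t * negExtDeriv c.β y (S.kerVec t y) v = 0 := by
  obtain ⟨h0, h1, h2⟩ := S.negExtDeriv_α_eField hy hv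
  rw [← S.θt_eq hy t hv]
  simp only [kerVec, θt, map_add, map_smul, add_apply, smul_apply, h0, h1, h2, smul_eq_mul]
  ring

/-- The derivative of the previous identity in `t`. -/
lemma negExtDeriv_kerVecDeriv (hy : y ∈ S.dom) (t : ℝ) {v : TangentSpace I y} (hv : v ∈ D y) :
    negExtDeriv c.α y (S.kerVecDeriv t y) v + t * negExtDeriv c.β y (S.kerVecDeriv t y) v =
      - negExtDeriv c.β y (S.kerVec t y) v := by
  obtain ⟨h0, h1, h2⟩ := S.negExtDeriv_α_eField hy hv
  have h3 := S.θ_two v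
  rw [S.θ_eq_negExtDeriv hy 2 hv] at h3
  rw [← S.θt_eq hy t hv]
  simp only [kerVecDeriv, θt, map_add, map_smul, add_apply, smul_apply, h1, h2, h3,
    S.θ_eq_negExtDeriv hy _ hv, smul_eq_mul]
  ring

lemma vec_pfv_eq_kerVec (t : ℝ) : S.vec y (pfv ((1 : ℝ) • S.a y + t • S.b y)) = S.kerVec t y := by
  rw [pfv_comb, S.vec_add, S.vec_add, S.vec_smul, S.vec_smul, S.vec_smul, one_pow, one_smul,
    one_mul]
  rfl

/-- The Pfaffian vector vanishes nowhere on the pencil, so each `A^*(α + tβ)` has a one-dimensional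
kernel. -/
lemma exists_eq_smul_kerVec (hk : ∀ y : N, kroneckerIndex I D y = 2) (hy : y ∈ S.dom) {t : ℝ}
    {v : TangentSpace I y} (hv : v ∈ D y)
    (h : ∀ u ∈ D y, negExtDeriv c.α y v u + t * negExtDeriv c.β y v u = 0) :
    ∃ r : ℝ, v = r • S.kerVec t y := by
  have hs := (S.isSkew_a (y := y)).comb (S.isSkew_b (y := y)) 1 t
  obtain ⟨r, hr⟩ := exists_smul_pfv hs
    ((S.kroneckerPencil hy (hk y)).pfv_comb_ne_zero (by simp)) (v := S.coords y v) (fun w => by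
      rw [bform_comb, ← S.negExtDeriv_α_vec hy, ← S.negExtDeriv_β_vec hy, S.vec_coords hy hv,
        one_mul]
      exact h _ (S.vec_mem hy w))
  refine ⟨r, ?_⟩
  rw [← S.vec_pfv_eq_kerVec, ← S.vec_smul, ← hr, S.vec_coords hy hv]

/-- The horizontal lift of the kernel. -/
def kerField (z : N × ℝ) : TangentSpace (I.prod 𝓘(ℝ, ℝ)) z :=
  S.polyField ![fun _ => 1, fun t => t, fun t => t ^ 2] z

/-- The horizontal lift of the derivative of the kernel. -/
def kerFieldDeriv (z : N × ℝ) : TangentSpace (I.prod 𝓘(ℝ, ℝ)) z :=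
  S.polyField ![fun _ => 0, fun _ => 1, fun t => 2 * t] z

lemma horiz_kerField (z : N × ℝ) : horiz I z (S.kerField z) = S.kerVec z.2 z.1 := by
  refine (S.horiz_polyField _ z).trans ?_
  rw [Fin.sum_univ_three]
  simp only [Matrix.cons_val_zero, Matrix.cons_val_one, Matrix.cons_val_two, one_smul]
  rfl

lemma horiz_kerFieldDeriv (z : N × ℝ) :
    horiz I z (S.kerFieldDeriv z) = S.kerVecDeriv z.2 z.1 := by
  refine (S.horiz_polyField _ z).trans ?_
  rw [Fin.sum_univ_three]
  simp only [Matrix.cons_val_zero, Matrix.cons_val_one, Matrix.cons_val_two, one_smul, zero_smul,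
    zero_add]
  rfl

lemma smooth_kerField {z : N × ℝ} (hz : z.1 ∈ S.dom) : SmoothFieldAt S.kerField z := by
  refine S.smooth_polyField (fun k => ?_) hz
  fin_cases k
  · exact contDiff_const
  · exact contDiff_id
  · exact contDiff_id.pow 2

lemma smooth_kerFieldDeriv {z : N × ℝ} (hz : z.1 ∈ S.dom) : SmoothFieldAt S.kerFieldDeriv z := by
  refine S.smooth_polyField (fun k => ?_) hz
  fin_cases k
  · exact contDiff_const
  · exact contDiff_const
  · exact contDiff_const.mul contDiff_id

lemma horiz_dt_kerField (hy : y ∈ S.dom) :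
    horiz I (y, t) (VectorField.mlieBracket (I.prod 𝓘(ℝ, ℝ)) (dt I) S.kerField (y, t)) =
      S.kerVecDeriv t y := by
  refine (S.horiz_dt_polyField (fun k => ?_) hy).trans ?_
  · fin_cases k
    · exact contDiff_const
    · exact contDiff_id
    · exact contDiff_id.pow 2
  · rw [Fin.sum_univ_three]
    simp only [Matrix.cons_val_zero, Matrix.cons_val_one, Matrix.cons_val_two, deriv_const',
      deriv_id'', zero_smul, zero_add, one_smul]
    have : deriv (fun t : ℝ => t ^ 2) t = 2 * t := by simp
    rw [kerVecDeriv, ← this]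
    rfl

lemma horiz_dt_kerFieldDeriv (hy : y ∈ S.dom) :
    horiz I (y, t) (VectorField.mlieBracket (I.prod 𝓘(ℝ, ℝ)) (dt I) S.kerFieldDeriv (y, t)) =
      (2 : ℝ) • S.eField 2 y := by
  refine (S.horiz_dt_polyField (fun k => ?_) hy).trans ?_
  · fin_cases k
    · exact contDiff_const
    · exact contDiff_const
    · exact contDiff_const.mul contDiff_id
  · rw [Fin.sum_univ_three]
    simp only [Matrix.cons_val_zero, Matrix.cons_val_one, Matrix.cons_val_two, deriv_const',
      zero_smul, zero_add]
    have : deriv (fun t : ℝ => 2 * t) t = 2 := by simp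
    exact congrArg (fun r : ℝ => r • S.eField 2 y) this

/-- `Y_i` is not in `D`, but `α(Y_i)` is constant, so the derivative terms of Cartan's formula still
vanish. -/
lemma α_mlieBracket_Y (hy : y ∈ S.dom) (i : Fin 2) (k : Fin 3) :
    c.α y (VectorField.mlieBracket I (S.Y i) (S.eField k) y) =
      negExtDeriv c.α y (S.Y i y) (S.eField k y) := by
  have h1 : ∀ᶠ z in 𝓝 y, c.α z (S.eField k z) = 0 := by
    filter_upwards [S.dom_mem_nhds hy] with z hz using S.α_mem hz _ (S.eField_mem hz k)
  have h2 : ∃ r, ∀ᶠ z in 𝓝 y, c.α z (S.Y i z) = r := by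
    fin_cases i
    · exact ⟨1, by filter_upwards [S.dom_mem_nhds hy] with z hz using (S.α_Y z hz).1⟩
    · exact ⟨0, by filter_upwards [S.dom_mem_nhds hy] with z hz using (S.α_Y z hz).2⟩
  obtain ⟨r, h2⟩ := h2
  rw [form_mlieBracket (S.smooth_α y hy) (S.smooth_Y i y hy) (S.smooth_eField hy k),
    mvfderiv_eq_zero_of_eventually h1, mvfderiv_eq_zero_of_eventually h2, sub_zero, zero_add]

lemma β_mlieBracket_Y (hy : y ∈ S.dom) (i : Fin 2) (k : Fin 3) :
    c.β y (VectorField.mlieBracket I (S.Y i) (S.eField k) y) =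
      negExtDeriv c.β y (S.Y i y) (S.eField k y) := by
  have h1 : ∀ᶠ z in 𝓝 y, c.β z (S.eField k z) = 0 := by
    filter_upwards [S.dom_mem_nhds hy] with z hz using S.β_mem hz _ (S.eField_mem hz k)
  have h2 : ∃ r, ∀ᶠ z in 𝓝 y, c.β z (S.Y i z) = r := by
    fin_cases i
    · exact ⟨0, by filter_upwards [S.dom_mem_nhds hy] with z hz using (S.β_Y z hz).1⟩
    · exact ⟨1, by filter_upwards [S.dom_mem_nhds hy] with z hz using (S.β_Y z hz).2⟩
  obtain ⟨r, h2⟩ := h2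
  rw [form_mlieBracket (S.smooth_β y hy) (S.smooth_Y i y hy) (S.smooth_eField hy k),
    mvfderiv_eq_zero_of_eventually h1, mvfderiv_eq_zero_of_eventually h2, sub_zero, zero_add]

/-- The `k`-th part of `(α + t β)([Y_i, X_p])`. -/
def driftTerm (i : Fin 2) (k : Fin 3) (z : N × ℝ) : ℝ :=
  c.α z.1 (VectorField.mlieBracket I (S.Y i) (S.eField k) z.1) +
    z.2 * c.β z.1 (VectorField.mlieBracket I (S.Y i) (S.eField k) z.1)

/-- The vertical component of the generator of the characteristic distribution. -/
def drift (z : N × ℝ) : ℝ :=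
  ∑ k : Fin 3, z.2 ^ (k : ℕ) * (z.2 * S.driftTerm 0 k z - S.driftTerm 1 k z)

lemma smooth_drift {z : N × ℝ} (hz : z.1 ∈ S.dom) : SmoothFunAt (I.prod 𝓘(ℝ, ℝ)) S.drift z := by
  have hs : SmoothFunAt (I.prod 𝓘(ℝ, ℝ)) (fun z : N × ℝ => z.2) z := contMDiffAt_snd
  have hd : ∀ i k, SmoothFunAt (I.prod 𝓘(ℝ, ℝ)) (S.driftTerm i k) z := by
    intro i k
    have hb := (S.smooth_Y i z.1 hz).mlieBracket (S.smooth_eField hz k)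
    have h1 := (S.smooth_α z.1 hz).apply hb
    have h2 := (S.smooth_β z.1 hz).apply hb
    exact (ContMDiffAt.comp z h1 contMDiffAt_fst).add
      (hs.mul (ContMDiffAt.comp z h2 contMDiffAt_fst))
  exact ContMDiffAt.sum fun k _ => (hs.pow _).mul ((hs.mul (hd 0 k)).sub (hd 1 k))

/-- Written with brackets, the drift is visibly smooth; written with exterior derivatives, it is the
term that cancels the contraction of `X_t` with the directions `Y_i`. -/
lemma drift_eq (hy : y ∈ S.dom) : S.drift (y, t) =
    t * (negExtDeriv c.α y (S.Y 0 y) (S.kerVec t y) +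
      t * negExtDeriv c.β y (S.Y 0 y) (S.kerVec t y)) -
    (negExtDeriv c.α y (S.Y 1 y) (S.kerVec t y) +
      t * negExtDeriv c.β y (S.Y 1 y) (S.kerVec t y)) := by
  simp only [drift, driftTerm, S.α_mlieBracket_Y hy, S.β_mlieBracket_Y hy, Fin.sum_univ_three,
    kerVec, map_add, map_smul, smul_eq_mul, Fin.val_zero, Fin.val_one, Fin.val_two]
  ring

/-- The generator of the characteristic distribution. -/
def charField (z : N × ℝ) : TangentSpace (I.prod 𝓘(ℝ, ℝ)) z := S.kerField z + S.drift z • dt I z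

lemma horiz_charField (z : N × ℝ) : horiz I z (S.charField z) = S.kerVec z.2 z.1 := by
  rw [charField, map_add, map_smul, horiz_dt, smul_zero, add_zero, horiz_kerField]

lemma vert_charField (z : N × ℝ) : vert I z (S.charField z) = S.drift z := by
  rw [charField, map_add, map_smul, vert_dt, kerField, vert_polyField, zero_add, smul_eq_mul,
    mul_one]

lemma smooth_charField {z : N × ℝ} (hz : z.1 ∈ S.dom) : SmoothFieldAt S.charField z :=
  (S.smooth_kerField hz).add ((smooth_dt I z).smul (S.smooth_drift hz))

lemma kerVec_mem_kernelSpan (hy : y ∈ S.dom) (t : ℝ) : S.kerVec t y ∈ kernelSpan I 2 D y :=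
  (S.isSectionAt_kerVec hy t).self_of_nhds.2

lemma kerVec_mem (hy : y ∈ S.dom) (t : ℝ) : S.kerVec t y ∈ D y := by
  have h := S.eField_mem hy
  exact Submodule.add_mem _ (Submodule.add_mem _ (h 0) (Submodule.smul_mem _ _ (h 1)))
      (Submodule.smul_mem _ _ (h 2))

lemma mem_quasiContact_of_horiz_mem {z : N × ℝ} (hz : z.1 ∈ S.dom)
    {v : TangentSpace (I.prod 𝓘(ℝ, ℝ)) z} (hv : horiz I z v ∈ D z.1) : v ∈ c.quasiContact z := by
  rw [c.mem_quasiContact, S.α_mem hz _ hv, S.β_mem hz _ hv, mul_zero, add_zero]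

/-- A vector of `Λ` projects to a vector of `D` plus a multiple of `Y_1 - t Y_0`. The `D` part pairs
to zero with `X_t`, and the drift is chosen to cancel the remaining pairing. -/
lemma charField_mem_characteristic {z : N × ℝ} (hz : z.1 ∈ S.dom) :
    S.charField z ∈ c.characteristic z := by
  obtain ⟨y, t⟩ := z
  change y ∈ S.dom at hz
  have hsec : IsSectionAt (I.prod 𝓘(ℝ, ℝ)) c.quasiContact S.charField (y, t) := by
    filter_upwards [S.prod_mem_nhds hz t] with z hz
    refine ⟨S.smooth_charField hz, S.mem_quasiContact_of_horiz_mem hz ?_⟩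
    rw [horiz_charField]
    exact S.kerVec_mem hz _
  refine Submodule.subset_span ⟨S.charField, hsec, rfl, fun Z hZ => c.mem_quasiContact.2 ?_⟩
  refine (S.contact_mlieBracket hz hZ hsec).trans ?_
  have h0 := c.mem_quasiContact.1 hZ.self_of_nhds.2
  rw [horiz_charField, vert_charField, S.drift_eq hz, S.β_mem hz _ (S.kerVec_mem hz t)]
  set v := horiz I (y, t) (Z (y, t)) with hv
  have hexp := S.expand y hz v
  set d := ∑ i, S.ξ i y v • S.X i y with hd
  have hdD : d ∈ D y := S.vec_mem hz _
  have hdk := S.negExtDeriv_kerVec hz t hdD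
  rw [negExtDeriv_swap _ _ (S.kerVec t y), negExtDeriv_swap _ _ (S.kerVec t y)] at hdk
  have e : ∀ η : ∀ y : N, TangentSpace I y →L[ℝ] ℝ, negExtDeriv η y v (S.kerVec t y) =
      negExtDeriv η y d (S.kerVec t y) + (c.α y v * negExtDeriv η y (S.Y 0 y) (S.kerVec t y) +
        c.β y v * negExtDeriv η y (S.Y 1 y) (S.kerVec t y)) := by
    intro η
    conv_lhs => rw [hexp]
    simp only [map_add, map_smul, add_apply, smul_apply, smul_eq_mul]
  rw [e, e]
  have h0' : c.α y v = - (t * c.β y v) := eq_neg_of_add_eq_zero_left h0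
  rw [h0']
  linear_combination - hdk

/-- Bracketing with `∂_t` forces `β = 0`, so the projection lies in `D`. Bracketing with lifts of
the frame of `D` then puts it in the kernel of `A^*(α + tβ)`. -/
lemma exists_horiz_eq_of_mem_characteristic (hk : ∀ y : N, kroneckerIndex I D y = 2)
    {z : N × ℝ} (hz : z.1 ∈ S.dom) {v : TangentSpace (I.prod 𝓘(ℝ, ℝ)) z}
    (hv : v ∈ c.characteristic z) : ∃ r : ℝ, horiz I z v = r • S.kerVec z.2 z.1 := by
  obtain ⟨y, t⟩ := z
  change y ∈ S.dom at hz
  suffices h : c.characteristic (y, t) ≤ (Submodule.span ℝ {S.kerVec t y}).comap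
      (horiz I (y, t)).toLinearMap by
    obtain ⟨r, hr⟩ := Submodule.mem_span_singleton.1 (h hv)
    exact ⟨r, hr.symm⟩
  refine Submodule.span_le.2 ?_
  rintro _ ⟨X, hX, rfl, hXC⟩
  have hdt : IsSectionAt (I.prod 𝓘(ℝ, ℝ)) c.quasiContact (dt I) (y, t) := by
    filter_upwards [S.prod_mem_nhds hz t] with z hz
    refine ⟨smooth_dt I z, S.mem_quasiContact_of_horiz_mem hz ?_⟩
    rw [horiz_dt]
    exact Submodule.zero_mem _
  have hXj : ∀ j, IsSectionAt (I.prod 𝓘(ℝ, ℝ)) c.quasiContact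
      (fun z => mkVec I z (S.X j z.1) 0) (y, t) := by
    intro j
    filter_upwards [S.prod_mem_nhds hz t] with z hz
    exact ⟨smoothFieldAt_mkVec (S.smooth_X j z.1 hz) 0,
      S.mem_quasiContact_of_horiz_mem hz (S.X_mem hz j)⟩
  have h1 := (S.contact_mlieBracket hz hdt hX).symm.trans (c.mem_quasiContact.1 (hXC _ hdt))
  rw [horiz_dt, vert_dt, map_zero, map_zero, map_zero, zero_apply] at h1
  have hβ : c.β y (horiz I (y, t) (X (y, t))) = 0 := by linarith
  have hα : c.α y (horiz I (y, t) (X (y, t))) = 0 := by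
    have h := c.mem_quasiContact.1 hX.self_of_nhds.2
    change c.α y (horiz I (y, t) (X (y, t))) + t * c.β y (horiz I (y, t) (X (y, t))) = 0 at h
    rw [hβ] at h
    linarith
  have hXD := (S.mem_D_iff hz).2 ⟨hα, hβ⟩
  have h2 : ∀ j, negExtDeriv c.α y (horiz I (y, t) (X (y, t))) (S.X j y) +
      t * negExtDeriv c.β y (horiz I (y, t) (X (y, t))) (S.X j y) = 0 := by
    intro j
    have h := (S.contact_mlieBracket hz (hXj j) hX).symm.trans
      (c.mem_quasiContact.1 (hXC _ (hXj j)))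
    rw [horiz_mkVec, vert_mkVec] at h
    change - (0 * _) + _ * c.β y (S.X j y) + (negExtDeriv c.α y (S.X j y) _ +
      t * negExtDeriv c.β y (S.X j y) _) = 0 at h
    rw [S.β_mem hz _ (S.X_mem hz j)] at h
    rw [negExtDeriv_swap _ _ _ (S.X j y), negExtDeriv_swap _ _ _ (S.X j y)]
    linarith
  obtain ⟨r, hr⟩ := S.exists_eq_smul_kerVec hk hz (t := t) hXD (fun u hu => by
    rw [← S.vec_coords hz hu]
    simp only [vec, map_sum, map_smul, smul_eq_mul, Finset.mul_sum, ← Finset.sum_add_distrib]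
    refine Finset.sum_eq_zero fun j _ => ?_
    linear_combination S.coords y u j * h2 j)
  exact Submodule.mem_span_singleton.2 ⟨r, hr.symm⟩

end AdaptedFrame
end Characteristic

/-! ### The filtrations `L_i`, `K_i` and `𝒜_r` -/

section Filtrations

set_option linter.unusedSectionVars false

variable {E : Type*} [NormedAddCommGroup E] [NormedSpace ℝ E] [CompleteSpace E]
  {H : Type*} [TopologicalSpace H] {I : ModelWithCorners ℝ E H}
  {N : Type*} [TopologicalSpace N] [ChartedSpace H N] [IsManifold I ∞ N]

lemma IsSectionAt.mono {P Q : ∀ y : N, Submodule ℝ (TangentSpace I y)}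
    {X : ∀ y : N, TangentSpace I y} {x : N} (hX : IsSectionAt I P X x)
    (h : ∀ᶠ y in 𝓝 x, P y ≤ Q y) : IsSectionAt I Q X x := by
  filter_upwards [hX, h] with y h1 h2 using ⟨h1.1, h2 h1.2⟩

namespace AdaptedFrame

variable {D : ∀ y : N, Submodule ℝ (TangentSpace I y)} {x : N} {c : AffineChart I D x}
  (S : AdaptedFrame D x c) {y : N} {t : ℝ}

lemma vertical_le_filtL (c : AffineChart I D x) (i : ℕ) (z : N × ℝ) :
    vertical I z ≤ c.filtL i z := by
  induction i with
  | zero => exact le_sup_left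
  | succ i ih => exact ih.trans le_sup_left

/-- `L_i` contains `V`, so membership depends on the projection only. In particular the drift may be
dropped. -/
lemma mem_filtL_of_horiz_eq {i : ℕ} {z : N × ℝ} {v w : TangentSpace (I.prod 𝓘(ℝ, ℝ)) z}
    (hv : v ∈ c.filtL i z) (h : horiz I z w = horiz I z v) : w ∈ c.filtL i z := by
  have h' : w - v ∈ c.filtL i z := vertical_le_filtL c i z (mem_vertical.2 (by
    rw [map_sub, h, sub_self]))
  simpa using Submodule.add_mem _ h' hv

lemma filtL_le_succ (c : AffineChart I D x) (i : ℕ) (z : N × ℝ) :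
    c.filtL i z ≤ c.filtL (i + 1) z := le_sup_left

lemma kerField_mem_filtL {z : N × ℝ} (hz : z.1 ∈ S.dom) : S.kerField z ∈ c.filtL 0 z := by
  have h : S.charField z ∈ c.filtL 0 z :=
    (le_sup_right : _ ≤ vertical I z ⊔ c.characteristic z) (S.charField_mem_characteristic hz)
  exact mem_filtL_of_horiz_eq h (by rw [horiz_kerField, horiz_charField])

lemma isSectionAt_dt (z : N × ℝ) : IsSectionAt (I.prod 𝓘(ℝ, ℝ)) (vertical I) (dt I) z :=
  .of_forall fun z => ⟨smooth_dt I z, mem_vertical.2 (horiz_dt I z)⟩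

lemma isSectionAt_kerField (hy : y ∈ S.dom) (t : ℝ) :
    IsSectionAt (I.prod 𝓘(ℝ, ℝ)) (c.filtL 0) S.kerField (y, t) := by
  filter_upwards [S.prod_mem_nhds hy t] with z hz
    using ⟨S.smooth_kerField hz, S.kerField_mem_filtL hz⟩

lemma kerFieldDeriv_mem_filtL {z : N × ℝ} (hz : z.1 ∈ S.dom) :
    S.kerFieldDeriv z ∈ c.filtL 1 z := by
  obtain ⟨y, t⟩ := z
  have h : VectorField.mlieBracket (I.prod 𝓘(ℝ, ℝ)) (dt I) S.kerField (y, t) ∈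
      c.filtL 1 (y, t) :=
    (le_sup_right : _ ≤ c.filtL 0 (y, t) ⊔ _) (Submodule.subset_span
      ⟨dt I, S.kerField, isSectionAt_dt _, S.isSectionAt_kerField hz t, rfl⟩)
  exact mem_filtL_of_horiz_eq h (by rw [S.horiz_dt_kerField hz, horiz_kerFieldDeriv])

lemma isSectionAt_kerFieldDeriv (hy : y ∈ S.dom) (t : ℝ) :
    IsSectionAt (I.prod 𝓘(ℝ, ℝ)) (c.filtL 1) S.kerFieldDeriv (y, t) := by
  filter_upwards [S.prod_mem_nhds hy t] with z hz
    using ⟨S.smooth_kerFieldDeriv hz, S.kerFieldDeriv_mem_filtL hz⟩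

/-- `H_3 ⊆ L_2`. -/
lemma lift_le_filtL {z : N × ℝ} (hz : z.1 ∈ S.dom) :
    lift I (kernelSpan I 2 D) z ≤ c.filtL 2 z := by
  obtain ⟨y, t⟩ := z
  change y ∈ S.dom at hz
  have h2 : VectorField.mlieBracket (I.prod 𝓘(ℝ, ℝ)) (dt I) S.kerFieldDeriv (y, t) ∈
      c.filtL 2 (y, t) :=
    (le_sup_right : _ ≤ c.filtL 1 (y, t) ⊔ _) (Submodule.subset_span
      ⟨dt I, S.kerFieldDeriv, isSectionAt_dt _, S.isSectionAt_kerFieldDeriv hz t, rfl⟩)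
  have h1 : S.kerFieldDeriv (y, t) ∈ c.filtL 2 (y, t) :=
    filtL_le_succ c 1 _ (S.kerFieldDeriv_mem_filtL hz)
  have h0 : S.kerField (y, t) ∈ c.filtL 2 (y, t) :=
    filtL_le_succ c 1 _ (filtL_le_succ c 0 _ (S.kerField_mem_filtL hz))
  -- The triangular system `X_t'' = 2 e_2`, `X_t' = e_1 + 2t e_2`, `X_t = e_0 + t e_1 + t² e_2` is
  -- solved from the top.
  have m2 : mkVec I (y, t) (S.eField 2 y) 0 ∈ c.filtL 2 (y, t) := by
    refine mem_filtL_of_horiz_eq (Submodule.smul_mem _ (1 / 2 : ℝ) h2) ?_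
    rw [map_smul, S.horiz_dt_kerFieldDeriv hz, horiz_mkVec, smul_smul]
    norm_num
  have m1 : mkVec I (y, t) (S.eField 1 y) 0 ∈ c.filtL 2 (y, t) := by
    refine mem_filtL_of_horiz_eq
      (Submodule.sub_mem _ h1 (Submodule.smul_mem _ (2 * t) m2)) ?_
    rw [map_sub, map_smul, horiz_kerFieldDeriv, horiz_mkVec, horiz_mkVec, kerVecDeriv,
      add_sub_cancel_right]
  have m0 : mkVec I (y, t) (S.eField 0 y) 0 ∈ c.filtL 2 (y, t) := by
    refine mem_filtL_of_horiz_eq (Submodule.sub_mem _ (Submodule.sub_mem _ h0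
      (Submodule.smul_mem _ (t ^ 2) m2)) (Submodule.smul_mem _ t m1)) ?_
    rw [map_sub, map_sub, map_smul, map_smul, horiz_kerField, horiz_mkVec, horiz_mkVec,
      horiz_mkVec, kerVec, add_sub_cancel_right, add_sub_cancel_right]
  intro v hv
  have hv' := mem_lift.1 hv
  rw [S.kernelSpan_eq hz] at hv'
  obtain ⟨r, hr⟩ := (Submodule.mem_span_range_iff_exists_fun ℝ).1 hv'
  have hm : ∀ k, mkVec I (y, t) (S.eField k y) 0 ∈ c.filtL 2 (y, t) := by
    intro k
    fin_cases k
    exacts [m0, m1, m2]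
  refine mem_filtL_of_horiz_eq (v := ∑ k, r k • mkVec I (y, t) (S.eField k y) 0)
    (Submodule.sum_mem _ fun k _ => Submodule.smul_mem _ _ (hm k)) ?_
  rw [map_sum, ← hr]
  exact Finset.sum_congr rfl fun k _ => by rw [map_smul, horiz_mkVec]

lemma θ_horiz_mlieBracket (hk : ∀ y : N, kroneckerIndex I D y = 2) (hy : y ∈ S.dom) (k : Fin 3)
    {X Y : ∀ z : N × ℝ, TangentSpace (I.prod 𝓘(ℝ, ℝ)) z}
    (hX : IsSectionAt (I.prod 𝓘(ℝ, ℝ)) (lift I (kernelSpan I 2 D)) X (y, t))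
    (hY : IsSectionAt (I.prod 𝓘(ℝ, ℝ)) (lift I (kernelSpan I 2 D)) Y (y, t)) :
    S.θ k y (horiz I (y, t) (VectorField.mlieBracket (I.prod 𝓘(ℝ, ℝ)) X Y (y, t))) =
      negExtDeriv (S.θ k) y (horiz I (y, t) (X (y, t))) (horiz I (y, t) (Y (y, t))) := by
  refine form_horiz_mlieBracket_of_eventually_zero (S.smooth_θ hy k) hX.self_of_nhds.1
    hY.self_of_nhds.1 ?_ ?_
  · filter_upwards [S.prod_mem_nhds hy t, hX] with z h1 h2
      using ((S.mem_kernelSpan_iff hk h1).1 (mem_lift.1 h2.2)).2 k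
  · filter_upwards [S.prod_mem_nhds hy t, hY] with z h1 h2
      using ((S.mem_kernelSpan_iff hk h1).1 (mem_lift.1 h2.2)).2 k

lemma θt_horiz_mlieBracket (hk : ∀ y : N, kroneckerIndex I D y = 2) (hy : y ∈ S.dom) (s : ℝ)
    {X Y : ∀ z : N × ℝ, TangentSpace (I.prod 𝓘(ℝ, ℝ)) z}
    (hX : IsSectionAt (I.prod 𝓘(ℝ, ℝ)) (lift I (kernelSpan I 2 D)) X (y, t))
    (hY : IsSectionAt (I.prod 𝓘(ℝ, ℝ)) (lift I (kernelSpan I 2 D)) Y (y, t)) :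
    S.θt s y (horiz I (y, t) (VectorField.mlieBracket (I.prod 𝓘(ℝ, ℝ)) X Y (y, t))) =
      negExtDeriv (S.θt s) y (horiz I (y, t) (X (y, t))) (horiz I (y, t) (Y (y, t))) := by
  refine form_horiz_mlieBracket_of_eventually_zero (S.smooth_θt hy s) hX.self_of_nhds.1
    hY.self_of_nhds.1 ?_ ?_
  · filter_upwards [S.prod_mem_nhds hy t, hX] with z h1 h2
      using S.θt_eq_zero hk h1 s (mem_lift.1 h2.2)
  · filter_upwards [S.prod_mem_nhds hy t, hY] with z h1 h2
      using S.θt_eq_zero hk h1 s (mem_lift.1 h2.2)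

/-- Brackets of sections of `H_3` are tangent to `H`. -/
lemma horiz_mlieBracket_mem (hk : ∀ y : N, kroneckerIndex I D y = 2) (hy : y ∈ S.dom)
    {X Y : ∀ z : N × ℝ, TangentSpace (I.prod 𝓘(ℝ, ℝ)) z}
    (hX : IsSectionAt (I.prod 𝓘(ℝ, ℝ)) (lift I (kernelSpan I 2 D)) X (y, t))
    (hY : IsSectionAt (I.prod 𝓘(ℝ, ℝ)) (lift I (kernelSpan I 2 D)) Y (y, t)) :
    horiz I (y, t) (VectorField.mlieBracket (I.prod 𝓘(ℝ, ℝ)) X Y (y, t)) ∈ D y := by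
  have h := S.negExtDeriv_eq_zero hk hy (mem_lift.1 hX.self_of_nhds.2)
    (mem_lift.1 hY.self_of_nhds.2)
  have hXD : ∀ᶠ z in 𝓝 (y, t), z.1 ∈ S.dom ∧ horiz I z (X z) ∈ D z.1 := by
    filter_upwards [S.prod_mem_nhds hy t, hX] with z h1 h2
      using ⟨h1, S.kernelSpan_le hk h1 (mem_lift.1 h2.2)⟩
  have hYD : ∀ᶠ z in 𝓝 (y, t), z.1 ∈ S.dom ∧ horiz I z (Y z) ∈ D z.1 := by
    filter_upwards [S.prod_mem_nhds hy t, hY] with z h1 h2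
      using ⟨h1, S.kernelSpan_le hk h1 (mem_lift.1 h2.2)⟩
  refine (S.mem_D_iff hy).2 ⟨?_, ?_⟩
  · exact (form_horiz_mlieBracket_of_eventually_zero (S.smooth_α y hy) hX.self_of_nhds.1
      hY.self_of_nhds.1 (hXD.mono fun z hz => S.α_mem hz.1 _ hz.2)
      (hYD.mono fun z hz => S.α_mem hz.1 _ hz.2)).trans h.1
  · exact (form_horiz_mlieBracket_of_eventually_zero (S.smooth_β y hy) hX.self_of_nhds.1
      hY.self_of_nhds.1 (hXD.mono fun z hz => S.β_mem hz.1 _ hz.2)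
      (hYD.mono fun z hz => S.β_mem hz.1 _ hz.2)).trans h.2

/-- The bracket of sections of `H_3` with dependent projections lies in `H_3`. -/
lemma mlieBracket_mem_lift (hk : ∀ y : N, kroneckerIndex I D y = 2) (hy : y ∈ S.dom)
    {X Y : ∀ z : N × ℝ, TangentSpace (I.prod 𝓘(ℝ, ℝ)) z} {u : TangentSpace I y} {r s : ℝ}
    (hX : IsSectionAt (I.prod 𝓘(ℝ, ℝ)) (lift I (kernelSpan I 2 D)) X (y, t))
    (hY : IsSectionAt (I.prod 𝓘(ℝ, ℝ)) (lift I (kernelSpan I 2 D)) Y (y, t))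
    (hXu : horiz I (y, t) (X (y, t)) = r • u) (hYu : horiz I (y, t) (Y (y, t)) = s • u) :
    VectorField.mlieBracket (I.prod 𝓘(ℝ, ℝ)) X Y (y, t) ∈ lift I (kernelSpan I 2 D) (y, t) := by
  refine mem_lift.2 ((S.mem_kernelSpan_iff hk hy).2
    ⟨S.horiz_mlieBracket_mem hk hy hX hY, fun k => ?_⟩)
  rw [S.θ_horiz_mlieBracket hk hy k hX hY, hXu, hYu, map_smul, map_smul, smul_apply,
    negExtDeriv_self, smul_zero, smul_zero]

lemma filtL_zero_spec (hk : ∀ y : N, kroneckerIndex I D y = 2)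
    {z : N × ℝ} (hz : z.1 ∈ S.dom) {v : TangentSpace (I.prod 𝓘(ℝ, ℝ)) z}
    (hv : v ∈ c.filtL 0 z) : ∃ r : ℝ, horiz I z v = r • S.kerVec z.2 z.1 := by
  obtain ⟨u, hu, w, hw, rfl⟩ := Submodule.mem_sup.1 hv
  obtain ⟨r, hr⟩ := S.exists_horiz_eq_of_mem_characteristic hk hz hw
  exact ⟨r, by rw [map_add, mem_vertical.1 hu, zero_add, hr]⟩

/-- `L_i ⊆ H_3`. -/
lemma filtL_le (hk : ∀ y : N, kroneckerIndex I D y = 2) (i : ℕ) : ∀ {z : N × ℝ}, z.1 ∈ S.dom →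
    c.filtL i z ≤ lift I (kernelSpan I 2 D) z := by
  induction i with
  | zero =>
    intro z hz v hv
    obtain ⟨r, hr⟩ := S.filtL_zero_spec hk hz hv
    rw [mem_lift, hr]
    exact Submodule.smul_mem _ _ (S.kerVec_mem_kernelSpan hz _)
  | succ i ih =>
    rintro ⟨y, t⟩ hz
    change y ∈ S.dom at hz
    refine sup_le (ih hz) (Submodule.span_le.2 ?_)
    rintro _ ⟨X, Y, hX, hY, rfl⟩
    have hX' := mem_vertical.1 hX.self_of_nhds.2
    -- A vertical field projects to zero, which is proportional to any projection.
    refine S.mlieBracket_mem_lift hk hz (u := horiz I (y, t) (Y (y, t))) (r := 0) (s := 1)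
      (hX.mono (.of_forall fun z v hv => ?_))
      (hY.mono ((S.prod_mem_nhds hz t).mono fun z hz => ih hz)) ?_ (one_smul _ _).symm
    · rw [mem_lift, mem_vertical.1 hv]
      exact Submodule.zero_mem _
    · rw [hX', zero_smul]

lemma isSectionAt_of_filtL (hk : ∀ y : N, kroneckerIndex I D y = 2) (hy : y ∈ S.dom) {i : ℕ}
    {X : ∀ z : N × ℝ, TangentSpace (I.prod 𝓘(ℝ, ℝ)) z}
    (hX : IsSectionAt (I.prod 𝓘(ℝ, ℝ)) (c.filtL i) X (y, t)) :
    IsSectionAt (I.prod 𝓘(ℝ, ℝ)) (lift I (kernelSpan I 2 D)) X (y, t) :=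
  hX.mono ((S.prod_mem_nhds hy t).mono fun _ hz => S.filtL_le hk i hz)

lemma spaceA_le (hk : ∀ y : N, kroneckerIndex I D y = 2)
    (hy : y ∈ S.dom) (r : ℕ) : c.spaceA 2 r (y, t) ≤ lift I D (y, t) := by
  refine sup_le (fun v hv => mem_lift.2 (S.kernelSpan_le hk hy (mem_lift.1 hv)))
    (iSup_le fun i => iSup_le fun j => iSup_le fun _ => Submodule.span_le.2 ?_)
  rintro _ ⟨X, Y, hX, hY, rfl⟩
  exact mem_lift.2 (S.horiz_mlieBracket_mem hk hy (S.isSectionAt_of_filtL hk hy hX)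
    (S.isSectionAt_of_filtL hk hy hY))

/-- `L_0` projects to a line, on which the skew forms `-dθ_k` vanish. Hence `0` is never a value of
the minimum defining `w`. -/
lemma spaceA_zero (hk : ∀ y : N, kroneckerIndex I D y = 2) (hy : y ∈ S.dom) :
    c.spaceA 2 0 (y, t) = lift I (kernelSpan I 2 D) (y, t) := by
  refine le_antisymm (sup_le le_rfl
    (iSup_le fun i => iSup_le fun j => iSup_le fun hij => Submodule.span_le.2 ?_)) le_sup_left
  obtain ⟨rfl, rfl⟩ : i = 0 ∧ j = 0 := by omega
  rintro _ ⟨X, Y, hX, hY, rfl⟩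
  obtain ⟨r, hr⟩ := S.filtL_zero_spec hk hy hX.self_of_nhds.2
  obtain ⟨s, hs⟩ := S.filtL_zero_spec hk hy hY.self_of_nhds.2
  exact S.mlieBracket_mem_lift hk hy (S.isSectionAt_of_filtL hk hy hX)
    (S.isSectionAt_of_filtL hk hy hY) hr hs

lemma bracketAt_le_spaceA {i j r : ℕ} (hij : i + j ≤ r ∧ i ≤ 2 ∧ j ≤ 2) (z : N × ℝ) :
    bracketAt (I.prod 𝓘(ℝ, ℝ)) (c.filtL i) (c.filtL j) z ≤ c.spaceA 2 r z := by
  refine le_sup_of_le_right (le_iSup_of_le i (le_iSup_of_le j ?_))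
  rw [iSup_pos hij]

lemma isSectionAt_mkVec {P : ∀ y : N, Submodule ℝ (TangentSpace I y)}
    {X : ∀ y : N, TangentSpace I y} (hX : IsSectionAt I P X y) (t : ℝ) :
    IsSectionAt (I.prod 𝓘(ℝ, ℝ)) (lift I P) (fun z => mkVec I z (X z.1) 0) (y, t) := by
  filter_upwards [continuousAt_fst.eventually hX] with z hz
  exact ⟨smoothFieldAt_mkVec hz.1 0, mem_lift.2 hz.2⟩

/-- If `D_3` is not involutive then the filtration `𝒜_r` is not constant. -/
lemma spaceA_four_ne (hk : ∀ y : N, kroneckerIndex I D y = 2)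
    (hy : y ∈ S.dom) (hinv : ¬ InvolutiveAt I (kernelSpan I 2 D) y) (t : ℝ) :
    c.spaceA 2 4 (y, t) ≠ lift I (kernelSpan I 2 D) (y, t) := by
  intro h
  refine hinv (Submodule.span_le.2 ?_)
  rintro _ ⟨X, Y, hX, hY, rfl⟩
  have hX1 := isSectionAt_mkVec hX t
  have hY1 := isSectionAt_mkVec hY t
  have hle : ∀ᶠ z in 𝓝 (y, t), lift I (kernelSpan I 2 D) z ≤ c.filtL 2 z :=
    (S.prod_mem_nhds hy t).mono fun z hz => S.lift_le_filtL hz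
  have hb : VectorField.mlieBracket (I.prod 𝓘(ℝ, ℝ)) (fun z => mkVec I z (X z.1) 0)
      (fun z => mkVec I z (Y z.1) 0) (y, t) ∈ lift I (kernelSpan I 2 D) (y, t) := by
    rw [← h]
    -- Since `H_3 ⊆ L_2`, lifts of sections of `D_3` are sections of `L_2`, and `4 = 2 + 2`.
    exact bracketAt_le_spaceA (i := 2) (j := 2) (by norm_num) _
      (Submodule.subset_span ⟨_, _, hX1.mono hle, hY1.mono hle, rfl⟩)
  refine (S.mem_kernelSpan_iff hk hy).2 ⟨S.mlieBracket_mem_D hk hy hX hY, fun k => ?_⟩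
  rw [S.θ_mlieBracket hk hy k hX hY]
  exact (S.θ_horiz_mlieBracket hk hy k hX1 hY1).symm.trans
    (((S.mem_kernelSpan_iff hk hy).1 (mem_lift.1 hb)).2 k)

/-- The bracket of the kernel with its derivative. -/
lemma kerBracket_mem_spaceA (hy : y ∈ S.dom) :
    VectorField.mlieBracket (I.prod 𝓘(ℝ, ℝ)) S.kerField S.kerFieldDeriv (y, t) ∈
      c.spaceA 2 1 (y, t) :=
  bracketAt_le_spaceA (i := 0) (j := 1) (by norm_num) _ (Submodule.subset_span
    ⟨_, _, S.isSectionAt_kerField hy t, S.isSectionAt_kerFieldDeriv hy t, rfl⟩)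

lemma θt_kerBracket (hk : ∀ y : N, kroneckerIndex I D y = 2) (hy : y ∈ S.dom) :
    S.θt t y (horiz I (y, t)
      (VectorField.mlieBracket (I.prod 𝓘(ℝ, ℝ)) S.kerField S.kerFieldDeriv (y, t))) =
      S.obstruction t y := by
  rw [S.θt_horiz_mlieBracket hk hy t (S.isSectionAt_of_filtL hk hy (S.isSectionAt_kerField hy t))
    (S.isSectionAt_of_filtL hk hy (S.isSectionAt_kerFieldDeriv hy t)), horiz_kerField,
    horiz_kerFieldDeriv]
  rfl

lemma spaceA_one_ne (hk : ∀ y : N, kroneckerIndex I D y = 2)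
    (hy : y ∈ S.dom) (h : S.obstruction t y ≠ 0) :
    c.spaceA 2 1 (y, t) ≠ lift I (kernelSpan I 2 D) (y, t) := by
  intro he
  have hm := S.kerBracket_mem_spaceA hy (t := t)
  rw [he] at hm
  exact h ((S.θt_kerBracket hk hy).symm.trans (S.θt_eq_zero hk hy t (mem_lift.1 hm)))

/-- The bracket of such a section of `H` with the generator of `C` lies in `H`, hence is killed by
`β`. By Cartan's formula that value is `A^*(β)(X_t, ·)`. -/
lemma negExtDeriv_eq_zero_of_mem_filtK (hy : y ∈ S.dom)
    {v : TangentSpace (I.prod 𝓘(ℝ, ℝ)) (y, t)} (hv : v ∈ c.filtK 2 1 (y, t)) :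
    negExtDeriv c.β y (S.kerVec t y) (horiz I (y, t) v) = 0 := by
  suffices h : c.filtK 2 1 (y, t) ≤ (LinearMap.ker
      (negExtDeriv c.β y (S.kerVec t y)).toLinearMap).comap (horiz I (y, t)).toLinearMap from h hv
  refine Submodule.span_le.2 ?_
  rintro _ ⟨X, hX, rfl, hXC⟩
  have hC : IsSectionAt (I.prod 𝓘(ℝ, ℝ)) c.characteristic S.charField (y, t) := by
    filter_upwards [S.prod_mem_nhds hy t] with z hz
      using ⟨S.smooth_charField hz, S.charField_mem_characteristic hz⟩
  have h := S.β_mem hy _ (mem_lift.1 (hXC _ hC))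
  have h' := form_horiz_mlieBracket_of_eventually_zero (S.smooth_β y hy) hC.self_of_nhds.1
    hX.self_of_nhds.1 (by
      filter_upwards [S.prod_mem_nhds hy t] with z hz
      rw [horiz_charField]
      exact S.β_mem hz _ (S.kerVec_mem hz _)) (by
      filter_upwards [S.prod_mem_nhds hy t, hX] with z hz hz'
      exact S.β_mem hz _ (mem_lift.1 hz'.2))
  rw [horiz_charField] at h'
  exact h'.symm.trans h

lemma obstruction_eq_zero (hk : ∀ y : N, kroneckerIndex I D y = 2)
    (hy : y ∈ S.dom) (h : c.spaceA 2 1 (y, t) ≤ c.filtK 2 1 (y, t)) :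
    S.obstruction t y = 0 := by
  have hm := S.kerBracket_mem_spaceA hy (t := t)
  rw [← S.θt_kerBracket hk hy, S.θt_eq hy t (mem_lift.1 (S.spaceA_le hk hy 1 hm))]
  exact S.negExtDeriv_eq_zero_of_mem_filtK hy (h hm)

end AdaptedFrame
end Filtrations

/-! ### Independence of the chart, and the invariants `w_D` and `i_D` -/

section Invariants

set_option linter.unusedSectionVars false

variable {E : Type*} [NormedAddCommGroup E] [NormedSpace ℝ E] [CompleteSpace E]
  {H : Type*} [TopologicalSpace H] {I : ModelWithCorners ℝ E H}
  {N : Type*} [TopologicalSpace N] [ChartedSpace H N] [IsManifold I ∞ N]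

variable (I) in
/-- The vanishing of the obstruction to `𝒜_1 ⊆ K_1` at `[p]`, in terms of `D` only. -/
def DegenerateAt (D : ∀ y : N, Submodule ℝ (TangentSpace I y)) (x : N)
    (p : TangentSpace I x →L[ℝ] ℝ) : Prop :=
  ∀ Z₁ Z₂ W : ∀ y : N, TangentSpace I y,
    IsSectionAt I (kernelSpan I 2 D) Z₁ x → IsSectionAt I (kernelSpan I 2 D) Z₂ x →
    IsSectionAt I D W x → W x = VectorField.mlieBracket I Z₁ Z₂ x →
    (∀ U, IsSectionAt I D U x → p (VectorField.mlieBracket I Z₁ U x) = 0) →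
    ∀ s ∈ annihilator I D x, (∀ U, IsSectionAt I D U x →
      p (VectorField.mlieBracket I Z₂ U x) = s (VectorField.mlieBracket I Z₁ U x)) →
    ∀ r ∈ annihilator I D x, r (VectorField.mlieBracket I Z₁ W x) = 0

namespace AdaptedFrame

variable {D : ∀ y : N, Submodule ℝ (TangentSpace I y)} {x : N} {c : AffineChart I D x}
  (S : AdaptedFrame D x c) {y : N} {t : ℝ}

/-- Modulo `α + tβ`, whose pencil form has `X_t` in its kernel, every element of `D^⊥` is a multiple
of `β`. -/
lemma annihilator_apply_kerVec (hy : y ∈ S.dom) {r : TangentSpace I y →L[ℝ] ℝ}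
    (hr : r ∈ annihilator I D y) {Z U : ∀ y : N, TangentSpace I y} (hZ : IsSectionAt I D Z y)
    (hU : IsSectionAt I D U y) {ρ : ℝ} (hρ : Z y = ρ • S.kerVec t y) :
    r (VectorField.mlieBracket I Z U y) = ρ * (r (S.Y 1 y) - t * r (S.Y 0 y)) *
      negExtDeriv c.β y (S.kerVec t y) (U y) := by
  have h := S.negExtDeriv_kerVec hy t hU.self_of_nhds.2
  have e := congrArg (fun q : TangentSpace I y →L[ℝ] ℝ => q (VectorField.mlieBracket I Z U y))
    (S.eq_of_annihilator hy hr)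
  refine e.trans ?_
  simp only [add_apply, smul_apply, smul_eq_mul, S.α_mlieBracket hy hZ hU,
    S.β_mlieBracket hy hZ hU, hρ, map_smul]
  linear_combination r (S.Y 0 y) * ρ * h

/-- The conditions in `DegenerateAt` describe the pair `(X_t, X_t')` without a chart. The first
makes `Z₁` a multiple of `X_t`; the second makes `Z₂` a combination of `X_t` and `X_t'`, because it
is the `t`-derivative of the kernel equation. So `θ_t([Z₁, Z₂])` is a multiple of the obstruction.
-/
lemma degenerateAt (hk : ∀ y : N, kroneckerIndex I D y = 2) (hy : y ∈ S.dom)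
    (h : S.obstruction t y = 0) {κ : ℝ} (hκ : κ ≠ 0) :
    DegenerateAt I D y (κ • (c.α y + t • c.β y)) := by
  intro Z₁ Z₂ W h1 h2 hW hWx hker s hs hZ₂ r hr
  have h1D := S.isSectionAt_kernelSpan hk hy h1
  have h2D := S.isSectionAt_kernelSpan hk hy h2
  have hp : ∀ Z U, IsSectionAt I D Z y → IsSectionAt I D U y →
      (κ • (c.α y + t • c.β y)) (VectorField.mlieBracket I Z U y) =
        κ * (negExtDeriv c.α y (Z y) (U y) + t * negExtDeriv c.β y (Z y) (U y)) := by
    intro Z U hZ hU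
    simp only [add_apply, smul_apply, smul_eq_mul, S.α_mlieBracket hy hZ hU,
      S.β_mlieBracket hy hZ hU]
  have hU := S.isSectionAt_vec_const hy
  obtain ⟨ρ, hρ⟩ := S.exists_eq_smul_kerVec hk hy (t := t) h1D.self_of_nhds.2 (fun u hu => by
    have e := hker _ (hU (S.coords y u))
    rw [hp _ _ h1D (hU _), S.vec_coords hy hu] at e
    exact (mul_eq_zero.1 e).resolve_left hκ)
  set μ := ρ * (s (S.Y 1 y) - t * s (S.Y 0 y)) with hμ
  have hk'D : S.kerVecDeriv t y ∈ D y :=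
    S.kernelSpan_le hk hy (S.isSectionAt_kerVecDeriv hy t).self_of_nhds.2
  obtain ⟨σ, hσ⟩ := S.exists_eq_smul_kerVec hk hy (t := t)
    (v := κ • Z₂ y + μ • S.kerVecDeriv t y)
    (Submodule.add_mem _ (Submodule.smul_mem _ _ h2D.self_of_nhds.2)
      (Submodule.smul_mem _ _ hk'D)) (fun u hu => by
    have e := hZ₂ _ (hU (S.coords y u))
    rw [hp _ _ h2D (hU _), S.annihilator_apply_kerVec hy hs h1D (hU _) hρ,
      S.vec_coords hy hu] at e
    have e' := S.negExtDeriv_kerVecDeriv hy t hu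
    simp only [map_add, map_smul, add_apply, smul_apply, smul_eq_mul]
    linear_combination e + μ * e')
  have hZ2 : κ • Z₂ y = σ • S.kerVec t y - μ • S.kerVecDeriv t y := eq_sub_of_add_eq hσ
  have hθ : S.θt t y (W y) = 0 := by
    rw [hWx, S.θt_mlieBracket hk hy t h1 h2, hρ]
    refine (mul_eq_zero.1 ?_).resolve_left hκ
    have e : κ * negExtDeriv (S.θt t) y (ρ • S.kerVec t y) (Z₂ y) =
        negExtDeriv (S.θt t) y (ρ • S.kerVec t y) (κ • Z₂ y) :=
      (map_smul (negExtDeriv (S.θt t) y (ρ • S.kerVec t y)) κ (Z₂ y)).symm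
    rw [e, hZ2]
    rw [obstruction] at h
    simp only [map_sub, map_smul, smul_apply, negExtDeriv_self, h, smul_zero, sub_zero]
  rw [S.annihilator_apply_kerVec hy hr h1D hW hρ, ← S.θt_eq hy t hW.self_of_nhds.2, hθ, mul_zero]

/-- The witnesses are `Z₁ = X_t`, `Z₂ = X_t'`, `s = -β` and `r = β`, for which the conclusion of
`DegenerateAt` is the vanishing of the obstruction. -/
lemma not_degenerateAt (hk : ∀ y : N, kroneckerIndex I D y = 2) (hy : y ∈ S.dom)
    (h : S.obstruction t y ≠ 0) : ¬ DegenerateAt I D y (c.α y + t • c.β y) := by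
  intro hdeg
  have h1 := S.isSectionAt_kerVec hy t
  have h2 := S.isSectionAt_kerVecDeriv hy t
  have h1D := S.isSectionAt_kernelSpan hk hy h1
  have h2D := S.isSectionAt_kernelSpan hk hy h2
  have hbD := S.mlieBracket_mem_D hk hy h1 h2
  have hW := S.isSectionAt_vec_const hy
    (S.coords y (VectorField.mlieBracket I (S.kerVec t) (S.kerVecDeriv t) y))
  have hWx := S.vec_coords hy hbD
  have e := hdeg _ _ _ h1 h2 hW hWx (fun U hU => by
      rw [add_apply, smul_apply, smul_eq_mul, S.α_mlieBracket hy h1D hU, S.β_mlieBracket hy h1D hU]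
      exact S.negExtDeriv_kerVec hy t hU.self_of_nhds.2)
    (-c.β y) (Submodule.neg_mem _ (S.β_mem hy)) (fun U hU => by
      rw [add_apply, smul_apply, smul_eq_mul, neg_apply, S.α_mlieBracket hy h2D hU,
        S.β_mlieBracket hy h2D hU, S.β_mlieBracket hy h1D hU]
      exact S.negExtDeriv_kerVecDeriv hy t hU.self_of_nhds.2)
    (c.β y) (S.β_mem hy)
  rw [S.β_mlieBracket hy h1D hW, hWx, ← S.θt_eq hy t hbD, S.θt_mlieBracket hk hy t h1 h2] at e
  exact h e

end AdaptedFrame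

variable {D : ∀ y : N, Submodule ℝ (TangentSpace I y)} {x : N}

/-- The frame with the two forms exchanged. -/
def AffineChart.swap (c : AffineChart I D x) : AffineChart I D x where
  α := c.β
  β := c.α
  smooth_α := c.smooth_β
  smooth_β := c.smooth_α
  frame := c.frame.mono fun y hy => ⟨LinearIndependent.pair_symm_iff.1 hy.1,
    by rw [Set.pair_comm]; exact hy.2⟩

/-- The chart misses only the point `[β]`, which has coordinate 0 once the forms are exchanged. -/
lemma exists_isCoord (c : AffineChart I D x) (lam : ℙ ℝ (annihilator I D x)) :
    ∃ (c' : AffineChart I D x) (t : ℝ), c'.IsCoord t lam := by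
  induction lam using Projectivization.ind with
  | h p hp =>
  have hsp := c.frame.self_of_nhds.2
  obtain ⟨s, t, hst⟩ := Submodule.mem_span_pair.1 (hsp.symm.le p.2)
  have key : (Projectivization.mk ℝ p hp).submodule.map (annihilator I D x).subtype =
      Submodule.span ℝ {(p : TangentSpace I x →L[ℝ] ℝ)} := by
    rw [Projectivization.submodule_mk, Submodule.map_span, Set.image_singleton]
    rfl
  by_cases hs : s = 0
  · have ht : t ≠ 0 := by
      rintro rfl
      refine hp (Subtype.ext ?_)
      rw [← hst, hs, zero_smul, zero_smul, add_zero]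
      rfl
    refine ⟨c.swap, 0, ?_⟩
    rw [AffineChart.IsCoord, key, ← hst, hs]
    change Submodule.span ℝ {(0 : ℝ) • c.α x + t • c.β x} =
      Submodule.span ℝ {c.β x + (0 : ℝ) • c.α x}
    rw [zero_smul, zero_add, add_zero]
    exact Submodule.span_singleton_smul_eq (isUnit_iff_ne_zero.2 ht) _
  · refine ⟨c, t / s, ?_⟩
    rw [AffineChart.IsCoord, key, ← hst]
    have e : s • c.α x + t • c.β x = s • (c.α x + (t / s) • c.β x) := by
      rw [smul_add, smul_smul, mul_div_cancel₀ t hs]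
    rw [e]
    exact Submodule.span_singleton_smul_eq (isUnit_iff_ne_zero.2 hs) _

lemma AdaptedFrame.exists_isCoord_eq {c : AffineChart I D x} (S : AdaptedFrame D x c) (t : ℝ) :
    ∃ lam : ℙ ℝ (annihilator I D x), c.IsCoord t lam := by
  obtain ⟨p, hp, h0, -⟩ := S.exists_annihilator S.mem_dom 1 t
  have hp0 : p ≠ 0 := by
    rintro rfl
    exact zero_ne_one h0
  refine ⟨Projectivization.mk ℝ p hp0, ?_⟩
  rw [AffineChart.IsCoord, Projectivization.submodule_mk, Submodule.map_span, Set.image_singleton]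
  rw [one_smul] at hp
  rw [← hp]
  rfl

/-- The infimum of an empty set of naturals is 0, so the set must first be shown to be nonempty, by
means of `𝒜_4`. Then 0 is excluded in whichever chart realizes the minimum. -/
lemma one_le_wAt [FiniteDimensional ℝ E] (hE : Module.finrank ℝ E = 7)
    (hD : IsDistribution I D 5) (hk : ∀ y : N, kroneckerIndex I D y = 2)
    (hinv : ¬ InvolutiveAt I (kernelSpan I 2 D) x) (lam : ℙ ℝ (annihilator I D x)) :
    1 ≤ wAt I 2 D x lam := by
  obtain ⟨c₀⟩ := nonempty_affineChart hE hD x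
  obtain ⟨c, t, ht⟩ := exists_isCoord c₀ lam
  obtain ⟨S⟩ := nonempty_adaptedFrame hE hD c
  have hmem := Nat.sInf_mem (s := {r | ∃ (c : AffineChart I D x) (t : ℝ), c.IsCoord t lam ∧
    c.spaceA 2 r (x, t) ≠ lift I (kernelSpan I 2 D) (x, t)})
    ⟨4, c, t, ht, S.spaceA_four_ne hk S.mem_dom hinv t⟩
  refine Nat.one_le_iff_ne_zero.2 fun h0 => ?_
  rw [wAt] at h0
  rw [h0] at hmem
  obtain ⟨c', t', -, hne⟩ := hmem
  obtain ⟨S'⟩ := nonempty_adaptedFrame hE hD c'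
  exact hne (S'.spaceA_zero hk S'.mem_dom)

/-- If `D_3` is not involutive then `w = 1` and `i = 2` at some point of the fibre. -/
lemma exists_wAt_eq_one_iAt_eq_two [FiniteDimensional ℝ E] (hE : Module.finrank ℝ E = 7)
    (hD : IsDistribution I D 5) (hk : ∀ y : N, kroneckerIndex I D y = 2)
    (hinv : ¬ InvolutiveAt I (kernelSpan I 2 D) x) :
    ∃ lam : ℙ ℝ (annihilator I D x), wAt I 2 D x lam = 1 ∧ iAt I 2 D x lam = 2 := by
  obtain ⟨c⟩ := nonempty_affineChart hE hD x
  obtain ⟨S⟩ := nonempty_adaptedFrame hE hD c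
  obtain ⟨t, ht⟩ := S.exists_obstruction_ne_zero hk S.mem_dom hinv
  obtain ⟨lam, hlam⟩ := S.exists_isCoord_eq t
  have hw : wAt I 2 D x lam = 1 := le_antisymm
    (Nat.sInf_le ⟨c, t, hlam, S.spaceA_one_ne hk S.mem_dom ht⟩) (one_le_wAt hE hD hk hinv lam)
  refine ⟨lam, hw, ?_⟩
  have hmem := Nat.sInf_mem (s := {i | 1 ≤ i ∧ i ≤ 2 ∧ ∃ (c : AffineChart I D x) (t : ℝ),
    c.IsCoord t lam ∧ c.spaceA 2 (wAt I 2 D x lam) (x, t) ≤ c.filtK 2 i (x, t)})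
    ⟨2, by norm_num, le_rfl, c, t, hlam, S.spaceA_le hk S.mem_dom _⟩
  change 1 ≤ iAt I 2 D x lam ∧ iAt I 2 D x lam ≤ 2 ∧ ∃ (c : AffineChart I D x) (t : ℝ),
    c.IsCoord t lam ∧ c.spaceA 2 (wAt I 2 D x lam) (x, t) ≤ c.filtK 2 (iAt I 2 D x lam) (x, t)
    at hmem
  obtain ⟨h1, h2, c', t', hlam', hle⟩ := hmem
  refine le_antisymm h2 (Nat.succ_le_of_lt (lt_of_le_of_ne h1 fun h => ?_))
  rw [hw, ← h] at hle
  obtain ⟨S'⟩ := nonempty_adaptedFrame hE hD c'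
  -- The chart `c'` witnessing `i = 1` need not be `c`, but both represent the same line. The
  -- obstruction would vanish in `c'`, so `DegenerateAt` would hold for a nonzero multiple of the
  -- form of `c'`, contradicting its failure in `c`.
  have hspan : Submodule.span ℝ {c.α x + t • c.β x} =
      Submodule.span ℝ {c'.α x + t' • c'.β x} := hlam.symm.trans hlam'
  obtain ⟨κ, hκ⟩ := Submodule.mem_span_singleton.1
    (hspan ▸ Submodule.mem_span_singleton_self (c.α x + t • c.β x))
  have hnd := S.not_degenerateAt hk S.mem_dom ht
  rw [← hκ] at hnd
  refine hnd (S'.degenerateAt hk S'.mem_dom (S'.obstruction_eq_zero hk S'.mem_dom hle) ?_)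
  rintro rfl
  have h0 := congrArg (fun q : TangentSpace I x →L[ℝ] ℝ => q (S.Y 0 x)) hκ
  simp only [zero_smul, zero_apply, add_apply, smul_apply, (S.α_Y x S.mem_dom).1,
    (S.β_Y x S.mem_dom).1, smul_zero, add_zero] at h0
  exact zero_ne_one h0

theorem wInv_eq_one [FiniteDimensional ℝ E] (hE : Module.finrank ℝ E = 7)
    (hD : IsDistribution I D 5) (hk : ∀ y : N, kroneckerIndex I D y = 2)
    (hinv : ¬ InvolutiveAt I (kernelSpan I 2 D) x) : wInv I 2 D x = 1 := by
  obtain ⟨lam, hw, -⟩ := exists_wAt_eq_one_iAt_eq_two hE hD hk hinv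
  refine le_antisymm (Nat.sInf_le ⟨lam, hw⟩) ?_
  obtain ⟨lam', h⟩ := Nat.sInf_mem (s := Set.range (wAt I 2 D x)) ⟨1, lam, hw⟩
  rw [wInv, ← h]
  exact one_le_wAt hE hD hk hinv lam'

theorem iInv_eq_two [FiniteDimensional ℝ E] (hE : Module.finrank ℝ E = 7)
    (hD : IsDistribution I D 5) (hk : ∀ y : N, kroneckerIndex I D y = 2)
    (hinv : ¬ InvolutiveAt I (kernelSpan I 2 D) x) : iInv I 2 D x = 2 := by
  obtain ⟨lam, -, hi⟩ := exists_wAt_eq_one_iAt_eq_two hE hD hk hinv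
  have hle : ∀ i ∈ Set.range (iAt I 2 D x), i ≤ 2 := by
    rintro _ ⟨lam', rfl⟩
    rw [iAt]
    -- The bound by 2, needed for the supremum to be a maximum, holds also for the default value 0.
    rcases Set.eq_empty_or_nonempty {i | 1 ≤ i ∧ i ≤ 2 ∧ ∃ (c : AffineChart I D x) (t : ℝ),
      c.IsCoord t lam' ∧ c.spaceA 2 (wAt I 2 D x lam') (x, t) ≤ c.filtK 2 i (x, t)} with h | h
    · rw [h, Nat.sInf_empty]
      norm_num
    · exact (Nat.sInf_mem h).2.1
  exact le_antisymm (csSup_le ⟨2, lam, hi⟩ hle) (le_csSup ⟨2, hle⟩ ⟨lam, hi⟩)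

end Invariants

end CorankTwo

end

open CorankTwo in
theorem corollary2 {M : Type*} [TopologicalSpace M]
    [ChartedSpace (EuclideanSpace ℝ (Fin 7)) M] [IsManifold (𝓡 7) ∞ M]
    (D : ∀ q : M, Submodule ℝ (TangentSpace (𝓡 7) q))
    (hD : IsDistribution (𝓡 7) D 5)
    (hmax : ∀ q : M, kroneckerIndex (𝓡 7) D q = 2) :
    (∀ q : M, iInv (𝓡 7) 2 D q = 2 ∨ InvolutiveAt (𝓡 7) (kernelSpan (𝓡 7) 2 D) q) ∧
    (∀ q : M, ¬ InvolutiveAt (𝓡 7) (kernelSpan (𝓡 7) 2 D) q → wInv (𝓡 7) 2 D q = 1) :=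
  ⟨fun _ => or_iff_not_imp_right.2 fun h => iInv_eq_two (by simp) hD hmax h,
    fun _ h => wInv_eq_one (by simp) hD hmax h⟩
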